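/- Let $n\in\mathbb N$ and let $J=\begin{pmatrix}0&1\\-1&0\end{pmatrix}$. Matrices carry the Euclidean (Frobenius) norm $\|\cdot\|$. For $X\in\mathbb{R}^{n\times 2}$ let $X^{ab}$ be the $2\times2$ matrix formed by the $a$-th and $b$-th rows of $X$, and let \[ \mathcal{A}(X)=\sqrt{1+\|X\|^2+\sum_{1\le a\le b\le n}\det(X^{ab})^2} \] be the area integrand. For $f\in C^1(\mathbb{R}^{n\times2})$ let \[ C_f=\left\{\begin{pmatrix}X\\ Df(X)J\\ X^TDf(X)J-f(X)J\end{pmatrix} : X\in\mathbb{R}^{n\times 2}\right\}\subset\mathbb{R}^{(2n+2)\times 2}. \] For every $R>0$ there exists $\varepsilon=\varepsilon(R)>0$ (depending only on $n$ and $R$) with the following property. Let $k\ge 2$ and let $f:\mathbb{R}^{n\times 2}\to\mathbb{R}$ be a function of class $C^k$ with \[ \|f-\mathcal{A}\|_{C^2(B_{2R}(0))}\le\varepsilon . \] Let $\Omega\subset\mathbb{R}^2$ be open and let $\mathcal{U}\in W^{1,\infty}(\Omega;\mathbb{R}^{2n+2})$ satisfy $\|D\mathcal{U}\|_{L^\infty(\Omega)}\le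 R$ and \[ D\mathcal{U}(x)\in C_f\quad\text{for a.e. }x\in\Omega . \] Then there is $\rho>0$ such that $\mathcal{U}\in W^{2,2+\rho}_{\mathrm{loc}}(\Omega;\mathbb{R}^{2n+2})$, i.e. $\mathcal U\in W^{2,2+\rho}(\Omega';\mathbb{R}^{2n+2})$ for every open $\Omega'$ whose closure is a compact subset of $\Omega$. -/

import Mathlib

open MeasureTheory
open scoped ENNReal ContDiff Matrix

/-! The norm of a matrix is the Euclidean (Frobenius) norm throughout. -/

attribute [local instance] Matrix.frobeniusNormedAddCommGroup Matrix.frobeniusNormedSpace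

noncomputable section

/-- The symplectic matrix `J`. -/
def matJ : Matrix (Fin 2) (Fin 2) ℝ := !![0, 1; -1, 0]

/-- The `2 × 2` submatrix of `X` consisting of its rows `a` and `b`. -/
def rowPair {n : ℕ} (X : Matrix (Fin n) (Fin 2) ℝ) (a b : Fin n) : Matrix (Fin 2) (Fin 2) ℝ :=
  X.submatrix ![a, b] id

/-- The area integrand `𝓐(X) = √(1 + ‖X‖² + ∑_{a ≤ b} det(X^{ab})²)`. -/
def areaFun {n : ℕ} (X : Matrix (Fin n) (Fin 2) ℝ) : ℝ :=
  √(1 + ‖X‖ ^ 2 + ∑ a : Fin n, ∑ b ∈ Finset.Ici a, (rowPair X a b).det ^ 2)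

/-- `Df(X)` as an `n × 2` matrix: its `(i, j)` entry is the partial derivative of `f` in the
direction of the `(i, j)` matrix unit. -/
def matGrad {n : ℕ} (f : Matrix (Fin n) (Fin 2) ℝ → ℝ) (X : Matrix (Fin n) (Fin 2) ℝ) :
    Matrix (Fin n) (Fin 2) ℝ :=
  Matrix.of fun i j => fderiv ℝ f X (Matrix.single i j 1)

/-- `A_f(X) = Df(X) J`. -/
def matA {n : ℕ} (f : Matrix (Fin n) (Fin 2) ℝ → ℝ) (X : Matrix (Fin n) (Fin 2) ℝ) :
    Matrix (Fin n) (Fin 2) ℝ :=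
  matGrad f X * matJ

/-- `B_f(X) = Xᵀ Df(X) J - f(X) J`. -/
def matB {n : ℕ} (f : Matrix (Fin n) (Fin 2) ℝ → ℝ) (X : Matrix (Fin n) (Fin 2) ℝ) :
    Matrix (Fin 2) (Fin 2) ℝ :=
  Xᵀ * matGrad f X * matJ - f X • matJ

/-- The index set of the `2n + 2` coordinates of `𝓤 = (u, v, w)`, grouped in the three blocks
`u ∈ ℝⁿ`, `v ∈ ℝⁿ`, `w ∈ ℝ²`. -/
abbrev BlockIdx (n : ℕ) : Type := Fin n ⊕ (Fin n ⊕ Fin 2)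

/-- The set `C_f` of all `(2n + 2) × 2` matrices with blocks `X`, `A_f(X)`, `B_f(X)`. -/
def inclusionSet {n : ℕ} (f : Matrix (Fin n) (Fin 2) ℝ → ℝ) :
    Set (Matrix (BlockIdx n) (Fin 2) ℝ) :=
  {Y | ∃ X : Matrix (Fin n) (Fin 2) ℝ,
    Y = Matrix.fromRows X (Matrix.fromRows (matA f X) (matB f X))}

/-- The `C²` norm of `g` on `s`: the sum over `i = 0, 1, 2` of the supremum over `s` of the norm
of the `i`-th derivative of `g`. -/
def c2Norm {n : ℕ} (g : Matrix (Fin n) (Fin 2) ℝ → ℝ) (s : Set (Matrix (Fin n) (Fin 2) ℝ)) :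
    ℝ≥0∞ :=
  ∑ i ∈ Finset.range 3, ⨆ X ∈ s, ‖iteratedFDeriv ℝ i g X‖ₑ

/-- The plane, with its Euclidean norm. -/
abbrev Plane : Type := EuclideanSpace ℝ (Fin 2)

/-- `v` is the weak partial derivative `∂u/∂x_j` on the open set `Ω`. -/
def HasWeakPartial (Ω : Set Plane) (j : Fin 2) (u v : Plane → ℝ) : Prop :=
  LocallyIntegrableOn u Ω ∧ LocallyIntegrableOn v Ω ∧
    ∀ φ : Plane → ℝ, ContDiff ℝ ∞ φ → HasCompactSupport φ → tsupport φ ⊆ Ω →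
      ∫ x in Ω, u x * fderiv ℝ φ x (EuclideanSpace.single j 1) = -∫ x in Ω, v x * φ x

/-- The Sobolev space `W^{k,p}(Ω)` of real functions: all iterated weak partial derivatives of
order at most `k` exist and lie in `L^p(Ω)`. -/
def MemSobolev : ℕ → ℝ≥0∞ → Set Plane → (Plane → ℝ) → Prop
  | 0, p, Ω, u => MemLp u p (volume.restrict Ω)
  | k + 1, p, Ω, u => MemLp u p (volume.restrict Ω) ∧
      ∀ j : Fin 2, ∃ v : Plane → ℝ, HasWeakPartial Ω j u v ∧ MemSobolev k p Ω v

/-- The space `W^{k,p}(Ω; ℝ^ι)` of vector-valued functions. -/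
def MemSobolevVec {ι : Type} [Fintype ι] (k : ℕ) (p : ℝ≥0∞) (Ω : Set Plane)
    (U : Plane → EuclideanSpace ℝ ι) : Prop :=
  ∀ i : ι, MemSobolev k p Ω (fun x => U x i)

/-- The space `W^{k,p}_loc(Ω; ℝ^ι)`: membership in `W^{k,p}(Ω'; ℝ^ι)` for every open `Ω'` whose
closure is a compact subset of `Ω`. -/
def MemSobolevVecLoc {ι : Type} [Fintype ι] (k : ℕ) (p : ℝ≥0∞) (Ω : Set Plane)
    (U : Plane → EuclideanSpace ℝ ι) : Prop :=
  ∀ Ω' : Set Plane, IsOpen Ω' → IsCompact (closure Ω') → closure Ω' ⊆ Ω → MemSobolevVec k p Ω' U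

/-- The matrix field `DU` is the weak differential of `U` on `Ω`. -/
def HasWeakGradient {ι : Type} [Fintype ι] (Ω : Set Plane) (U : Plane → EuclideanSpace ℝ ι)
    (DU : Plane → Matrix ι (Fin 2) ℝ) : Prop :=
  ∀ (i : ι) (j : Fin 2), HasWeakPartial Ω j (fun x => U x i) (fun x => DU x i j)

end

/-! The set $C_f$ is uniformly elliptic with respect to a null Lagrangian. There is a quadratic form
$q$ in the $2\times2$ minors and a $c>0$ with $c\|Z\|^2\le q(Z)$ for all differences $Z$ of two
points of $C_f$ whose $X$-blocks lie in the ball of radius $R$ (`exists_elliptic`).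

For the area this is explicit (`elliptic_areaFun`). With $g=I+X^TX$ and $P=\sqrt{\det g}\,g^{-1}$, a
symmetric positive matrix of determinant one, the blocks are $X$, $XPJ$ and $-PJ$. The minors
pairing $u$ with $v$ give $\langle X-Y,\,XP-YP'\rangle$. This controls $\|X-Y\|^2$ up to a multiple
of $\|P-P'\|^2$, and that error is absorbed by a large multiple of $-\det(P-P')$, the minor of the
$w$-block. A $C^2$-small perturbation of the integrand changes the block map by a map of small
Lipschitz constant, so ellipticity survives.

Difference quotients of $\mathcal U$ have gradients in the elliptic set up to scaling. Since $q$ is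
a null Lagrangian, integration by parts gives a Caccioppoli inequality (`caccioppoli`). Combined
with the Sobolev-Poincaré inequality $W^{1,1}\to L^2$ in the plane, it becomes a reverse Hölder
inequality (`reverseHolder_of_limit`), and `gehring` raises the exponent to $2+\rho$. The resulting
bound does not depend on the step of the difference quotient (`exists_lintegral_diffQuot_le`), so a
weak limit produces the second derivatives in $L^{2+\rho}$ (`exists_weak_partial_of_diffQuot`). Both
$q$ and $c$, hence also $\rho$, are fixed before $f$ and $\mathcal U$. -/

noncomputable section

/-! ### Frobenius norm and quadratic forms in the minors. -/

section MatrixNorm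

variable {ι : Type} [Fintype ι]

theorem frobenius_norm_sq (Z : Matrix ι (Fin 2) ℝ) : ‖Z‖ ^ 2 = ∑ a, (Z a 0 ^ 2 + Z a 1 ^ 2) := by
  rw [Matrix.frobenius_norm_def, ← Real.rpow_natCast, ← Real.rpow_mul (by positivity)]
  norm_num

theorem abs_entry_le_norm (Z : Matrix ι (Fin 2) ℝ) (a : ι) (j : Fin 2) : |Z a j| ≤ ‖Z‖ := by
  apply abs_le_of_sq_le_sq _ (norm_nonneg _)
  rw [frobenius_norm_sq]
  have h := Finset.single_le_sum (f := fun a => Z a 0 ^ 2 + Z a 1 ^ 2)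
    (fun i _ => by positivity) (Finset.mem_univ a)
  refine le_trans ?_ h
  fin_cases j
  · simpa using sq_nonneg (Z a 1)
  · simpa using sq_nonneg (Z a 0)

theorem norm_le_sum_abs_entry (Z : Matrix ι (Fin 2) ℝ) : ‖Z‖ ≤ ∑ a, (|Z a 0| + |Z a 1|) := by
  apply le_of_sq_le_sq _ (Finset.sum_nonneg fun a _ => by positivity)
  rw [frobenius_norm_sq]
  refine le_trans (Finset.sum_le_sum (g := fun a => (|Z a 0| + |Z a 1|) ^ 2) fun a _ => ?_)
    (Finset.sum_sq_le_sq_sum_of_nonneg fun a _ => by positivity)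
  nlinarith [sq_abs (Z a 0), sq_abs (Z a 1), abs_nonneg (Z a 0), abs_nonneg (Z a 1)]

theorem norm_single_le (a : ι) [DecidableEq ι] (j : Fin 2) :
    ‖(Matrix.single a j 1 : Matrix ι (Fin 2) ℝ)‖ ≤ 1 := by
  refine (norm_le_sum_abs_entry _).trans ?_
  fin_cases j <;> simp [Matrix.single_apply, apply_ite abs]

/-- The quadratic form `∑ q_{ab} det Z^{ab}` in the `2 × 2` minors of `Z`. -/
def minorForm (q : ι → ι → ℝ) (Z : Matrix ι (Fin 2) ℝ) : ℝ :=
  ∑ a, ∑ b, q a b * (Z a 0 * Z b 1 - Z a 1 * Z b 0)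

/-- Expanding the minors leaves only terms containing an entry of `T`, and entries are bounded by
norms. This stability serves twice: for passing from the area to a nearby integrand, and for the
error made by a cutoff function. -/
theorem minorForm_add_ge (q : ι → ι → ℝ) (S T : Matrix ι (Fin 2) ℝ) :
    minorForm q S - (2 * ∑ a, ∑ b, |q a b|) * (2 * ‖S‖ * ‖T‖ + ‖T‖ ^ 2)
      ≤ minorForm q (S + T) := by
  have key : ∀ a b, q a b * (S a 0 * S b 1 - S a 1 * S b 0)
      - 2 * |q a b| * (2 * ‖S‖ * ‖T‖ + ‖T‖ ^ 2)
      ≤ q a b * ((S + T) a 0 * (S + T) b 1 - (S + T) a 1 * (S + T) b 0) := by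
    intro a b
    have e : q a b * (S a 0 * S b 1 - S a 1 * S b 0)
        - q a b * ((S + T) a 0 * (S + T) b 1 - (S + T) a 1 * (S + T) b 0)
        = q a b * (-(S a 0 * T b 1) + -(T a 0 * S b 1) + -(T a 0 * T b 1) + S a 1 * T b 0
          + T a 1 * S b 0 + T a 1 * T b 0) := by
      simp only [Matrix.add_apply]; ring
    have hm : ∀ x y p q : ℝ, |x| ≤ p → |y| ≤ q → |x * y| ≤ p * q := by
      intro x y p q hx hy
      rw [abs_mul]; exact mul_le_mul hx hy (abs_nonneg _) ((abs_nonneg _).trans hx)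
    have hS := abs_entry_le_norm S
    have hT := abs_entry_le_norm T
    have h1 := abs_le.1 (hm _ _ _ _ (hS a 0) (hT b 1))
    have h2 := abs_le.1 (hm _ _ _ _ (hT a 0) (hS b 1))
    have h3 := abs_le.1 (hm _ _ _ _ (hT a 0) (hT b 1))
    have h4 := abs_le.1 (hm _ _ _ _ (hS a 1) (hT b 0))
    have h5 := abs_le.1 (hm _ _ _ _ (hT a 1) (hS b 0))
    have h6 := abs_le.1 (hm _ _ _ _ (hT a 1) (hT b 0))
    have hb : |-(S a 0 * T b 1) + -(T a 0 * S b 1) + -(T a 0 * T b 1) + S a 1 * T b 0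
          + T a 1 * S b 0 + T a 1 * T b 0| ≤ 2 * (2 * ‖S‖ * ‖T‖ + ‖T‖ ^ 2) := by
      rw [abs_le]; constructor <;> nlinarith
    have := (le_abs_self _).trans (hm _ _ _ _ (le_refl |q a b|) hb)
    linarith
  have := Finset.sum_le_sum fun a (_ : a ∈ Finset.univ) =>
    Finset.sum_le_sum fun b (_ : b ∈ Finset.univ) => key a b
  simp only [Finset.sum_sub_distrib, ← Finset.sum_mul, ← Finset.mul_sum] at this
  exact this

end MatrixNorm

/-! ### The area integrand -/

section Area

variable {n : ℕ}

/-- The entry `∑ x_i0 ^ 2`, `∑ x_i0 x_i1`, `∑ x_i1 ^ 2` of `Xᵀ X`. -/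
def gram (X : Matrix (Fin n) (Fin 2) ℝ) (i j : Fin 2) : ℝ := ∑ a, X a i * X a j

theorem gram_self_nonneg (X : Matrix (Fin n) (Fin 2) ℝ) (i : Fin 2) : 0 ≤ gram X i i :=
  Finset.sum_nonneg fun _ _ => mul_self_nonneg _

theorem gram_self_le (X : Matrix (Fin n) (Fin 2) ℝ) (i : Fin 2) : gram X i i ≤ ‖X‖ ^ 2 := by
  rw [frobenius_norm_sq]
  refine Finset.sum_le_sum fun a _ => ?_
  fin_cases i <;> simp <;> nlinarith [sq_nonneg (X a 0), sq_nonneg (X a 1)]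

/-- Lagrange's identity. The sum over $a\le b$ is half the full double sum, because the summand is
symmetric and vanishes on the diagonal. -/
theorem sum_sq_minors (x y : Fin n → ℝ) :
    ∑ a : Fin n, ∑ b ∈ Finset.Ici a, (x a * y b - y a * x b) ^ 2
      = (∑ a, x a * x a) * (∑ a, y a * y a) - (∑ a, x a * y a) ^ 2 := by
  set F : Fin n → Fin n → ℝ := fun a b => (x a * y b - y a * x b) ^ 2
  have hsym : ∀ a b, F a b = F b a := fun a b => by simp only [F]; ring
  have htot : ∑ a, ∑ b, F a b
      = 2 * ((∑ a, x a * x a) * (∑ a, y a * y a) - (∑ a, x a * y a) ^ 2) := by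
    have : ∀ a b, F a b = (x a * x a) * (y b * y b) + (y a * y a) * (x b * x b)
        - 2 * ((x a * y a) * (x b * y b)) := fun a b => by simp only [F]; ring
    simp only [this, Finset.sum_sub_distrib, Finset.sum_add_distrib, ← Finset.mul_sum,
      ← Finset.sum_mul]
    ring
  have h1 : ∀ a, ∑ b, F a b = ∑ b ∈ Finset.Ici a, F a b + ∑ b ∈ Finset.Iic a, F a b := by
    intro a
    have hI : ∑ b ∈ Finset.Iic a, F a b = ∑ b ∈ Finset.Iio a, F a b := by
      rw [← Finset.Iio_insert, Finset.sum_insert (by simp)]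
      simp [F, mul_comm]
    rw [hI, ← Finset.sum_union]
    · congr 1; ext b; simp [le_or_gt]
    · rw [Finset.disjoint_left]; intro b; simp
  have h2 : ∑ a, ∑ b ∈ Finset.Iic a, F a b = ∑ a, ∑ b ∈ Finset.Ici a, F a b := by
    rw [Finset.sum_comm' (t' := Finset.univ) (s' := fun b => Finset.Ici b) (by simp)]
    exact Finset.sum_congr rfl fun a _ => Finset.sum_congr rfl fun b _ => hsym _ _
  simp only [h1, Finset.sum_add_distrib, h2] at htot
  change ∑ a, ∑ b ∈ Finset.Ici a, F a b = _
  linarith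

/-- The radicand is $\det(I+X^TX)$, so only the three Gram entries matter from here on. -/
theorem areaFun_eq (X : Matrix (Fin n) (Fin 2) ℝ) :
    areaFun X = √((1 + gram X 0 0) * (1 + gram X 1 1) - gram X 0 1 ^ 2) := by
  have h : ∀ a b, (rowPair X a b).det = X a 0 * X b 1 - X a 1 * X b 0 := by
    intro a b; rw [Matrix.det_fin_two]; simp [rowPair]
  have h2 := sum_sq_minors (fun a => X a 0) (fun a => X a 1)
  simp only [areaFun, h, frobenius_norm_sq, Finset.sum_add_distrib]
  rw [h2]
  simp only [gram, pow_two]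
  congr 1; ring

theorem one_le_area_sq (X : Matrix (Fin n) (Fin 2) ℝ) :
    1 ≤ (1 + gram X 0 0) * (1 + gram X 1 1) - gram X 0 1 ^ 2 := by
  have h2 := sum_sq_minors (fun a => X a 0) (fun a => X a 1)
  have h3 : 0 ≤ gram X 0 0 * gram X 1 1 - gram X 0 1 ^ 2 := by
    simp only [gram]
    rw [← h2]
    positivity
  nlinarith [gram_self_nonneg X 0, gram_self_nonneg X 1]

theorem contDiff_entry (a : Fin n) (i : Fin 2) {m : WithTop ℕ∞} :
    ContDiff ℝ m (fun X : Matrix (Fin n) (Fin 2) ℝ => X a i) :=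
  (Matrix.entryLinearMap ℝ ℝ a i).toContinuousLinearMap.contDiff

theorem contDiff_gram (i j : Fin 2) {m : WithTop ℕ∞} :
    ContDiff ℝ m (fun X : Matrix (Fin n) (Fin 2) ℝ => gram X i j) :=
  ContDiff.sum fun a _ => (contDiff_entry a i).mul (contDiff_entry a j)

theorem contDiff_area_sq {m : WithTop ℕ∞} :
    ContDiff ℝ m (fun X : Matrix (Fin n) (Fin 2) ℝ =>
      (1 + gram X 0 0) * (1 + gram X 1 1) - gram X 0 1 ^ 2) :=
  ((contDiff_const.add (contDiff_gram 0 0)).mul (contDiff_const.add (contDiff_gram 1 1))).sub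
    ((contDiff_gram 0 1).pow 2)

theorem contDiff_areaFun {m : WithTop ℕ∞} :
    ContDiff ℝ m (areaFun : Matrix (Fin n) (Fin 2) ℝ → ℝ) := by
  rw [show (areaFun : Matrix (Fin n) (Fin 2) ℝ → ℝ) = _ from funext areaFun_eq]
  exact contDiff_area_sq.sqrt fun X => (zero_lt_one.trans_le (one_le_area_sq X)).ne'

theorem one_le_areaFun (X : Matrix (Fin n) (Fin 2) ℝ) : 1 ≤ areaFun X := by
  rw [areaFun_eq]; exact Real.one_le_sqrt.2 (one_le_area_sq X)

theorem areaFun_sq (X : Matrix (Fin n) (Fin 2) ℝ) :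
    areaFun X ^ 2 = (1 + gram X 0 0) * (1 + gram X 1 1) - gram X 0 1 ^ 2 := by
  rw [areaFun_eq]; exact Real.sq_sqrt (zero_le_one.trans (one_le_area_sq X))

theorem hasDerivAt_gram (X V : Matrix (Fin n) (Fin 2) ℝ) (i j : Fin 2) :
    HasDerivAt (fun t : ℝ => gram (X + t • V) i j) (∑ a, (V a i * X a j + X a i * V a j)) 0 := by
  simp only [gram]
  refine HasDerivAt.fun_sum fun a _ => ?_
  have h : ∀ k, HasDerivAt (fun t : ℝ => (X + t • V) a k) (V a k) 0 := fun k => by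
    simpa using ((hasDerivAt_id (0 : ℝ)).mul_const (V a k)).const_add (X a k)
  simpa using (h i).fun_mul (h j)

theorem fderiv_areaFun (X V : Matrix (Fin n) (Fin 2) ℝ) :
    fderiv ℝ areaFun X V =
      ((∑ a, X a 0 * V a 0) * (1 + gram X 1 1) + (1 + gram X 0 0) * (∑ a, X a 1 * V a 1)
        - gram X 0 1 * ∑ a, (V a 0 * X a 1 + X a 0 * V a 1)) / areaFun X := by
  have hd : DifferentiableAt ℝ areaFun X := contDiff_areaFun.differentiable one_ne_zero X
  have h1 : HasDerivAt (fun t : ℝ => areaFun (X + t • V)) (fderiv ℝ areaFun X V) 0 := by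
    have hl : HasDerivAt (fun t : ℝ => X + t • V) V 0 := by
      have := ((hasDerivAt_id (0 : ℝ)).smul_const V).const_add X
      rwa [one_smul] at this
    have hX : X + (0 : ℝ) • V = X := by simp
    have hf : HasFDerivAt areaFun (fderiv ℝ areaFun X) (X + (0 : ℝ) • V) := by
      rw [hX]; exact hd.hasFDerivAt
    exact hf.comp_hasDerivAt (0 : ℝ) hl
  have h2 := ((((hasDerivAt_gram X V 0 0).const_add 1).mul
    ((hasDerivAt_gram X V 1 1).const_add 1)).sub ((hasDerivAt_gram X V 0 1).pow 2)).sqrt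
    (by simpa using (zero_lt_one.trans_le (one_le_area_sq X)).ne')
  simp only [areaFun_eq] at h1
  have h3 := h1.unique h2
  rw [h3, areaFun_eq]
  simp only [zero_smul, add_zero]
  have e0 : ∀ i, ∑ a, (V a i * X a i + X a i * V a i) = 2 * ∑ a, X a i * V a i := fun i => by
    rw [Finset.mul_sum]; exact Finset.sum_congr rfl fun a _ => by ring
  simp only [Pi.mul_apply, Pi.sub_apply, Pi.pow_apply, zero_smul, add_zero, e0]
  rw [div_eq_div_iff]
  · push_cast; ring
  · have := one_le_areaFun X; rw [areaFun_eq] at this; positivity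
  · have := one_le_areaFun X; rw [areaFun_eq] at this; positivity

/-- The matrix `√(det g) g⁻¹` for `g = I + Xᵀ X`. -/
def conformalGram (X : Matrix (Fin n) (Fin 2) ℝ) : Matrix (Fin 2) (Fin 2) ℝ :=
  (areaFun X)⁻¹ • !![1 + gram X 1 1, -gram X 0 1; -gram X 0 1, 1 + gram X 0 0]

/-- This is $d\sqrt{\det g}=\tfrac12\sqrt{\det g}\,\operatorname{tr}(g^{-1}dg)$ with $g=I+X^TX$. -/
theorem matGrad_areaFun (X : Matrix (Fin n) (Fin 2) ℝ) :
    matGrad areaFun X = X * conformalGram X := by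
  ext i j
  have := (zero_lt_one.trans_le (one_le_areaFun X)).ne'
  simp only [matGrad, Matrix.of_apply, fderiv_areaFun, Matrix.mul_apply, Fin.sum_univ_two,
    conformalGram, Matrix.smul_apply, smul_eq_mul]
  fin_cases j <;> simp [Matrix.single_apply] <;> field_simp <;> ring

theorem matA_areaFun (X : Matrix (Fin n) (Fin 2) ℝ) :
    matA areaFun X = X * conformalGram X * matJ := by rw [matA, matGrad_areaFun]

theorem matB_areaFun (X : Matrix (Fin n) (Fin 2) ℝ) :
    matB areaFun X = -(conformalGram X * matJ) := by
  have h0 := (zero_lt_one.trans_le (one_le_areaFun X)).ne'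
  have h1 := areaFun_sq X
  -- Because $X^TX=g-I$ and $gP=\sqrt{\det g}\,I$. The multiple of the identity then cancels against
  -- $f(X)J$.
  have : Xᵀ * matGrad areaFun X = areaFun X • 1 - conformalGram X := by
    rw [matGrad_areaFun, ← Matrix.mul_assoc]
    have hg : Xᵀ * X = !![gram X 0 0, gram X 0 1; gram X 0 1, gram X 1 1] := by
      ext i j
      fin_cases i <;> fin_cases j <;> simp [Matrix.mul_apply, gram, mul_comm]
    rw [hg]
    ext i j
    fin_cases i <;> fin_cases j <;> simp [conformalGram, Matrix.mul_apply] <;> field_simp <;>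
      nlinarith
  rw [matB, this, Matrix.sub_mul, Matrix.smul_mul, Matrix.one_mul]
  abel

end Area

/-! ### Ellipticity of the area integrand with respect to a null Lagrangian. -/

section Ellipticity

/-- The eigenvalues of the matrix have product one and sum at most $2L$, so the smaller one is at
least $1/(2L)$. -/
theorem quadForm_ge {p r s L : ℝ} (hp : 0 < p) (hs : 0 < s) (hpL : p ≤ L) (hsL : s ≤ L)
    (hdet : p * s - r ^ 2 = 1) (x y : ℝ) :
    (x ^ 2 + y ^ 2) / (2 * L) ≤ x * (x * p + y * r) + y * (x * r + y * s) := by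
  have hL : 0 < L := hp.trans_le hpL
  rw [div_le_iff₀ (by positivity)]
  -- Cayley-Hamilton, $(\operatorname{tr}P)P=P^2+I$, evaluated as a quadratic form.
  have e : (p + s) * (x * (x * p + y * r) + y * (x * r + y * s))
      = x ^ 2 + y ^ 2 + (x * p + y * r) ^ 2 + (x * r + y * s) ^ 2 := by
    linear_combination (x ^ 2 + y ^ 2) * hdet
  have h1 : x ^ 2 + y ^ 2 ≤ (p + s) * (x * (x * p + y * r) + y * (x * r + y * s)) := by
    rw [e]; nlinarith [sq_nonneg (x * p + y * r), sq_nonneg (x * r + y * s)]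
  have h2 : 0 ≤ x * (x * p + y * r) + y * (x * r + y * s) := by
    by_contra hneg
    push Not at hneg
    nlinarith [mul_neg_of_pos_of_neg (add_pos hp hs) hneg, sq_nonneg x, sq_nonneg y]
  nlinarith

/-- The positive symmetric matrices of determinant one form a sheet of a hyperboloid for the
Lorentzian form $\det$, and its chords are spacelike. Quantitatively, $-\det(P-P')$ times a product
of diagonal entries is a sum of two squares, one of them the squared difference of these entries.
The off-diagonal difference is recovered from the determinant itself. -/
theorem neg_det_sub_ge {p r s p' r' s' L : ℝ} (hp : 0 < p) (hs : 0 < s) (hp' : 0 < p')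
    (_hs' : 0 < s') (hpL : p ≤ L) (hsL : s ≤ L) (hpL' : p' ≤ L) (hsL' : s' ≤ L)
    (hdet : p * s - r ^ 2 = 1) (hdet' : p' * s' - r' ^ 2 = 1) :
    (p - p') ^ 2 + 2 * (r - r') ^ 2 + (s - s') ^ 2
      ≤ (2 + 4 * L ^ 2) * -((p - p') * (s - s') - (r - r') ^ 2) := by
  set T := -((p - p') * (s - s') - (r - r') ^ 2) with hT
  have hL : 0 < L := hp.trans_le hpL
  have e1 : T * (p * p') = (r * p' - r' * p) ^ 2 + (p - p') ^ 2 := by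
    rw [hT]; linear_combination (p' ^ 2 - p' * p) * hdet + (p ^ 2 - p * p') * hdet'
  have e2 : T * (s * s') = (r * s' - r' * s) ^ 2 + (s - s') ^ 2 := by
    rw [hT]; linear_combination (s' ^ 2 - s' * s) * hdet + (s ^ 2 - s * s') * hdet'
  have hT0 : 0 ≤ T := by
    by_contra hneg
    push Not at hneg
    nlinarith [mul_neg_of_neg_of_pos hneg (mul_pos hp hp'), sq_nonneg (r * p' - r' * p),
      sq_nonneg (p - p')]
  have h1 : (p - p') ^ 2 ≤ L ^ 2 * T := by
    have : p * p' ≤ L ^ 2 := by nlinarith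
    nlinarith [sq_nonneg (r * p' - r' * p)]
  have h2 : (s - s') ^ 2 ≤ L ^ 2 * T := by
    have : s * s' ≤ L ^ 2 := by nlinarith
    nlinarith [sq_nonneg (r * s' - r' * s)]
  have h3 : (r - r') ^ 2 = T + (p - p') * (s - s') := by rw [hT]; ring
  nlinarith [sq_nonneg ((p - p') - (s - s'))]

/-- For a single row, $xP-x'P'=(x-x')P+x'(P-P')$. The first part is coercive by `quadForm_ge`, and
half of that coercivity pays for the second part through Young's inequality. -/
theorem row_ge {p r s p' r' s' L : ℝ} (hp : 0 < p) (hs : 0 < s) (hpL : p ≤ L) (hsL : s ≤ L)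
    (hdet : p * s - r ^ 2 = 1) (x y x' y' : ℝ) :
    ((x - x') ^ 2 + (y - y') ^ 2) / (4 * L)
        - L * ((p - p') ^ 2 + 2 * (r - r') ^ 2 + (s - s') ^ 2) * (x' ^ 2 + y' ^ 2)
      ≤ (x - x') * ((x * p + y * r) - (x' * p' + y' * r'))
        + (y - y') * ((x * r + y * s) - (x' * r' + y' * s')) := by
  have hL : 0 < L := hp.trans_le hpL
  have h1 := quadForm_ge hp hs hpL hsL hdet (x - x') (y - y')
  set a := p - p' with ha
  set b := r - r' with hb
  set c := s - s' with hc
  set z := x - x' with hz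
  set w := y - y' with hw
  have e : z * ((x * p + y * r) - (x' * p' + y' * r')) + w * ((x * r + y * s) - (x' * r' + y' * s'))
      = z * (z * p + w * r) + w * (z * r + w * s) + (z * (x' * a + y' * b) + w * (x' * b + y' * c)) := by
    rw [ha, hb, hc, hz, hw]; ring
  rw [e]
  have h2 : ∀ u v : ℝ, -(u ^ 2 / (4 * L) + L * v ^ 2) ≤ u * v := by
    intro u v
    have : u ^ 2 / (4 * L) + L * v ^ 2 + u * v = (u + 2 * L * v) ^ 2 / (4 * L) := by
      field_simp; ring
    have h3 : 0 ≤ (u + 2 * L * v) ^ 2 / (4 * L) := by positivity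
    linarith
  have h3 := h2 z (x' * a + y' * b)
  have h4 := h2 w (x' * b + y' * c)
  have h5 : (x' * a + y' * b) ^ 2 + (x' * b + y' * c) ^ 2
      ≤ (a ^ 2 + 2 * b ^ 2 + c ^ 2) * (x' ^ 2 + y' ^ 2) := by
    nlinarith [sq_nonneg (x' * b - y' * a), sq_nonneg (x' * c - y' * b)]
  have h6 := mul_le_mul_of_nonneg_left h5 hL.le
  have h7 : (z ^ 2 + w ^ 2) / (2 * L) = (z ^ 2 + w ^ 2) / (4 * L) + z ^ 2 / (4 * L)
      + w ^ 2 / (4 * L) := by field_simp; ring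
  linarith

variable {n : ℕ}

theorem conformalGram_spec {R : ℝ} (X : Matrix (Fin n) (Fin 2) ℝ) (hX : ‖X‖ ≤ R) :
    0 < conformalGram X 0 0 ∧ 0 < conformalGram X 1 1 ∧ conformalGram X 0 0 ≤ 1 + R ^ 2 ∧
      conformalGram X 1 1 ≤ 1 + R ^ 2 ∧ conformalGram X 1 0 = conformalGram X 0 1 ∧
      conformalGram X 0 0 * conformalGram X 1 1 - conformalGram X 0 1 ^ 2 = 1 := by
  have hA := one_le_areaFun X
  have hA0 : 0 < areaFun X := zero_lt_one.trans_le hA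
  have hsq := areaFun_sq X
  have h0 := gram_self_nonneg X 0
  have h1 := gram_self_nonneg X 1
  have hR : ‖X‖ ^ 2 ≤ R ^ 2 := by gcongr
  have h0' := (gram_self_le X 0).trans hR
  have h1' := (gram_self_le X 1).trans hR
  have hi : (areaFun X)⁻¹ ≤ 1 := inv_le_one_of_one_le₀ hA
  simp only [conformalGram, Matrix.smul_apply, smul_eq_mul, Matrix.of_apply, Matrix.cons_val',
    Matrix.cons_val_zero, Matrix.cons_val_one, Matrix.cons_val_fin_one]
  refine ⟨by positivity, by positivity, ?_, ?_, trivial, ?_⟩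
  · calc _ ≤ 1 * (1 + gram X 1 1) := by gcongr
      _ ≤ _ := by linarith
  · calc _ ≤ 1 * (1 + gram X 0 0) := by gcongr
      _ ≤ _ := by linarith
  · field_simp; nlinarith

/-- The block matrix `(X, A_f(X), B_f(X))`. -/
def inclusionMap (f : Matrix (Fin n) (Fin 2) ℝ → ℝ) (X : Matrix (Fin n) (Fin 2) ℝ) :
    Matrix (BlockIdx n) (Fin 2) ℝ :=
  Matrix.fromRows X (Matrix.fromRows (matA f X) (matB f X))

/-- The coefficients of the null Lagrangian `∑ det (uᵢ, vᵢ) - M det (w₁, w₂)`. -/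
def blockCoeff (n : ℕ) (M : ℝ) : BlockIdx n → BlockIdx n → ℝ
  | .inl i, .inr (.inl j) => if i = j then 1 else 0
  | .inr (.inr a), .inr (.inr b) => if a = 0 ∧ b = 1 then -M else 0
  | _, _ => 0

theorem minorForm_blockCoeff (M : ℝ) (Z : Matrix (BlockIdx n) (Fin 2) ℝ) :
    minorForm (blockCoeff n M) Z =
      ∑ i, (Z (.inl i) 0 * Z (.inr (.inl i)) 1 - Z (.inl i) 1 * Z (.inr (.inl i)) 0)
        - M * (Z (.inr (.inr 0)) 0 * Z (.inr (.inr 1)) 1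
          - Z (.inr (.inr 0)) 1 * Z (.inr (.inr 1)) 0) := by
  simp [minorForm, blockCoeff, Fintype.sum_sum_type]
  ring

/-- The quarter turn $J$ converts a minor into an inner product: the determinant of the rows $u$ and
$hJ$ is $u\cdot h$. -/
theorem mul_matJ_apply {m : Type} [Fintype m] (H : Matrix m (Fin 2) ℝ) (i : m) :
    (H * matJ) i 0 = -H i 1 ∧ (H * matJ) i 1 = H i 0 := by
  simp [matJ, Matrix.mul_apply]

/-- With $L=1+R^2$, summing `row_ge` leaves an error of at most $LR^2\|P-P'\|^2$. By
`neg_det_sub_ge` this is at most $LR^2(2+4L^2)\cdot(-\det(P-P'))$, which explains the coefficient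
$M$. Since the last block is $-PJ$ and $\det J=1$, its minor is exactly $\det(P-P')$. -/
theorem elliptic_areaFun (R : ℝ) (X Y : Matrix (Fin n) (Fin 2) ℝ) (hX : ‖X‖ ≤ R)
    (hY : ‖Y‖ ≤ R) :
    ‖X - Y‖ ^ 2 / (4 * (1 + R ^ 2)) ≤
      minorForm (blockCoeff n ((1 + R ^ 2) * (2 + 4 * (1 + R ^ 2) ^ 2) * R ^ 2))
        (inclusionMap areaFun X - inclusionMap areaFun Y) := by
  obtain ⟨hp, hs, hpL, hsL, hr, hdet⟩ := conformalGram_spec X hX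
  obtain ⟨hp', hs', hpL', hsL', hr', hdet'⟩ := conformalGram_spec Y hY
  rw [minorForm_blockCoeff]
  simp only [inclusionMap, matA_areaFun, matB_areaFun, Matrix.sub_apply, Matrix.fromRows_apply_inl,
    Matrix.fromRows_apply_inr, mul_matJ_apply, Matrix.neg_apply, Matrix.mul_apply (M := X),
    Matrix.mul_apply (M := Y), Fin.sum_univ_two, hr, hr']
  set p := conformalGram X 0 0
  set r := conformalGram X 0 1
  set s := conformalGram X 1 1
  set p' := conformalGram Y 0 0
  set r' := conformalGram Y 0 1
  set s' := conformalGram Y 1 1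
  set L := 1 + R ^ 2
  have hL : 0 < L := hp.trans_le hpL
  have hsum := Finset.sum_le_sum fun i (_ : i ∈ Finset.univ) =>
    row_ge (p' := p') (r' := r') (s' := s') hp hs hpL hsL hdet (X i 0) (X i 1) (Y i 0) (Y i 1)
  have hT := neg_det_sub_ge hp hs hp' hs' hpL hsL hpL' hsL' hdet hdet'
  set D := (p - p') ^ 2 + 2 * (r - r') ^ 2 + (s - s') ^ 2 with hD
  have hD0 : 0 ≤ D := by positivity
  rw [Finset.sum_sub_distrib, ← Finset.sum_div, ← Finset.mul_sum] at hsum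
  have e1 := frobenius_norm_sq (X - Y)
  simp only [Matrix.sub_apply] at e1
  rw [← e1, ← frobenius_norm_sq Y] at hsum
  have hY2 : ‖Y‖ ^ 2 ≤ R ^ 2 := by gcongr
  have h2 : L * D * ‖Y‖ ^ 2 ≤ L * D * R ^ 2 := by gcongr
  have h3 := mul_le_mul_of_nonneg_left hT (by positivity : 0 ≤ L * R ^ 2)
  refine le_trans ?_ (le_trans (sub_le_sub_right hsum
    (-(L * (2 + 4 * L ^ 2) * R ^ 2 * -((p - p') * (s - s') - (r - r') ^ 2)))) (le_of_eq ?_))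
  · linarith
  · rw [sub_eq_add_neg, sub_eq_add_neg]
    congr 1
    · exact Finset.sum_congr rfl fun i _ => by ring
    · ring

end Ellipticity

/-! ### Stability of ellipticity under a perturbation of the integrand that is small in $C^2$. -/

section Perturbation

variable {n : ℕ}

theorem norm_fromRows_le {m₁ m₂ : Type} [Fintype m₁] [Fintype m₂] (A : Matrix m₁ (Fin 2) ℝ)
    (B : Matrix m₂ (Fin 2) ℝ) : ‖Matrix.fromRows A B‖ ≤ ‖A‖ + ‖B‖ := by
  apply le_of_sq_le_sq _ (by positivity)
  have h : ‖Matrix.fromRows A B‖ ^ 2 = ‖A‖ ^ 2 + ‖B‖ ^ 2 := by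
    simp [frobenius_norm_sq, Fintype.sum_sum_type]
  nlinarith [norm_nonneg A, norm_nonneg B]

theorem norm_le_of_forall_abs_entry_le {B : ℝ} (Z : Matrix (Fin n) (Fin 2) ℝ)
    (h : ∀ a j, |Z a j| ≤ B) : ‖Z‖ ≤ 2 * n * B := by
  refine (norm_le_sum_abs_entry _).trans ?_
  calc _ ≤ ∑ _a : Fin n, 2 * B := Finset.sum_le_sum fun a _ => by linarith [h a 0, h a 1]
    _ = _ := by simp; ring

theorem fderiv_bounds_of_iteratedFDeriv_le {E : Type*} [NormedAddCommGroup E] [NormedSpace ℝ E]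
    {g : E → ℝ} (hg : ContDiff ℝ 2 g) {s : Set E} (hs : Convex ℝ s) {ε : ℝ}
    (h1 : ∀ Z ∈ s, ‖iteratedFDeriv ℝ 1 g Z‖ ≤ ε) (h2 : ∀ Z ∈ s, ‖iteratedFDeriv ℝ 2 g Z‖ ≤ ε)
    {X Y : E} (hX : X ∈ s) (hY : Y ∈ s) :
    |g X - g Y| ≤ ε * ‖X - Y‖ ∧ (∀ V, |fderiv ℝ g X V| ≤ ε * ‖V‖) ∧
      ∀ V, |fderiv ℝ g X V - fderiv ℝ g Y V| ≤ ε * ‖X - Y‖ * ‖V‖ := by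
  have hd1 : ∀ Z ∈ s, ‖fderiv ℝ g Z‖ ≤ ε := fun Z hZ => by
    rw [← norm_iteratedFDeriv_one]; exact h1 Z hZ
  have hd2 : ∀ Z ∈ s, ‖fderiv ℝ (fderiv ℝ g) Z‖ ≤ ε := fun Z hZ => by
    rw [← norm_iteratedFDeriv_one, norm_iteratedFDeriv_fderiv]; exact h2 Z hZ
  refine ⟨hs.norm_image_sub_le_of_norm_fderiv_le
    (fun Z _ => hg.differentiable two_ne_zero Z) hd1 hY hX, fun V => ?_, fun V => ?_⟩
  · exact ((fderiv ℝ g X).le_opNorm V).trans (by gcongr; exact hd1 X hX)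
  · have h3 : ‖fderiv ℝ g X - fderiv ℝ g Y‖ ≤ ε * ‖X - Y‖ :=
      hs.norm_image_sub_le_of_norm_fderiv_le
        (fun Z _ => (hg.fderiv_right (m := 1) (by norm_num)).differentiable one_ne_zero Z) hd2
        hY hX
    exact ((fderiv ℝ g X - fderiv ℝ g Y).le_opNorm V).trans (by gcongr)

theorem inclusionMap_add (f g : Matrix (Fin n) (Fin 2) ℝ → ℝ) (hf : Differentiable ℝ f)
    (hg : Differentiable ℝ g) (X : Matrix (Fin n) (Fin 2) ℝ) :
    inclusionMap (fun X => f X + g X) X = inclusionMap f X +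
      Matrix.fromRows 0 (Matrix.fromRows (matA g X) (matB g X)) := by
  have h : matGrad (fun X => f X + g X) X = matGrad f X + matGrad g X := by
    ext i j
    simp only [matGrad, Matrix.of_apply, Matrix.add_apply]
    exact congrArg (fun L => L (Matrix.single i j 1)) (fderiv_fun_add (hf X) (hg X))
  ext i j
  rcases i with i | i | i
  · simp [inclusionMap]
  · simp [inclusionMap, matA, h, Matrix.add_mul]
  · simp [inclusionMap, matB, h, Matrix.add_mul, Matrix.mul_add]; ring

theorem norm_perturbation_sub_le {R ε : ℝ} (hε : 0 ≤ ε) (g : Matrix (Fin n) (Fin 2) ℝ → ℝ)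
    (X Y : Matrix (Fin n) (Fin 2) ℝ) (hY : ‖Y‖ ≤ R) (h0 : |g X - g Y| ≤ ε * ‖X - Y‖)
    (h1 : ∀ V, |fderiv ℝ g X V| ≤ ε * ‖V‖)
    (h2 : ∀ V, |fderiv ℝ g X V - fderiv ℝ g Y V| ≤ ε * ‖X - Y‖ * ‖V‖) :
    ‖Matrix.fromRows (0 : Matrix (Fin n) (Fin 2) ℝ) (Matrix.fromRows (matA g X) (matB g X))
      - Matrix.fromRows 0 (Matrix.fromRows (matA g Y) (matB g Y))‖
      ≤ (2 * n * (2 + R) + 1) * ‖matJ‖ * ε * ‖X - Y‖ := by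
  have e : Matrix.fromRows (0 : Matrix (Fin n) (Fin 2) ℝ) (Matrix.fromRows (matA g X) (matB g X))
      - Matrix.fromRows 0 (Matrix.fromRows (matA g Y) (matB g Y))
      = Matrix.fromRows 0 (Matrix.fromRows (matA g X - matA g Y) (matB g X - matB g Y)) := by
    ext i j; rcases i with i | i | i <;> simp
  have hG : ‖matGrad g X - matGrad g Y‖ ≤ 2 * n * (ε * ‖X - Y‖) :=
    norm_le_of_forall_abs_entry_le _ fun a j => (h2 _).trans
      (mul_le_of_le_one_right (by positivity) (norm_single_le a j))
  have hG' : ‖matGrad g X‖ ≤ 2 * n * ε :=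
    norm_le_of_forall_abs_entry_le _ fun a j => (h1 _).trans
      (mul_le_of_le_one_right hε (norm_single_le a j))
  have hA : ‖matA g X - matA g Y‖ ≤ (2 * n * (ε * ‖X - Y‖)) * ‖matJ‖ := by
    rw [matA, matA, ← Matrix.sub_mul]
    exact (Matrix.frobenius_norm_mul _ _).trans (by gcongr)
  have hB : ‖matB g X - matB g Y‖ ≤
      (‖X - Y‖ * (2 * n * ε) + R * (2 * n * (ε * ‖X - Y‖))) * ‖matJ‖
        + ε * ‖X - Y‖ * ‖matJ‖ := by
    -- Every summand now contains one increment, so each is of order $\varepsilon\|X-Y\|$.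
    have eB : matB g X - matB g Y = ((X - Y)ᵀ * matGrad g X + Yᵀ * (matGrad g X - matGrad g Y))
        * matJ - (g X - g Y) • matJ := by
      simp only [matB, Matrix.transpose_sub, Matrix.sub_mul, Matrix.mul_sub, Matrix.add_mul,
        sub_smul]
      abel
    rw [eB]
    refine (norm_sub_le _ _).trans (add_le_add ((Matrix.frobenius_norm_mul _ _).trans ?_) ?_)
    · gcongr
      refine (norm_add_le _ _).trans (add_le_add ?_ ?_)
      · refine (Matrix.frobenius_norm_mul _ _).trans ?_
        rw [Matrix.frobenius_norm_transpose]
        gcongr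
      · refine (Matrix.frobenius_norm_mul _ _).trans ?_
        rw [Matrix.frobenius_norm_transpose]
        gcongr
        exact (norm_nonneg _).trans hY
    · rw [norm_smul]
      gcongr
      exact h0
  rw [e]
  refine (norm_fromRows_le _ _).trans ?_
  rw [norm_zero, zero_add]
  refine (norm_fromRows_le _ _).trans ?_
  linarith

theorem contDiff_inclusionMap_areaFun (i : BlockIdx n) (j : Fin 2) :
    ContDiff ℝ 1 (fun X : Matrix (Fin n) (Fin 2) ℝ => inclusionMap areaFun X i j) := by
  have hinv : ContDiff ℝ 1 (fun X : Matrix (Fin n) (Fin 2) ℝ => (areaFun X)⁻¹) :=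
    contDiff_areaFun.inv fun X => (zero_lt_one.trans_le (one_le_areaFun X)).ne'
  have hP : ∀ a b, ContDiff ℝ 1 (fun X : Matrix (Fin n) (Fin 2) ℝ => conformalGram X a b) := by
    intro a b
    simp only [conformalGram, Matrix.smul_apply, smul_eq_mul]
    refine hinv.mul ?_
    fin_cases a <;> fin_cases b <;> simp
    · exact contDiff_const.add (contDiff_gram 1 1)
    · exact (contDiff_gram 0 1).neg
    · exact (contDiff_gram 0 1).neg
    · exact contDiff_const.add (contDiff_gram 0 0)
  simp only [inclusionMap, matA_areaFun, matB_areaFun]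
  rcases i with i | i | i
  · simpa using contDiff_entry i j
  · simp only [Matrix.fromRows_apply_inr, Matrix.fromRows_apply_inl, Matrix.mul_apply,
      Fin.sum_univ_two]
    exact ((((contDiff_entry _ _).mul (hP _ _)).add ((contDiff_entry _ _).mul (hP _ _))).mul
      contDiff_const).add ((((contDiff_entry _ _).mul (hP _ _)).add
        ((contDiff_entry _ _).mul (hP _ _))).mul contDiff_const)
  · simp only [Matrix.fromRows_apply_inr, Matrix.neg_apply, Matrix.mul_apply, Fin.sum_univ_two]
    exact (((hP _ _).mul contDiff_const).add ((hP _ _).mul contDiff_const)).neg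

theorem exists_lipschitz_inclusionMap_areaFun (R : ℝ) :
    ∃ L : ℝ, 0 ≤ L ∧ ∀ X Y : Matrix (Fin n) (Fin 2) ℝ, ‖X‖ ≤ R → ‖Y‖ ≤ R →
      ‖inclusionMap areaFun X - inclusionMap areaFun Y‖ ≤ L * ‖X - Y‖ := by
  have h : ∀ i j, ∃ K, LipschitzOnWith K
      (fun X : Matrix (Fin n) (Fin 2) ℝ => inclusionMap areaFun X i j)
      (Metric.closedBall 0 R) := fun i j =>
    (contDiff_inclusionMap_areaFun i j).contDiffOn.exists_lipschitzOnWith one_ne_zero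
      (convex_closedBall _ _) (isCompact_closedBall _ _)
  choose K hK using h
  refine ⟨∑ i, ((K i 0 : ℝ) + K i 1), by positivity, fun X Y hX hY => ?_⟩
  refine (norm_le_sum_abs_entry _).trans ?_
  rw [Finset.sum_mul]
  refine Finset.sum_le_sum fun i _ => ?_
  have := fun j => (hK i j).dist_le_mul X (by simpa using hX) Y (by simpa using hY)
  simp only [dist_eq_norm] at this
  rw [add_mul]
  exact add_le_add (this 0) (this 1)

theorem le_of_c2Norm_le {g : Matrix (Fin n) (Fin 2) ℝ → ℝ} {s : Set (Matrix (Fin n) (Fin 2) ℝ)}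
    {ε : ℝ} (hε : 0 ≤ ε) (h : c2Norm g s ≤ ENNReal.ofReal ε) {i : ℕ} (hi : i < 3)
    {X : Matrix (Fin n) (Fin 2) ℝ} (hX : X ∈ s) : ‖iteratedFDeriv ℝ i g X‖ ≤ ε := by
  have h1 : ‖iteratedFDeriv ℝ i g X‖ₑ ≤ c2Norm g s :=
    (le_iSup₂ (f := fun X (_ : X ∈ s) => ‖iteratedFDeriv ℝ i g X‖ₑ) X hX).trans
      (Finset.single_le_sum (f := fun i => ⨆ X ∈ s, ‖iteratedFDeriv ℝ i g X‖ₑ)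
        (fun _ _ => zero_le) (Finset.mem_range.2 hi))
  have h2 := h1.trans h
  rwa [← ofReal_norm, ENNReal.ofReal_le_ofReal_iff hε] at h2

/-- The map $X\mapsto$ block matrix for $f$ is that of the area plus one of Lipschitz constant
$N\varepsilon$ on the ball of radius $R$. The lower bound by $\|X-Y\|^2$ survives for small
$\varepsilon$, and Lipschitz continuity of the block map turns it into one by the full difference.
-/
theorem exists_elliptic (n : ℕ) (R : ℝ) (hR : 0 < R) :
    ∃ ε : ℝ, 0 < ε ∧ ∃ c : ℝ, 0 < c ∧ ∃ q : BlockIdx n → BlockIdx n → ℝ,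
      ∀ f : Matrix (Fin n) (Fin 2) ℝ → ℝ, ContDiff ℝ 2 f →
        c2Norm (fun X => f X - areaFun X) (Metric.ball 0 (2 * R)) ≤ ENNReal.ofReal ε →
        ∀ X Y : Matrix (Fin n) (Fin 2) ℝ, ‖X‖ ≤ R → ‖Y‖ ≤ R →
          c * ‖inclusionMap f X - inclusionMap f Y‖ ^ 2
            ≤ minorForm q (inclusionMap f X - inclusionMap f Y) := by
  obtain ⟨L, hL, hLip⟩ := exists_lipschitz_inclusionMap_areaFun (n := n) R
  set q := blockCoeff n ((1 + R ^ 2) * (2 + 4 * (1 + R ^ 2) ^ 2) * R ^ 2)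
  set C := 2 * ∑ a, ∑ b, |q a b| with hC
  have hC0 : 0 ≤ C := by positivity
  set N := (2 * n * (2 + R) + 1) * ‖matJ‖ with hN
  have hN0 : 0 ≤ N := by positivity
  -- Half of the ellipticity constant of the area; the other half absorbs the perturbation.
  set κ := 1 / (8 * (1 + R ^ 2)) with hκ
  have hκ0 : 0 < κ := by positivity
  -- The bound by 1 makes the term quadratic in the perturbation linear in $\varepsilon$. The `+ 1`
  -- keeps the denominator positive.
  set ε := min 1 (κ / (C * (2 * L * N + N ^ 2) + 1)) with hε
  have hε0 : 0 < ε := by positivity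
  refine ⟨ε, hε0, κ / (1 + (L + N)) ^ 2, by positivity, q, fun f hf hfε X Y hX hY => ?_⟩
  set g := fun X => f X - areaFun X with hg
  have hgc : ContDiff ℝ 2 g := hf.sub contDiff_areaFun
  have hmem : ∀ Z : Matrix (Fin n) (Fin 2) ℝ, ‖Z‖ ≤ R → Z ∈ Metric.ball 0 (2 * R) := by
    intro Z hZ; rw [mem_ball_zero_iff]; linarith
  obtain ⟨h0, h1, h2⟩ := fderiv_bounds_of_iteratedFDeriv_le hgc (convex_ball 0 (2 * R))
    (fun Z hZ => le_of_c2Norm_le hε0.le hfε (by norm_num) hZ)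
    (fun Z hZ => le_of_c2Norm_le hε0.le hfε (by norm_num) hZ) (hmem X hX) (hmem Y hY)
  have hE := norm_perturbation_sub_le hε0.le g X Y hY h0 h1 h2
  have hfe : f = fun X => areaFun X + g X := by ext X; simp [hg]
  have hgd : Differentiable ℝ g := hgc.differentiable two_ne_zero
  have hsplit : inclusionMap f X - inclusionMap f Y
      = (inclusionMap areaFun X - inclusionMap areaFun Y) +
        (Matrix.fromRows (0 : Matrix (Fin n) (Fin 2) ℝ) (Matrix.fromRows (matA g X) (matB g X))
      - Matrix.fromRows 0 (Matrix.fromRows (matA g Y) (matB g Y))) := by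
    have := contDiff_areaFun (n := n) (m := 1)
    have hX1 := inclusionMap_add areaFun g (this.differentiable one_ne_zero) hgd X
    have hY1 := inclusionMap_add areaFun g (this.differentiable one_ne_zero) hgd Y
    rw [← hfe] at hX1 hY1
    rw [hX1, hY1]; abel
  set S := inclusionMap areaFun X - inclusionMap areaFun Y with hS
  set T := Matrix.fromRows (0 : Matrix (Fin n) (Fin 2) ℝ) (Matrix.fromRows (matA g X) (matB g X))
      - Matrix.fromRows 0 (Matrix.fromRows (matA g Y) (matB g Y)) with hT
  rw [hsplit]
  have hSn : ‖S‖ ≤ L * ‖X - Y‖ := hLip X Y hX hY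
  have hTn : ‖T‖ ≤ N * ε * ‖X - Y‖ := hE
  have hε1 : ε ≤ 1 := min_le_left _ _
  have hTn' : ‖T‖ ≤ N * ‖X - Y‖ := hTn.trans (by
    gcongr; exact mul_le_of_le_one_right hN0 hε1)
  have hell := elliptic_areaFun R X Y hX hY
  have hadd := minorForm_add_ge q S T
  have hbound : C * (2 * ‖S‖ * ‖T‖ + ‖T‖ ^ 2) ≤ κ * ‖X - Y‖ ^ 2 := by
    have hεC : ε * (C * (2 * L * N + N ^ 2) + 1) ≤ κ := by
      rw [← le_div_iff₀ (by positivity)]; exact min_le_right _ _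
    calc C * (2 * ‖S‖ * ‖T‖ + ‖T‖ ^ 2)
        ≤ C * (2 * (L * ‖X - Y‖) * (N * ε * ‖X - Y‖)
          + (N * ‖X - Y‖) * (N * ε * ‖X - Y‖)) := by
          rw [pow_two]; gcongr
      _ = (ε * (C * (2 * L * N + N ^ 2))) * ‖X - Y‖ ^ 2 := by ring
      _ ≤ κ * ‖X - Y‖ ^ 2 := by gcongr; linarith
  have hk : ‖X - Y‖ ^ 2 / (4 * (1 + R ^ 2)) = 2 * κ * ‖X - Y‖ ^ 2 := by
    rw [hκ]; field_simp; ring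
  have hfin : ‖S + T‖ ≤ (1 + (L + N)) * ‖X - Y‖ := by
    refine (norm_add_le _ _).trans ?_
    nlinarith [norm_nonneg (X - Y)]
  calc κ / (1 + (L + N)) ^ 2 * ‖S + T‖ ^ 2
      ≤ κ / (1 + (L + N)) ^ 2 * ((1 + (L + N)) * ‖X - Y‖) ^ 2 := by gcongr
    _ = κ * ‖X - Y‖ ^ 2 := by field_simp
    _ ≤ minorForm q (S + T) := by rw [hk] at hell; linarith

end Perturbation

/-! ### Gehring's lemma on $\mathbb R\times\mathbb R$, where balls of the maximum norm are squares.
-/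

section Gehring

open Set Metric Filter
open scoped Topology

theorem volume_real_closedBall_prod (x : ℝ × ℝ) {r : ℝ} (hr : 0 ≤ r) :
    volume.real (closedBall x r) = 4 * r ^ 2 := by
  obtain ⟨a, b⟩ := x
  rw [← closedBall_prod_same, Measure.volume_eq_prod, Measure.real, Measure.prod_prod,
    Real.volume_closedBall, Real.volume_closedBall, ← ENNReal.ofReal_mul (by positivity),
    ENNReal.toReal_ofReal (by positivity)]
  ring

theorem setIntegral_le_add_of_le_off {α : Type*} [MeasurableSpace α] {μ : Measure α} {f : α → ℝ}
    {B S : Set α} {c : ℝ} (hc : 0 ≤ c) (hf : IntegrableOn f B μ) (hB : MeasurableSet B)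
    (hS : MeasurableSet S) (hμ : μ B ≠ ⊤) (h : ∀ x, x ∉ S → f x ≤ c) :
    ∫ x in B, f x ∂μ ≤ ∫ x in B ∩ S, f x ∂μ + c * μ.real B := by
  rw [← integral_inter_add_sdiff hS hf]
  gcongr
  calc ∫ x in B \ S, f x ∂μ ≤ ∫ _x in B \ S, c ∂μ :=
        setIntegral_mono_on (hf.mono_set sdiff_subset)
          (integrableOn_const (measure_ne_top_of_subset sdiff_subset hμ)) (hB.diff hS)
          fun x hx => h x hx.2
    _ = c * μ.real (B \ S) := by simp [mul_comm]
    _ ≤ c * μ.real B := by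
        exact mul_le_mul_of_nonneg_left (measureReal_mono sdiff_subset hμ) hc

/-- On a ball where `g ^ 2` has mean `≥ t ^ 2`, the reverse Hölder inequality bounds `t ^ 2 r ^ 2`
by integrals over super-level sets. -/
theorem sq_mul_sq_le_of_reverseHolder {A η t r : ℝ} (hA : 0 < A) (hη : 0 < η)
    (hηA : 528 * A * η ^ 2 ≤ 2) (ht : 0 < t) (hr : 0 < r) {g h : ℝ × ℝ → ℝ} (hg0 : ∀ x, 0 ≤ g x)
    (hh0 : ∀ x, 0 ≤ h x) (hg : Measurable g) (hh : Measurable h) (hgi : Integrable g)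
    (hhi : Integrable (fun x => h x ^ 2)) (x : ℝ × ℝ)
    (hrev : ∫ y in closedBall x r, g y ^ 2 ≤ A / r ^ 2 * (∫ y in closedBall x (2 * r), g y) ^ 2
      + A * ∫ y in closedBall x (2 * r), h y ^ 2)
    (hmean : t ^ 2 * (4 * r ^ 2) ≤ ∫ y in closedBall x r, g y ^ 2) :
    t ^ 2 * r ^ 2 ≤ (√(2 * A) + A) * (t * (∫ y in closedBall x (2 * r) ∩ {y | η * t < g y}, g y)
      + ∫ y in closedBall x (2 * r) ∩ {y | η * t < h y}, h y ^ 2) := by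
  have hfin : volume (closedBall x (2 * r)) ≠ ⊤ := measure_closedBall_lt_top.ne
  have ha := setIntegral_le_add_of_le_off (by positivity : 0 ≤ η * t) hgi.integrableOn
    measurableSet_closedBall (measurableSet_lt measurable_const hg) hfin
    (fun y hy => not_lt.1 hy)
  have hb := setIntegral_le_add_of_le_off (by positivity : 0 ≤ (η * t) ^ 2) hhi.integrableOn
    measurableSet_closedBall (measurableSet_lt measurable_const hh) hfin
    (fun y hy => pow_le_pow_left₀ (hh0 y) (not_lt.1 hy) 2)
  rw [volume_real_closedBall_prod x (by positivity)] at ha hb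
  have ha0 : 0 ≤ ∫ y in closedBall x (2 * r), g y := integral_nonneg hg0
  have ha'0 : 0 ≤ ∫ y in closedBall x (2 * r) ∩ {y | η * t < g y}, g y := integral_nonneg hg0
  have hb'0 : 0 ≤ ∫ y in closedBall x (2 * r) ∩ {y | η * t < h y}, h y ^ 2 :=
    integral_nonneg fun y => by positivity
  set a := ∫ y in closedBall x (2 * r), g y
  set a' := ∫ y in closedBall x (2 * r) ∩ {y | η * t < g y}, g y
  set b := ∫ y in closedBall x (2 * r), h y ^ 2
  set b' := ∫ y in closedBall x (2 * r) ∩ {y | η * t < h y}, h y ^ 2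
  have hsq : a ^ 2 ≤ 2 * a' ^ 2 + 2 * (η * t * (4 * (2 * r) ^ 2)) ^ 2 := by
    have := pow_le_pow_left₀ ha0 ha 2
    nlinarith [sq_nonneg (a' - η * t * (4 * (2 * r) ^ 2))]
  have h1 : t ^ 2 * (4 * r ^ 2) ≤ A / r ^ 2 * (2 * a' ^ 2 + 2 * (η * t * (4 * (2 * r) ^ 2)) ^ 2)
      + A * (b' + (η * t) ^ 2 * (4 * (2 * r) ^ 2)) := by
    refine hmean.trans (hrev.trans ?_)
    gcongr
  -- The doubled square has area $16r^2$, and $528=2\cdot16^2+16$. The choice of $\eta$ lets this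
  -- term take at most half of the left side $4t^2r^2$.
  have h2 : A / r ^ 2 * (2 * a' ^ 2 + 2 * (η * t * (4 * (2 * r) ^ 2)) ^ 2)
      + A * (b' + (η * t) ^ 2 * (4 * (2 * r) ^ 2))
      = 2 * A * (a' / r) ^ 2 + A * b' + 528 * A * η ^ 2 * (t ^ 2 * r ^ 2) := by
    field_simp; ring
  have h3 : 528 * A * η ^ 2 * (t ^ 2 * r ^ 2) ≤ 2 * (t ^ 2 * r ^ 2) := by gcongr
  have h4 : 2 * (t ^ 2 * r ^ 2) ≤ 2 * A * (a' / r) ^ 2 + A * b' := by linarith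
  set K := √(2 * A) with hK
  have hK0 : 0 ≤ K := Real.sqrt_nonneg _
  have hK2 : K ^ 2 = 2 * A := Real.sq_sqrt (by positivity)
  have hta : 0 ≤ t * a' := by positivity
  -- The term quadratic in $a'$ is removed by an alternative: either $a'$ is large and the claim is
  -- immediate, or $2A(a'/r)^2\le t^2r^2$ can be absorbed.
  by_cases hc : t * r ^ 2 ≤ K * a'
  · have h5 : t * (t * r ^ 2) ≤ t * (K * a') := by gcongr
    nlinarith [mul_nonneg hA.le hta, mul_nonneg hK0 hb'0, mul_nonneg hA.le hb'0]
  · push Not at hc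
    have h6 : K * (a' / r) ≤ t * r := by
      rw [← mul_div_assoc, div_le_iff₀ hr]; nlinarith
    have h7 : (K * (a' / r)) ^ 2 ≤ (t * r) ^ 2 := by gcongr
    rw [mul_pow, hK2] at h7
    nlinarith [mul_nonneg hA.le hta, mul_nonneg hK0 hb'0, mul_nonneg hK0 hta]

/-- At almost every point of `{g > t}` there is a radius at which the mean of `g ^ 2` passes
through `t ^ 2`. -/
theorem ae_exists_stopping_radius {g : ℝ × ℝ → ℝ}
    (hgi : Integrable (fun x => g x ^ 2)) :
    ∀ᵐ x : ℝ × ℝ, ∀ t, 0 < t → t < g x → ∃ r, 0 < r ∧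
      t ^ 2 * (4 * r ^ 2) ≤ ∫ y in closedBall x r, g y ^ 2 ∧
      ∀ s, 2 * r ≤ s → ∫ y in closedBall x s, g y ^ 2 ≤ t ^ 2 * (4 * s ^ 2) := by
  filter_upwards [IsUnifLocDoublingMeasure.ae_tendsto_average (volume : Measure (ℝ × ℝ))
    hgi.locallyIntegrable 1] with x hx t ht htg
  have h1 : Tendsto (fun r : ℝ => ⨍ y in closedBall x r, g y ^ 2) (𝓝[>] 0) (𝓝 (g x ^ 2)) := by
    refine hx (fun _ => x) id tendsto_id ?_
    filter_upwards [self_mem_nhdsWithin] with r hr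
    exact mem_closedBall_self (by simpa using (le_of_lt hr))
  set T := {r : ℝ | 0 < r ∧ t ^ 2 * (4 * r ^ 2) ≤ ∫ y in closedBall x r, g y ^ 2} with hT
  -- Lebesgue differentiation: small squares have mean near $g(x)^2>t^2$. Integrability of $g^2$
  -- bounds the admissible radii from above.
  have hne : T.Nonempty := by
    have h2 : ∀ᶠ r in 𝓝[>] (0 : ℝ), t ^ 2 < ⨍ y in closedBall x r, g y ^ 2 :=
      h1.eventually (lt_mem_nhds (pow_lt_pow_left₀ htg ht.le two_ne_zero))
    obtain ⟨r, hr, hr0⟩ := (h2.and self_mem_nhdsWithin).exists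
    have hr0 : 0 < r := hr0
    refine ⟨r, hr0, ?_⟩
    rw [setAverage_eq, volume_real_closedBall_prod x hr0.le, smul_eq_mul, ← div_eq_inv_mul,
      lt_div_iff₀ (by positivity)] at hr
    exact hr.le
  set I := ∫ y, g y ^ 2
  have hle : ∀ r, ∫ y in closedBall x r, g y ^ 2 ≤ I := fun r =>
    setIntegral_le_integral hgi (ae_of_all _ fun y => by positivity)
  have hbdd : BddAbove T := by
    refine ⟨√(I / (4 * t ^ 2)), fun r hr => Real.le_sqrt_of_sq_le ?_⟩
    rw [le_div_iff₀ (by positivity)]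
    linarith [hr.2.trans (hle r)]
  obtain ⟨r₀, hr₀⟩ := hne
  have hs : 0 < sSup T := hr₀.1.trans_le (le_csSup hbdd hr₀)
  obtain ⟨r, hrT, hr⟩ := exists_lt_of_lt_csSup ⟨r₀, hr₀⟩ (half_lt_self hs)
  refine ⟨r, hrT.1, hrT.2, fun s hs2 => ?_⟩
  by_contra hcon
  push Not at hcon
  have : s ≤ sSup T := le_csSup hbdd ⟨by linarith [hrT.1], hcon.le⟩
  linarith

theorem withDensity_ofReal_apply {f : ℝ × ℝ → ℝ} (hf0 : ∀ x, 0 ≤ f x) (hf : Integrable f)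
    {s : Set (ℝ × ℝ)} (hs : MeasurableSet s) :
    volume.withDensity (fun x => ENNReal.ofReal (f x)) s = ENNReal.ofReal (∫ x in s, f x) := by
  rw [withDensity_apply _ hs, ofReal_integral_eq_lintegral_ofReal hf.integrableOn
    (ae_of_all _ hf0)]

/-- Stopping-time squares cover almost all of $\{g>t\}$. On each of them the reverse Hölder
inequality compares mass above the level $t$ with mass above $\eta t$, and a Vitali selection sums
these bounds over disjoint squares. -/
theorem levelSet_le_of_reverseHolder {A η t : ℝ} (hA : 0 < A) (hη : 0 < η)
    (hηA : 528 * A * η ^ 2 ≤ 2) (ht : 0 < t) {g h : ℝ × ℝ → ℝ} (hg0 : ∀ x, 0 ≤ g x)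
    (hh0 : ∀ x, 0 ≤ h x) (hg : Measurable g) (hh : Measurable h) (hgi : Integrable g)
    (hg2 : Integrable (fun x => g x ^ 2)) (hh2 : Integrable (fun x => h x ^ 2))
    (hrev : ∀ (x : ℝ × ℝ) (r : ℝ), 0 < r → ∫ y in closedBall x r, g y ^ 2
      ≤ A / r ^ 2 * (∫ y in closedBall x (2 * r), g y) ^ 2
        + A * ∫ y in closedBall x (2 * r), h y ^ 2) :
    volume.withDensity (fun x => ENNReal.ofReal (g x ^ 2)) {x | t < g x} ≤
      ENNReal.ofReal (400 * (√(2 * A) + A)) *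
        (ENNReal.ofReal t * volume.withDensity (fun x => ENNReal.ofReal (g x)) {x | η * t < g x}
          + volume.withDensity (fun x => ENNReal.ofReal (h x ^ 2)) {x | η * t < h x}) := by
  have hradius := ae_exists_stopping_radius hg2
  set μ := volume.withDensity (fun x => ENNReal.ofReal (g x ^ 2)) with hμ
  set μ₁ := volume.withDensity (fun x => ENNReal.ofReal (g x)) with hμ₁
  set μ₂ := volume.withDensity (fun x => ENNReal.ofReal (h x ^ 2)) with hμ₂
  set K := √(2 * A) + A with hK
  have hK0 : 0 ≤ K := by positivity
  set P : ℝ × ℝ → ℝ → Prop := fun x r => 0 < r ∧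
      t ^ 2 * (4 * r ^ 2) ≤ ∫ y in closedBall x r, g y ^ 2 ∧
      ∀ s, 2 * r ≤ s → ∫ y in closedBall x s, g y ^ 2 ≤ t ^ 2 * (4 * s ^ 2) with hP
  set D : Set (ℝ × ℝ) := {x | ∃ r, P x r} with hD
  have hex : ∀ x, ∃ r, x ∈ D → P x r := fun x => by
    by_cases hx : x ∈ D
    · exact ⟨hx.choose, fun _ => hx.choose_spec⟩
    · exact ⟨0, fun h => (hx h).elim⟩
  choose r hr using hex
  have hI : ∀ x ∈ D, 2 * r x ≤ 2 * √((∫ y, g y ^ 2) / (4 * t ^ 2)) := by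
    intro x hx
    gcongr
    refine Real.le_sqrt_of_sq_le ?_
    rw [le_div_iff₀ (by positivity)]
    have := setIntegral_le_integral (s := closedBall x (r x)) hg2
      (ae_of_all _ fun y => by positivity)
    linarith [(hr x hx).2.1]
  -- The selection uses the radii $2r$, since the right side of the reverse Hölder inequality lives
  -- on the doubled squares, which have to be disjoint.
  obtain ⟨u, huD, hdisj, hcov⟩ := Vitali.exists_disjoint_subfamily_covering_enlargement_closedBall
    D id (fun x => 2 * r x) _ hI 5 (by norm_num)
  simp only [id] at hdisj hcov
  have hucount : u.Countable := hdisj.countable_of_nonempty_interior fun x hx => by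
    have : 0 < 2 * r x := by linarith [(hr x (huD hx)).1]
    exact ⟨x, ball_subset_interior_closedBall (mem_ball_self this)⟩
  have hball : ∀ x ∈ u, μ (closedBall x (5 * (2 * r x))) ≤ ENNReal.ofReal (400 * K) *
      (ENNReal.ofReal t * μ₁ (closedBall x (2 * r x) ∩ {y | η * t < g y})
        + μ₂ (closedBall x (2 * r x) ∩ {y | η * t < h y})) := by
    intro x hx
    obtain ⟨hr0, hm, hmax⟩ := hr x (huD hx)
    have key := sq_mul_sq_le_of_reverseHolder hA hη hηA ht hr0 hg0 hh0 hg hh hgi hh2 x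
      (hrev x _ hr0) hm
    have hS1 : MeasurableSet (closedBall x (2 * r x) ∩ {y | η * t < g y}) :=
      measurableSet_closedBall.inter (measurableSet_lt measurable_const hg)
    have hS2 : MeasurableSet (closedBall x (2 * r x) ∩ {y | η * t < h y}) :=
      measurableSet_closedBall.inter (measurableSet_lt measurable_const hh)
    rw [hμ, hμ₁, hμ₂, withDensity_ofReal_apply (fun y => by positivity) hg2
      measurableSet_closedBall, withDensity_ofReal_apply hg0 hgi hS1,
      withDensity_ofReal_apply (fun y => by positivity) hh2 hS2, ← ENNReal.ofReal_mul ht.le,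
      ← ENNReal.ofReal_add (mul_nonneg ht.le (integral_nonneg hg0))
        (integral_nonneg fun y => by positivity), ← ENNReal.ofReal_mul (by positivity)]
    apply ENNReal.ofReal_le_ofReal
    -- At radius $10r$ the stopping bound reads $t^2\cdot4\cdot100r^2$, the source of the factor
    -- 400.
    have := hmax (5 * (2 * r x)) (by linarith)
    linarith
  have hsub : {x | t < g x} ≤ᵐ[μ] ⋃ x ∈ u, closedBall x (5 * (2 * r x)) := by
    have hae : ∀ᵐ x ∂μ, ∀ t, 0 < t → t < g x → ∃ r, 0 < r ∧
        t ^ 2 * (4 * r ^ 2) ≤ ∫ y in closedBall x r, g y ^ 2 ∧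
        ∀ s, 2 * r ≤ s → ∫ y in closedBall x s, g y ^ 2 ≤ t ^ 2 * (4 * s ^ 2) :=
      (withDensity_absolutelyContinuous _ _).ae_le hradius
    filter_upwards [hae] with x hx htx
    have hxD : x ∈ D := hx t ht htx
    obtain ⟨b, hb, hxb⟩ := hcov x hxD
    exact mem_iUnion₂.2 ⟨b, hb, hxb (mem_closedBall_self (by linarith [(hr x hxD).1]))⟩
  have hdisj' : ∀ f : ℝ × ℝ → ℝ, u.PairwiseDisjoint
      fun x => closedBall x (2 * r x) ∩ {y | η * t < f y} := fun f =>
    hdisj.mono_on fun x _ => inter_subset_left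
  have hsum : ∀ (ν : Measure (ℝ × ℝ)) (f : ℝ × ℝ → ℝ), Measurable f →
      ∑' x : u, ν (closedBall (x : ℝ × ℝ) (2 * r x) ∩ {y | η * t < f y})
        ≤ ν {y | η * t < f y} := fun ν f hf => by
    rw [← measure_biUnion hucount (hdisj' f) fun x _ =>
      measurableSet_closedBall.inter (measurableSet_lt measurable_const hf)]
    exact measure_mono (iUnion₂_subset fun _ _ => inter_subset_right)
  calc μ {x | t < g x} ≤ μ (⋃ x ∈ u, closedBall x (5 * (2 * r x))) := measure_mono_ae hsub
    _ ≤ ∑' x : u, μ (closedBall (x : ℝ × ℝ) (5 * (2 * r x))) := measure_biUnion_le _ hucount _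
    _ ≤ ∑' x : u, ENNReal.ofReal (400 * K) *
      (ENNReal.ofReal t * μ₁ (closedBall (x : ℝ × ℝ) (2 * r x) ∩ {y | η * t < g y})
        + μ₂ (closedBall (x : ℝ × ℝ) (2 * r x) ∩ {y | η * t < h y})) :=
        ENNReal.tsum_le_tsum fun x => hball x x.2
    _ ≤ _ := by
        rw [ENNReal.tsum_mul_left, ENNReal.tsum_add, ENNReal.tsum_mul_left]
        gcongr
        · exact hsum _ _ hg
        · exact hsum _ _ hh

theorem lintegral_Ioi_rpow_mul_measure_lt {μ : Measure (ℝ × ℝ)} {f : ℝ × ℝ → ℝ}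
    (hf0 : ∀ x, 0 ≤ f x) (hf : Measurable f) {p : ℝ} (hp : 0 < p) :
    ∫⁻ t in Ioi (0 : ℝ), μ {x | t < f x} * ENNReal.ofReal (t ^ (p - 1))
      = ENNReal.ofReal p⁻¹ * ∫⁻ x, ENNReal.ofReal (f x ^ p) ∂μ := by
  rw [lintegral_rpow_eq_lintegral_meas_lt_mul μ (ae_of_all _ hf0) hf.aemeasurable hp, ← mul_assoc,
    ← ENNReal.ofReal_mul (by positivity), inv_mul_cancel₀ hp.ne', ENNReal.ofReal_one, one_mul]

theorem lintegral_withDensity_rpow {f w : ℝ × ℝ → ℝ} (hf : Measurable f)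
    (hw0 : ∀ x, 0 ≤ w x) (hw : Measurable w) {p : ℝ} :
    ∫⁻ x, ENNReal.ofReal (f x ^ p) ∂(volume.withDensity fun x => ENNReal.ofReal (w x))
      = ∫⁻ x, ENNReal.ofReal (w x * f x ^ p) := by
  rw [lintegral_withDensity_eq_lintegral_mul _ hw.ennreal_ofReal
    (hf.pow_const p).ennreal_ofReal]
  exact lintegral_congr fun x => (ENNReal.ofReal_mul (hw0 x)).symm

/-- **Gehring's lemma** on the plane with an inhomogeneous term. -/
theorem gehring (A : ℝ) (hA : 0 < A) :
    ∃ ρ : ℝ, 0 < ρ ∧ ∃ C : ℝ, ∀ g h : ℝ × ℝ → ℝ, (∀ x, 0 ≤ g x) → (∀ x, 0 ≤ h x) →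
      Measurable g → Measurable h → Integrable g → Integrable (fun x => g x ^ 2) →
      Integrable (fun x => h x ^ 2) → (∫⁻ x, ENNReal.ofReal (g x ^ (2 + ρ))) ≠ ⊤ →
      (∀ (x : ℝ × ℝ) (r : ℝ), 0 < r → ∫ y in closedBall x r, g y ^ 2
        ≤ A / r ^ 2 * (∫ y in closedBall x (2 * r), g y) ^ 2
          + A * ∫ y in closedBall x (2 * r), h y ^ 2) →
      ∫⁻ x, ENNReal.ofReal (g x ^ (2 + ρ))
        ≤ ENNReal.ofReal C * ∫⁻ x, ENNReal.ofReal (h x ^ (2 + ρ)) := by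
  set η := min 1 (√(1 / (528 * A))) with hη
  have hη0 : 0 < η := by positivity
  have hη1 : η ≤ 1 := min_le_left _ _
  have hηA : 528 * A * η ^ 2 ≤ 2 := by
    have h1 : η ^ 2 ≤ 1 / (528 * A) := by
      rw [← Real.sq_sqrt (by positivity : 0 ≤ 1 / (528 * A))]
      exact pow_le_pow_left₀ hη0.le (min_le_right _ _) 2
    have h2 : 528 * A * η ^ 2 ≤ 528 * A * (1 / (528 * A)) := by gcongr
    have h3 : 528 * A * (1 / (528 * A)) = 1 := by field_simp
    linarith
  set K := 400 * (√(2 * A) + A) with hK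
  have hK0 : 0 < K := by positivity
  -- Chosen so that $\rho K\eta^{-2}\le\tfrac12$, which is what the final absorption needs.
  set ρ := min 1 (η ^ 2 / (2 * K)) with hρ
  have hρ0 : 0 < ρ := by positivity
  have hρ1 : ρ ≤ 1 := min_le_left _ _
  refine ⟨ρ, hρ0, 2 * (K * η⁻¹ ^ ρ), fun g h hg0 hh0 hg hh hgi hg2 hh2 hfin hrev => ?_⟩
  have hlev : ∀ t : ℝ, 0 < t → _ := fun t ht =>
    levelSet_le_of_reverseHolder hA hη0 hηA ht hg0 hh0 hg hh hgi hg2 hh2 hrev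
  set μ := volume.withDensity (fun x => ENNReal.ofReal (g x ^ 2)) with hμ
  set μ₁ := volume.withDensity (fun x => ENNReal.ofReal (g x)) with hμ₁
  set μ₂ := volume.withDensity (fun x => ENNReal.ofReal (h x ^ 2)) with hμ₂
  have hset : ∀ (f : ℝ × ℝ → ℝ) (t : ℝ), {x | η * t < f x} = {x | t < η⁻¹ * f x} := fun f t => by
    ext x
    simp only [mem_ofPred_eq]
    rw [← div_eq_inv_mul, lt_div_iff₀ hη0, mul_comm]
  have hi0 : ∀ {f : ℝ × ℝ → ℝ}, (∀ x, 0 ≤ f x) → ∀ x, 0 ≤ η⁻¹ * f x := fun hf x =>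
    mul_nonneg (inv_nonneg.2 hη0.le) (hf x)
  set G := ∫⁻ x, ENNReal.ofReal (g x ^ (2 + ρ)) with hG
  set H := ∫⁻ x, ENNReal.ofReal (h x ^ (2 + ρ)) with hH
  have hpow2 : ∀ a : ℝ, 0 ≤ a → a ^ 2 * a ^ ρ = a ^ (2 + ρ) := fun a ha => by
    rw [← Real.rpow_natCast, ← Real.rpow_add_of_nonneg ha (by positivity) hρ0.le]; norm_num
  have hpow1 : ∀ a : ℝ, 0 ≤ a → a * a ^ (1 + ρ) = a ^ (2 + ρ) := fun a ha => by
    conv_lhs => rw [← Real.rpow_one a]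
    rw [← Real.rpow_mul ha, ← Real.rpow_add_of_nonneg ha zero_le_one (by positivity)]
    ring_nf
  have e1 : ∫⁻ t in Ioi (0 : ℝ), μ {x | t < g x} * ENNReal.ofReal (t ^ (ρ - 1))
      = ENNReal.ofReal ρ⁻¹ * G := by
    rw [lintegral_Ioi_rpow_mul_measure_lt hg0 hg hρ0, hμ, lintegral_withDensity_rpow hg
      (fun x => by positivity) (hg.pow_const 2)]
    congr 1
    exact lintegral_congr fun x => by rw [hpow2 _ (hg0 x)]
  have e2 : ∫⁻ t in Ioi (0 : ℝ), μ₁ {x | t < η⁻¹ * g x} * ENNReal.ofReal (t ^ (1 + ρ - 1))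
      = ENNReal.ofReal (1 + ρ)⁻¹ * (ENNReal.ofReal (η⁻¹ ^ (1 + ρ)) * G) := by
    rw [lintegral_Ioi_rpow_mul_measure_lt (hi0 hg0) (hg.const_mul _) (by positivity), hμ₁,
      lintegral_withDensity_rpow (hg.const_mul _) hg0 hg,
      ← lintegral_const_mul' (ENNReal.ofReal (η⁻¹ ^ (1 + ρ))) _ ENNReal.ofReal_ne_top]
    congr 1
    refine lintegral_congr fun x => ?_
    rw [Real.mul_rpow (by positivity) (hg0 x), ← ENNReal.ofReal_mul (by positivity),
      ← hpow1 _ (hg0 x)]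
    congr 1; ring
  have e3 : ∫⁻ t in Ioi (0 : ℝ), μ₂ {x | t < η⁻¹ * h x} * ENNReal.ofReal (t ^ (ρ - 1))
      = ENNReal.ofReal ρ⁻¹ * (ENNReal.ofReal (η⁻¹ ^ ρ) * H) := by
    rw [lintegral_Ioi_rpow_mul_measure_lt (hi0 hh0) (hh.const_mul _) hρ0, hμ₂,
      lintegral_withDensity_rpow (hh.const_mul _) (fun x => by positivity)
        (hh.pow_const 2), ← lintegral_const_mul' (ENNReal.ofReal (η⁻¹ ^ ρ)) _ ENNReal.ofReal_ne_top]
    congr 1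
    refine lintegral_congr fun x => ?_
    rw [Real.mul_rpow (by positivity) (hh0 x), ← ENNReal.ofReal_mul (by positivity),
      ← hpow2 _ (hh0 x)]
    congr 1; ring
  have hanti : ∀ (ν : Measure (ℝ × ℝ)) (f : ℝ × ℝ → ℝ),
      Measurable fun t : ℝ => ν {x | t < f x} := fun ν f =>
    Antitone.measurable fun a b hab => measure_mono fun x hx => lt_of_le_of_lt hab hx
  have hrpow : ∀ p : ℝ, Measurable fun t : ℝ => ENNReal.ofReal (t ^ p) := fun p =>
    (measurable_id.pow_const p).ennreal_ofReal
  -- The level-set estimate integrated against $t^{\rho-1}\,dt$. The first term on its right carries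
  -- an extra factor $t$ and so yields $1/(1+\rho)$ instead of $1/\rho$; this gain makes absorption
  -- possible for small $\rho$.
  have main : ENNReal.ofReal ρ⁻¹ * G ≤ ENNReal.ofReal K *
      (ENNReal.ofReal (1 + ρ)⁻¹ * (ENNReal.ofReal (η⁻¹ ^ (1 + ρ)) * G)
        + ENNReal.ofReal ρ⁻¹ * (ENNReal.ofReal (η⁻¹ ^ ρ) * H)) := by
    rw [← e1, ← e2, ← e3, ← lintegral_add_left
      (f := fun t : ℝ => μ₁ {x | t < η⁻¹ * g x} * ENNReal.ofReal (t ^ (1 + ρ - 1)))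
      ((hanti _ _).mul (hrpow _)),
      ← lintegral_const_mul' _ _ ENNReal.ofReal_ne_top]
    refine setLIntegral_mono' measurableSet_Ioi fun t ht => ?_
    have ht : 0 < t := ht
    have h1 : ENNReal.ofReal (t ^ (1 + ρ - 1)) = ENNReal.ofReal t * ENNReal.ofReal (t ^ (ρ - 1)) := by
      rw [← ENNReal.ofReal_mul ht.le]
      congr 1
      nth_rewrite 2 [← Real.rpow_one t]
      rw [← Real.rpow_add ht]; ring_nf
    have h2 := hlev t ht
    rw [hset, hset] at h2
    refine (mul_le_mul_left h2 _).trans (le_of_eq ?_)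
    rw [h1]; ring
  rcases eq_or_ne H ⊤ with hHt | hHt
  · rw [hHt, ENNReal.mul_top]
    · exact le_top
    · exact (ENNReal.ofReal_pos.2 (by positivity)).ne'
  -- Absorbing a multiple of `G` into the left side requires `G` to be finite beforehand.
  · rw [← ENNReal.ofReal_toReal hfin, ← ENNReal.ofReal_toReal hHt] at main ⊢
    set G' := G.toReal
    set H' := H.toReal
    have hG'0 : 0 ≤ G' := ENNReal.toReal_nonneg
    have hH'0 : 0 ≤ H' := ENNReal.toReal_nonneg
    rw [← ENNReal.ofReal_mul (by positivity), ← ENNReal.ofReal_mul (by positivity),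
      ← ENNReal.ofReal_mul (by positivity), ← ENNReal.ofReal_mul (by positivity),
      ← ENNReal.ofReal_mul (by positivity), ← ENNReal.ofReal_add (by positivity) (by positivity),
      ← ENNReal.ofReal_mul (by positivity), ENNReal.ofReal_le_ofReal_iff (by positivity)] at main
    rw [← ENNReal.ofReal_mul (by positivity)]
    apply ENNReal.ofReal_le_ofReal
    have h1 : η⁻¹ ^ (1 + ρ) ≤ η⁻¹ ^ 2 := by
      rw [← Real.rpow_natCast]
      exact Real.rpow_le_rpow_of_exponent_le ((one_le_inv₀ hη0).2 hη1) (by push_cast; linarith)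
    have h2 : ρ * (K * η⁻¹ ^ 2) ≤ 1 / 2 := by
      calc ρ * (K * η⁻¹ ^ 2) ≤ η ^ 2 / (2 * K) * (K * η⁻¹ ^ 2) := by
            gcongr; exact min_le_right _ _
        _ = 1 / 2 := by field_simp
    have h3 : (1 + ρ)⁻¹ ≤ 1 := inv_le_one_of_one_le₀ (by linarith)
    have h4 : ρ⁻¹ * G' ≤ K * (1 * (η⁻¹ ^ 2 * G') + ρ⁻¹ * (η⁻¹ ^ ρ * H')) :=
      main.trans (by gcongr)
    have h5 := mul_le_mul_of_nonneg_left h4 hρ0.le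
    have h6 : ρ * (K * (1 * (η⁻¹ ^ 2 * G') + ρ⁻¹ * (η⁻¹ ^ ρ * H')))
        = ρ * (K * η⁻¹ ^ 2) * G' + K * η⁻¹ ^ ρ * H' := by field_simp
    rw [h6, ← mul_assoc, mul_inv_cancel₀ hρ0.ne', one_mul] at h5
    have h7 : ρ * (K * η⁻¹ ^ 2) * G' ≤ 1 / 2 * G' := by gcongr
    linarith

end Gehring

/-! ### Sobolev-Poincaré inequality on squares and integration by parts for minors. -/

section Caccioppoli

open Set Metric Filter
open scoped Topology

theorem abs_sub_le_setIntegral_deriv {u u' : ℝ → ℝ} (hu : ∀ t, HasDerivAt u (u' t) t)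
    (hu' : Continuous u') {a b s t : ℝ} (hs : s ∈ Icc a b) (ht : t ∈ Icc a b) :
    |u s - u t| ≤ ∫ x in Icc a b, |u' x| := by
  wlog hst : t ≤ s generalizing s t
  · rw [abs_sub_comm]; exact this ht hs (le_of_not_ge hst)
  rw [← intervalIntegral.integral_eq_sub_of_hasDerivAt (fun x _ => hu x)
    (hu'.intervalIntegrable _ _)]
  refine (intervalIntegral.abs_integral_le_integral_abs hst).trans ?_
  rw [intervalIntegral.integral_of_le hst]
  exact setIntegral_mono_set hu'.abs.integrableOn_Icc (ae_of_all _ fun x => abs_nonneg _)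
    (LE.le.eventuallyLE fun x hx => ⟨ht.1.trans hx.1.le, hx.2.trans hs.2⟩)

/-- The coordinate directions of `ℝ × ℝ`. -/
def coordVec : Fin 2 → ℝ × ℝ := ![(1, 0), (0, 1)]

theorem continuous_fderiv_apply {w : ℝ × ℝ → ℝ} (hw : ContDiff ℝ 1 w) (v : ℝ × ℝ) :
    Continuous fun z => fderiv ℝ w z v :=
  (hw.continuous_fderiv one_ne_zero).clm_apply continuous_const

theorem hasDerivAt_slice_fst {w : ℝ × ℝ → ℝ} (hw : ContDiff ℝ 1 w) (x y : ℝ) :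
    HasDerivAt (fun t => w (t, y)) (fderiv ℝ w (x, y) (coordVec 0)) x := by
  have h := (hw.differentiable one_ne_zero (x, y)).hasFDerivAt
  exact h.comp_hasDerivAt x ((hasDerivAt_id x).prodMk (hasDerivAt_const x y))

theorem hasDerivAt_slice_snd {w : ℝ × ℝ → ℝ} (hw : ContDiff ℝ 1 w) (x y : ℝ) :
    HasDerivAt (fun t => w (x, t)) (fderiv ℝ w (x, y) (coordVec 1)) y := by
  have h := (hw.differentiable one_ne_zero (x, y)).hasFDerivAt
  exact h.comp_hasDerivAt y ((hasDerivAt_const y x).prodMk (hasDerivAt_id y))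

/-- The Sobolev-Poincaré inequality `W^{1,1} → L²` on a square. -/
theorem exists_setIntegral_sub_sq_le {w : ℝ × ℝ → ℝ} (hw : ContDiff ℝ 1 w) (z : ℝ × ℝ) {r : ℝ}
    (hr : 0 < r) : ∃ c : ℝ, ∫ p in closedBall z r, (w p - c) ^ 2
      ≤ (∫ p in closedBall z r, (|fderiv ℝ w p (coordVec 0)| + |fderiv ℝ w p (coordVec 1)|)) ^ 2 := by
  obtain ⟨a, b⟩ := z
  rw [← closedBall_prod_same, Real.closedBall_eq_Icc, Real.closedBall_eq_Icc]
  set I := Icc (a - r) (a + r)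
  set J := Icc (b - r) (b + r)
  have hc0 := (continuous_fderiv_apply hw (coordVec 0)).abs
  have hc1 := (continuous_fderiv_apply hw (coordVec 1)).abs
  have hK : IsCompact (I ×ˢ J) := isCompact_Icc.prod isCompact_Icc
  have hvol : (volume : Measure (ℝ × ℝ)).restrict (I ×ˢ J)
      = (volume.restrict I).prod (volume.restrict J) := by
    rw [Measure.volume_eq_prod, Measure.prod_restrict]
  have hint : ∀ f : ℝ × ℝ → ℝ, Continuous f →
      Integrable f ((volume.restrict I).prod (volume.restrict J)) := fun f hf => by
    rw [← hvol]; exact hf.continuousOn.integrableOn_compact hK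
  have hi0 := hint _ hc0
  have hi1 := hint _ hc1
  set F : ℝ → ℝ := fun y => ∫ x in I, |fderiv ℝ w (x, y) (coordVec 0)| with hF
  set G : ℝ → ℝ := fun x => ∫ y in J, |fderiv ℝ w (x, y) (coordVec 1)| with hG
  have hFi : IntegrableOn F J := hi0.integral_prod_right
  have hGi : IntegrableOn G I := hi1.integral_prod_left
  have hF0 : ∀ y, 0 ≤ F y := fun y => integral_nonneg fun x => abs_nonneg _
  have hG0 : ∀ x, 0 ≤ G x := fun x => integral_nonneg fun y => abs_nonneg _
  have hIv : volume.real I = 2 * r := by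
    rw [Real.volume_real_Icc_of_le (by linarith)]; ring
  have hJv : volume.real J = 2 * r := by
    rw [Real.volume_real_Icc_of_le (by linarith)]; ring
  have hne : ∀ s : Set ℝ, volume.real s = 2 * r → volume s ≠ 0 := fun s hs h0 => by
    rw [Measure.real, h0] at hs; simp at hs; linarith
  have htop : ∀ c d : ℝ, volume (Icc c d) ≠ ⊤ := fun c d => measure_Icc_lt_top.ne
  -- A good vertical and a good horizontal line, on which the derivative integrals are at most
  -- average. The constant is the value of `w` at their intersection.
  obtain ⟨x', hx', hGx'⟩ := exists_le_setAverage (hne I hIv) (htop _ _) hGi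
  obtain ⟨y', hy', hFy'⟩ := exists_le_setAverage (hne J hJv) (htop _ _) hFi
  rw [setAverage_eq, hIv, smul_eq_mul, ← div_eq_inv_mul, le_div_iff₀ (by positivity)] at hGx'
  rw [setAverage_eq, hJv, smul_eq_mul, ← div_eq_inv_mul, le_div_iff₀ (by positivity)] at hFy'
  have hsum : ∫ p in I ×ˢ J, (|fderiv ℝ w p (coordVec 0)| + |fderiv ℝ w p (coordVec 1)|)
      = (∫ y in J, F y) + ∫ x in I, G x := by
    rw [hvol, integral_add hi0 hi1, integral_prod_symm _ hi0, integral_prod _ hi1]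
  refine ⟨w (x', y'), ?_⟩
  -- The two L-shaped paths to $(x',y')$ give two bounds. Their product separates the variables, so
  -- its integral factorizes.
  have hpt : ∀ p ∈ I ×ˢ J, (w p - w (x', y')) ^ 2 ≤ (G p.1 + F y') * (F p.2 + G x') := by
    rintro ⟨x, y⟩ ⟨hx, hy⟩
    have hh : ∀ y, ∀ s ∈ I, ∀ t ∈ I, |w (s, y) - w (t, y)| ≤ F y := fun y s hs t ht =>
      abs_sub_le_setIntegral_deriv (fun t => hasDerivAt_slice_fst hw t y)
        ((continuous_fderiv_apply hw _).comp (by fun_prop)) hs ht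
    have hv : ∀ x, ∀ s ∈ J, ∀ t ∈ J, |w (x, s) - w (x, t)| ≤ G x := fun x s hs t ht =>
      abs_sub_le_setIntegral_deriv (fun t => hasDerivAt_slice_snd hw x t)
        ((continuous_fderiv_apply hw _).comp (by fun_prop)) hs ht
    have h1 : |w (x, y) - w (x', y')| ≤ F y + G x' :=
      (abs_sub_le _ (w (x', y)) _).trans (add_le_add (hh y x hx x' hx') (hv x' y hy y' hy'))
    have h2 : |w (x, y) - w (x', y')| ≤ G x + F y' :=
      (abs_sub_le _ (w (x, y')) _).trans (add_le_add (hv x y hy y' hy') (hh y' x hx x' hx'))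
    rw [← sq_abs, pow_two]
    exact mul_le_mul h2 h1 (abs_nonneg _) (add_nonneg (hG0 x) (hF0 y'))
  have hGc : Integrable (fun x => G x + F y') (volume.restrict I) :=
    hGi.add (integrable_const _)
  have hFc : Integrable (fun y => F y + G x') (volume.restrict J) :=
    hFi.add (integrable_const _)
  have hprod : ∫ p in I ×ˢ J, (G p.1 + F y') * (F p.2 + G x')
      = (∫ x in I, (G x + F y')) * ∫ y in J, (F y + G x') := by
    rw [hvol]; exact integral_prod_mul (L := ℝ) (fun x => G x + F y') (fun y => F y + G x')
  have hGI : ∫ x in I, (G x + F y') ≤ (∫ y in J, F y) + ∫ x in I, G x := by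
    rw [integral_add hGi (integrable_const _), setIntegral_const, hIv, smul_eq_mul]
    linarith
  have hFJ : ∫ y in J, (F y + G x') ≤ (∫ y in J, F y) + ∫ x in I, G x := by
    rw [integral_add hFi (integrable_const _), setIntegral_const, hJv, smul_eq_mul]
    linarith
  calc ∫ p in I ×ˢ J, (w p - w (x', y')) ^ 2
      ≤ ∫ p in I ×ˢ J, (G p.1 + F y') * (F p.2 + G x') := by
        refine setIntegral_mono_on ?_ ?_ (measurableSet_Icc.prod measurableSet_Icc) hpt
        · exact ((hw.continuous.sub continuous_const).pow 2).continuousOn.integrableOn_compact hK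
        · rw [IntegrableOn, hvol]; exact hGc.mul_prod hFc
    _ ≤ _ := by
        rw [hprod, hsum, pow_two]
        refine mul_le_mul hGI hFJ (integral_nonneg fun y => add_nonneg (hF0 y) (hG0 x')) ?_
        exact add_nonneg (integral_nonneg hF0) (integral_nonneg hG0)

/-- Minors are null Lagrangians: $\int\det(DP,Dw_2)=0$ for the compactly supported $P=\psi(w_1-c)$,
by symmetry of the second derivatives of $w_2$. The product rule then moves the derivative from
$w_1$ to $\psi$, for any constant $c$. -/
theorem integral_mul_minor_eq {ψ w₁ w₂ : ℝ × ℝ → ℝ} (hψ : ContDiff ℝ 2 ψ)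
    (hψc : HasCompactSupport ψ) (hw₁ : ContDiff ℝ 2 w₁) (hw₂ : ContDiff ℝ 2 w₂) (c : ℝ) :
    ∫ z, ψ z * (fderiv ℝ w₁ z (coordVec 0) * fderiv ℝ w₂ z (coordVec 1)
        - fderiv ℝ w₁ z (coordVec 1) * fderiv ℝ w₂ z (coordVec 0))
      = -∫ z, (w₁ z - c) * (fderiv ℝ ψ z (coordVec 0) * fderiv ℝ w₂ z (coordVec 1)
        - fderiv ℝ ψ z (coordVec 1) * fderiv ℝ w₂ z (coordVec 0)) := by
  set P : ℝ × ℝ → ℝ := fun z => ψ z * (w₁ z - c) with hP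
  have hPc : ContDiff ℝ 2 P := hψ.mul (hw₁.sub contDiff_const)
  have hPs : HasCompactSupport P := hψc.mul_right
  have hPd : ∀ v z, fderiv ℝ P z v = ψ z * fderiv ℝ w₁ z v + (w₁ z - c) * fderiv ℝ ψ z v := by
    intro v z
    rw [hP, fderiv_fun_mul (hψ.differentiable two_ne_zero z)
      ((hw₁.differentiable two_ne_zero z).sub_const c), fderiv_sub_const]
    simp
  have hd2 : ∀ v, ContDiff ℝ 1 (fun z => fderiv ℝ w₂ z v) := fun v =>
    (hw₂.fderiv_right (m := 1) (by norm_num)).clm_apply contDiff_const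
  have hibp : ∀ u v, ∫ z, P z * fderiv ℝ (fun z => fderiv ℝ w₂ z v) z u
      = -∫ z, fderiv ℝ P z u * fderiv ℝ w₂ z v := fun u v => by
    have hP1 : ContDiff ℝ 1 P := hPc.of_le (by norm_num)
    apply integral_mul_fderiv_eq_neg_fderiv_mul_of_integrable
    · exact ((continuous_fderiv_apply hP1 u).mul (hd2 v).continuous).integrable_of_hasCompactSupport
        (hPs.fderiv_apply ℝ u).mul_right
    · exact (hPc.continuous.mul
        (continuous_fderiv_apply (hd2 v) u)).integrable_of_hasCompactSupport hPs.mul_right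
    · exact (hPc.continuous.mul (hd2 v).continuous).integrable_of_hasCompactSupport hPs.mul_right
    · exact fun z _ => hPc.differentiable two_ne_zero z
    · exact fun z _ => (hd2 v).differentiable one_ne_zero z
  have hsymm : ∀ z u v, fderiv ℝ (fun z => fderiv ℝ w₂ z v) z u
      = fderiv ℝ (fun z => fderiv ℝ w₂ z u) z v := by
    intro z u v
    have hdd : DifferentiableAt ℝ (fderiv ℝ w₂) z :=
      (hw₂.fderiv_right (m := 1) (by norm_num)).differentiable one_ne_zero z
    have h := hw₂.contDiffAt.isSymmSndFDerivAt (x := z) (by simp)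
    have e : ∀ v u, fderiv ℝ (fun z => fderiv ℝ w₂ z v) z u = fderiv ℝ (fderiv ℝ w₂) z u v := by
      intro v u
      rw [fderiv_clm_apply hdd (differentiableAt_const v)]
      simp
    rw [e, e]; exact h u v
  have hz : ∫ z, fderiv ℝ P z (coordVec 0) * fderiv ℝ w₂ z (coordVec 1)
      = ∫ z, fderiv ℝ P z (coordVec 1) * fderiv ℝ w₂ z (coordVec 0) := by
    have h1 := hibp (coordVec 0) (coordVec 1)
    have h2 := hibp (coordVec 1) (coordVec 0)
    have h3 : ∫ z, P z * fderiv ℝ (fun z => fderiv ℝ w₂ z (coordVec 1)) z (coordVec 0)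
        = ∫ z, P z * fderiv ℝ (fun z => fderiv ℝ w₂ z (coordVec 0)) z (coordVec 1) :=
      integral_congr_ae (ae_of_all _ fun z => by simp only [hsymm z (coordVec 0) (coordVec 1)])
    linarith
  have cw₁ := fun v => continuous_fderiv_apply (hw₁.of_le (by norm_num : (1 : WithTop ℕ∞) ≤ 2)) v
  have cψ := fun v => continuous_fderiv_apply (hψ.of_le (by norm_num : (1 : WithTop ℕ∞) ≤ 2)) v
  have cP := fun v => continuous_fderiv_apply (hPc.of_le (by norm_num : (1 : WithTop ℕ∞) ≤ 2)) v
  have iP : ∀ u v, Integrable (fun z => fderiv ℝ P z u * fderiv ℝ w₂ z v) := fun u v =>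
    ((cP u).mul (hd2 v).continuous).integrable_of_hasCompactSupport
      (hPs.fderiv_apply ℝ u).mul_right
  rw [← sub_eq_zero, sub_neg_eq_add, ← integral_add]
  · rw [← sub_eq_zero, ← integral_sub (iP _ _) (iP _ _)] at hz
    rw [← hz]
    refine integral_congr_ae (ae_of_all _ fun z => ?_)
    simp only [hPd]; ring
  · exact (hψ.continuous.mul (((cw₁ _).mul (hd2 _).continuous).sub
      ((cw₁ _).mul (hd2 _).continuous))).integrable_of_hasCompactSupport hψc.mul_right
  · refine Continuous.integrable_of_hasCompactSupport ((hw₁.continuous.sub continuous_const).mul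
      (((cψ _).mul (hd2 _).continuous).sub ((cψ _).mul (hd2 _).continuous))) ?_
    refine HasCompactSupport.mul_left (HasCompactSupport.sub ?_ ?_)
    · exact (hψc.fderiv_apply ℝ _).mul_right
    · exact (hψc.fderiv_apply ℝ _).mul_right

end Caccioppoli

/-! ### Caccioppoli inequality for quadratic forms in minors. -/

section ReverseHolder

open Set Metric Filter
open scoped Topology

/-- Rescaling one fixed bump makes `D` universal. -/
theorem exists_cutoff : ∃ D : ℝ, 0 ≤ D ∧ ∀ (x : ℝ × ℝ) (r : ℝ), 0 < r → ∃ φ : ℝ × ℝ → ℝ,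
    ContDiff ℝ 2 φ ∧ HasCompactSupport φ ∧ (∀ z, 0 ≤ φ z) ∧ (∀ z, φ z ≤ 1) ∧
      (∀ z ∈ closedBall x r, φ z = 1) ∧ (∀ z, z ∉ closedBall x (2 * r) → φ z = 0) ∧
      ∀ z j, |fderiv ℝ φ z (coordVec j)| ≤ D / r := by
  let φ₀ : ContDiffBump (0 : ℝ × ℝ) := ⟨1, 2, one_pos, one_lt_two⟩
  have hs : ContDiff ℝ 2 (φ₀ : ℝ × ℝ → ℝ) := φ₀.contDiff
  obtain ⟨D, hD⟩ := ((hs.continuous_fderiv two_ne_zero).norm).bddAbove_range_of_hasCompactSupport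
    (φ₀.hasCompactSupport.fderiv ℝ).norm
  have hD' : ∀ z, ‖fderiv ℝ φ₀ z‖ ≤ D := fun z => hD ⟨z, rfl⟩
  refine ⟨D, (norm_nonneg _).trans (hD' 0), fun x r hr => ?_⟩
  have hmem : ∀ z s, r⁻¹ • (z - x) ∈ closedBall (0 : ℝ × ℝ) s ↔ z ∈ closedBall x (s * r) := by
    intro z s
    rw [mem_closedBall_zero_iff, norm_smul, norm_inv, Real.norm_of_nonneg hr.le,
      mem_closedBall, dist_eq_norm, ← div_eq_inv_mul, div_le_iff₀ hr]
  have hz0 : ∀ z, z ∉ closedBall x (2 * r) → φ₀ (r⁻¹ • (z - x)) = 0 := fun z hz => by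
    rw [← hmem] at hz
    apply φ₀.zero_of_le_dist
    simp only [mem_closedBall, not_le] at hz
    exact hz.le
  refine ⟨fun z => φ₀ (r⁻¹ • (z - x)), ?_, ?_, fun z => φ₀.nonneg, fun z => φ₀.le_one, ?_, hz0, ?_⟩
  · exact hs.comp ((contDiff_id.sub contDiff_const).const_smul _)
  · exact HasCompactSupport.intro (isCompact_closedBall x (2 * r)) hz0
  · intro z hz
    apply φ₀.one_of_mem_closedBall
    rw [hmem]; simpa [φ₀] using hz
  · intro z j
    have hd : HasFDerivAt (fun z : ℝ × ℝ => φ₀ (r⁻¹ • (z - x)))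
        ((fderiv ℝ φ₀ (r⁻¹ • (z - x))).comp (r⁻¹ • ContinuousLinearMap.id ℝ (ℝ × ℝ))) z :=
      (hs.differentiable two_ne_zero _).hasFDerivAt.comp z
        (((hasFDerivAt_id z).sub_const x).const_smul r⁻¹)
    rw [hd.fderiv]
    have hn : ‖coordVec j‖ ≤ 1 := by fin_cases j <;> simp [coordVec, Prod.norm_def]
    simp only [ContinuousLinearMap.comp_apply, smul_apply,
      ContinuousLinearMap.id_apply, map_smul, smul_eq_mul, abs_mul, abs_inv, abs_of_pos hr]
    rw [div_eq_inv_mul]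
    gcongr
    exact ((fderiv ℝ φ₀ _).le_opNorm _).trans
      ((mul_le_of_le_one_right (norm_nonneg _) hn).trans (hD' _))

variable {ι : Type}

/-- The matrix of partial derivatives of a map `ℝ × ℝ → ℝ^ι`. -/
def gradMat (w : ι → ℝ × ℝ → ℝ) (z : ℝ × ℝ) : Matrix ι (Fin 2) ℝ :=
  Matrix.of fun a j => fderiv ℝ (w a) z (coordVec j)

theorem continuous_gradMat {w : ι → ℝ × ℝ → ℝ} (hw : ∀ a, ContDiff ℝ 1 (w a)) :
    Continuous (gradMat w) :=
  continuous_pi fun a => continuous_pi fun j => continuous_fderiv_apply (hw a) (coordVec j)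

variable [Fintype ι]

theorem continuous_frobenius_norm : Continuous fun Z : Matrix ι (Fin 2) ℝ => ‖Z‖ := by
  have : (fun Z : Matrix ι (Fin 2) ℝ => ‖Z‖) = fun Z => √(∑ a, (Z a 0 ^ 2 + Z a 1 ^ 2)) := by
    ext Z; rw [← frobenius_norm_sq, Real.sqrt_sq (norm_nonneg _)]
  rw [this]
  fun_prop

theorem continuous_minorForm (q : ι → ι → ℝ) :
    Continuous fun Z : Matrix ι (Fin 2) ℝ => minorForm q Z := by
  unfold minorForm; fun_prop

theorem abs_minorForm_le (q : ι → ι → ℝ) (Z : Matrix ι (Fin 2) ℝ) :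
    |minorForm q Z| ≤ (2 * ∑ a, ∑ b, |q a b|) * ‖Z‖ ^ 2 := by
  unfold minorForm
  refine (Finset.abs_sum_le_sum_abs _ _).trans ?_
  rw [Finset.mul_sum, Finset.sum_mul]
  refine Finset.sum_le_sum fun a _ => (Finset.abs_sum_le_sum_abs _ _).trans ?_
  rw [Finset.mul_sum, Finset.sum_mul]
  refine Finset.sum_le_sum fun b _ => ?_
  have hm : ∀ a i b j, |Z a i * Z b j| ≤ ‖Z‖ ^ 2 := fun a i b j => by
    rw [abs_mul, pow_two]
    exact mul_le_mul (abs_entry_le_norm Z a i) (abs_entry_le_norm Z b j) (abs_nonneg _)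
      (norm_nonneg _)
  rw [abs_mul]
  have := (abs_sub _ _).trans (add_le_add (hm a 0 b 1) (hm a 1 b 0))
  nlinarith [abs_nonneg (q a b)]

/-- After integration by parts, each minor pairs $\varphi\,D\varphi\,(w_a-c_a)$ with $Dw_b$. Young's
inequality separates a small multiple of $\varphi^2\|Dw\|^2$ from $r^{-2}(w_a-c_a)^2$, and
Sobolev-Poincaré bounds the latter by the square of an $L^1$ norm. No ellipticity enters, and the
cutoff is chosen before `τ` and `w` so that limits in `w` can be taken later. -/
theorem caccioppoli (q : ι → ι → ℝ) : ∃ C : ℝ, 0 ≤ C ∧ ∀ (x : ℝ × ℝ) (r : ℝ), 0 < r →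
    ∃ φ : ℝ × ℝ → ℝ, Continuous φ ∧ (∀ z, 0 ≤ φ z) ∧ (∀ z, φ z ≤ 1) ∧
      (∀ z ∈ closedBall x r, φ z = 1) ∧ (∀ z, z ∉ closedBall x (2 * r) → φ z = 0) ∧
      ∀ τ : ℝ, 0 < τ → ∀ w : ι → ℝ × ℝ → ℝ, (∀ a, ContDiff ℝ 2 (w a)) →
        ∫ z, φ z ^ 2 * minorForm q (gradMat w z) ≤ τ * (∫ z, φ z ^ 2 * ‖gradMat w z‖ ^ 2)
          + C / (τ * r ^ 2) * (∫ z in closedBall x (2 * r), ‖gradMat w z‖) ^ 2 := by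
  obtain ⟨D, hD, hcut⟩ := exists_cutoff
  set Q := ∑ a, ∑ b, |q a b| with hQ
  have hQ0 : 0 ≤ Q := by positivity
  refine ⟨8 * D ^ 2 * Q * (Q + 1), by positivity, fun x r hr => ?_⟩
  obtain ⟨φ, hφ, hφs, hφ0, hφ1, hφB, hφz, hφd⟩ := hcut x r hr
  refine ⟨φ, hφ.continuous, hφ0, hφ1, hφB, hφz, fun τ hτ w hw => ?_⟩
  set B := closedBall x (2 * r) with hB
  have hw1 : ∀ a, ContDiff ℝ 1 (w a) := fun a => (hw a).of_le (by norm_num)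
  have hcg := continuous_gradMat hw1
  have hcn : Continuous fun z => ‖gradMat w z‖ := continuous_frobenius_norm.comp hcg
  have hc : ∀ a, ∃ c : ℝ, ∫ p in B, (w a p - c) ^ 2 ≤ (2 * ∫ z in B, ‖gradMat w z‖) ^ 2 := by
    intro a
    obtain ⟨c, hc⟩ := exists_setIntegral_sub_sq_le (hw1 a) x (by positivity : 0 < 2 * r)
    refine ⟨c, hc.trans ?_⟩
    refine pow_le_pow_left₀ (integral_nonneg fun z => by positivity) ?_ 2
    rw [← integral_const_mul]
    refine setIntegral_mono ?_ ?_ fun z => ?_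
    · exact ((continuous_fderiv_apply (hw1 a) _).abs.add
        (continuous_fderiv_apply (hw1 a) _).abs).continuousOn.integrableOn_compact
          (isCompact_closedBall _ _)
    · exact (hcn.const_mul 2).continuousOn.integrableOn_compact (isCompact_closedBall _ _)
    · have h0 := abs_entry_le_norm (gradMat w z) a 0
      have h1 := abs_entry_le_norm (gradMat w z) a 1
      simp only [gradMat, Matrix.of_apply] at h0 h1 ⊢
      linarith
  choose c hc using hc
  have hφs2 : HasCompactSupport fun z => φ z ^ 2 := by
    rw [show (fun z => φ z ^ 2) = φ * φ from funext fun z => pow_two _]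
    exact hφs.mul_right
  have hint : ∀ f : ℝ × ℝ → ℝ, Continuous f → Integrable fun z => φ z ^ 2 * f z := fun f hf =>
    ((hφ.continuous.pow 2).mul hf).integrable_of_hasCompactSupport hφs2.mul_right
  have hIi : Integrable fun z => φ z ^ 2 * ‖gradMat w z‖ ^ 2 := hint _ (hcn.pow 2)
  -- The Young parameter for one minor; weighted by the coefficients of `q`, the total stays below
  -- `τ`.
  set σ := τ / (Q + 1) with hσ
  have hσ0 : 0 < σ := by positivity
  set I := ∫ z, φ z ^ 2 * ‖gradMat w z‖ ^ 2 with hI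
  set N := ∫ z in B, ‖gradMat w z‖ with hN
  have hab : ∀ a b, q a b * ∫ z, φ z ^ 2 * (fderiv ℝ (w a) z (coordVec 0) *
      fderiv ℝ (w b) z (coordVec 1) - fderiv ℝ (w a) z (coordVec 1) * fderiv ℝ (w b) z (coordVec 0))
      ≤ |q a b| * (σ * I + 2 * (D / r) ^ 2 / σ * (2 * N) ^ 2) := by
    intro a b
    refine (le_abs_self _).trans ?_
    rw [abs_mul]
    gcongr
    have hψ : ContDiff ℝ 2 fun z => φ z ^ 2 := hφ.pow 2
    rw [integral_mul_minor_eq hψ hφs2 (hw a) (hw b) (c a), abs_neg]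
    have hψd : ∀ z v, fderiv ℝ (fun z => φ z ^ 2) z v = 2 * φ z * fderiv ℝ φ z v := by
      intro z v
      rw [fderiv_fun_pow 2 (hφ.differentiable two_ne_zero z)]
      simp
    have hBi : IntegrableOn (fun z => (w a z - c a) ^ 2) B :=
      (((hw a).continuous.sub continuous_const).pow 2).continuousOn.integrableOn_compact
        (isCompact_closedBall _ _)
    have hsplit : σ * I + 2 * (D / r) ^ 2 / σ * ∫ z in B, (w a z - c a) ^ 2
        = ∫ z, (σ * (φ z ^ 2 * ‖gradMat w z‖ ^ 2)
          + 2 * (D / r) ^ 2 / σ * B.indicator (fun z => (w a z - c a) ^ 2) z) := by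
      rw [integral_add (hIi.const_mul _), integral_const_mul,
        integral_const_mul, integral_indicator measurableSet_closedBall]
      exact ((integrable_indicator_iff measurableSet_closedBall).2 hBi).const_mul _
    have hle : σ * I + 2 * (D / r) ^ 2 / σ * ∫ z in B, (w a z - c a) ^ 2
        ≤ σ * I + 2 * (D / r) ^ 2 / σ * (2 * N) ^ 2 := by
      gcongr
      exact hc a
    refine le_trans ?_ hle
    rw [hsplit]
    refine (abs_integral_le_integral_abs).trans ?_
    refine integral_mono_of_nonneg (ae_of_all _ fun z => abs_nonneg _) ?_ (ae_of_all _ fun z => ?_)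
    · exact (hIi.const_mul _).add
        (((integrable_indicator_iff measurableSet_closedBall).2 hBi).const_mul _)
    · simp only [hψd]
      by_cases hz : z ∈ B
      · rw [indicator_of_mem hz]
        have hn := frobenius_norm_sq (gradMat w z)
        have hn' : fderiv ℝ (w b) z (coordVec 0) ^ 2 + fderiv ℝ (w b) z (coordVec 1) ^ 2
            ≤ ‖gradMat w z‖ ^ 2 := by
          rw [hn]
          exact Finset.single_le_sum (f := fun a => gradMat w z a 0 ^ 2 + gradMat w z a 1 ^ 2)
            (fun i _ => by positivity) (Finset.mem_univ b)
        have hd0 : fderiv ℝ φ z (coordVec 0) ^ 2 ≤ (D / r) ^ 2 := by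
          rw [← sq_abs]; exact pow_le_pow_left₀ (abs_nonneg _) (hφd z 0) 2
        have hd1 : fderiv ℝ φ z (coordVec 1) ^ 2 ≤ (D / r) ^ 2 := by
          rw [← sq_abs]; exact pow_le_pow_left₀ (abs_nonneg _) (hφd z 1) 2
        set p₀ := fderiv ℝ (w b) z (coordVec 0)
        set p₁ := fderiv ℝ (w b) z (coordVec 1)
        set d₀ := fderiv ℝ φ z (coordVec 0)
        set d₁ := fderiv ℝ φ z (coordVec 1)
        set y := w a z - c a
        have young : ∀ u v : ℝ, |2 * u * v| ≤ σ * u ^ 2 + v ^ 2 / σ := by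
          intro u v
          have e1 : σ * u ^ 2 + v ^ 2 / σ - 2 * u * v = (σ * u - v) ^ 2 / σ := by field_simp; ring
          have e2 : σ * u ^ 2 + v ^ 2 / σ + 2 * u * v = (σ * u + v) ^ 2 / σ := by field_simp; ring
          have e3 : 0 ≤ (σ * u - v) ^ 2 / σ := by positivity
          have e4 : 0 ≤ (σ * u + v) ^ 2 / σ := by positivity
          rw [abs_le]; constructor <;> linarith
        have y0 := young (φ z * p₁) (y * d₀)
        have y1 := young (φ z * p₀) (y * d₁)
        have e : y * (2 * φ z * d₀ * p₁ - 2 * φ z * d₁ * p₀)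
            = 2 * (φ z * p₁) * (y * d₀) - 2 * (φ z * p₀) * (y * d₁) := by ring
        rw [e]
        refine (abs_sub _ _).trans ((add_le_add y0 y1).trans ?_)
        have f1 : σ * (φ z * p₁) ^ 2 + σ * (φ z * p₀) ^ 2 ≤ σ * (φ z ^ 2 * ‖gradMat w z‖ ^ 2) := by
          have := mul_le_mul_of_nonneg_left hn' (by positivity : 0 ≤ σ * φ z ^ 2)
          linarith
        have f2 : (y * d₀) ^ 2 / σ + (y * d₁) ^ 2 / σ ≤ 2 * (D / r) ^ 2 / σ * y ^ 2 := by
          rw [← add_div, div_mul_eq_mul_div]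
          gcongr
          nlinarith [sq_nonneg y]
        linarith
      · rw [indicator_of_notMem hz, hφz z hz]
        simp
  have hexp : ∫ z, φ z ^ 2 * minorForm q (gradMat w z) = ∑ a, ∑ b, q a b * ∫ z, φ z ^ 2 *
      (fderiv ℝ (w a) z (coordVec 0) * fderiv ℝ (w b) z (coordVec 1)
        - fderiv ℝ (w a) z (coordVec 1) * fderiv ℝ (w b) z (coordVec 0)) := by
    have hcd := fun a j => continuous_fderiv_apply (hw1 a) (coordVec j)
    have hi : ∀ a b, Integrable fun z => q a b * (φ z ^ 2 *
      (fderiv ℝ (w a) z (coordVec 0) * fderiv ℝ (w b) z (coordVec 1)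
        - fderiv ℝ (w a) z (coordVec 1) * fderiv ℝ (w b) z (coordVec 0))) := fun a b =>
      (hint _ (((hcd _ _).mul (hcd _ _)).sub ((hcd _ _).mul (hcd _ _)))).const_mul _
    simp_rw [← integral_const_mul]
    simp_rw [← integral_finsetSum _ fun b _ => hi _ b]
    rw [← integral_finsetSum _ fun a _ => integrable_finsetSum _ fun b _ => hi a b]
    refine integral_congr_ae (ae_of_all _ fun z => ?_)
    simp only [minorForm, gradMat, Matrix.of_apply, Finset.mul_sum]
    refine Finset.sum_congr rfl fun a _ => Finset.sum_congr rfl fun b _ => ?_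
    ring
  rw [hexp]
  refine (Finset.sum_le_sum fun a _ => Finset.sum_le_sum fun b _ => hab a b).trans ?_
  simp_rw [← Finset.sum_mul]
  rw [← hQ]
  have hI0 : 0 ≤ I := integral_nonneg fun z => by positivity
  have h1 : Q * (σ * I) ≤ τ * I := by
    rw [← mul_assoc]
    gcongr
    rw [hσ, mul_div_assoc', div_le_iff₀ (by positivity)]
    nlinarith
  have h2 : Q * (2 * (D / r) ^ 2 / σ * (2 * N) ^ 2)
      = 8 * D ^ 2 * Q * (Q + 1) / (τ * r ^ 2) * N ^ 2 := by
    rw [hσ]; field_simp; ring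
  rw [mul_add, h2]
  linarith

end ReverseHolder

/-! ### Reverse Hölder inequality and higher integrability for limits of smooth gradients. -/

section HigherIntegrability

open Set Metric Filter
open scoped Topology

variable {ι : Type} [Fintype ι]

theorem integrable_of_bounded_of_compact {E : Type*} [TopologicalSpace E] [MeasurableSpace E]
    [OpensMeasurableSpace E] [T2Space E] {μ : Measure E} [IsFiniteMeasureOnCompacts μ] {f : E → ℝ}
    (hf : AEStronglyMeasurable f μ) {K : Set E} (hK : IsCompact K) (hfK : ∀ z, z ∉ K → f z = 0)
    {B : ℝ} (hB : ∀ᵐ z ∂μ, |f z| ≤ B) : Integrable f μ := by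
  rw [← integrableOn_iff_integrable_of_support_subset (s := K)]
  · exact Measure.integrableOn_of_bounded hK.measure_lt_top.ne hf (ae_restrict_of_ae hB)
  · intro z hz
    by_contra h
    exact hz (hfK z h)

/-- Ellipticity holds only for the limit field `G`, while integration by parts needs smooth maps.
The Caccioppoli inequality is therefore passed to the limit by dominated convergence before
ellipticity is used. The bound `B` serves domination only and does not affect `A`. -/
theorem reverseHolder_of_limit (q : ι → ι → ℝ) {c : ℝ} (hc : 0 < c) : ∃ A : ℝ, 0 < A ∧
    ∀ (G : ℝ × ℝ → Matrix ι (Fin 2) ℝ) (h : ℝ × ℝ → ℝ) (w : ℕ → ι → ℝ × ℝ → ℝ) (B : ℝ),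
      Measurable (fun z => ‖G z‖) → Measurable (fun z => minorForm q (G z)) →
      Integrable (fun z => h z ^ 2) → (∀ m a, ContDiff ℝ 2 (w m a)) →
      (∀ m z, ‖gradMat (w m) z‖ ≤ B) →
      (∀ᵐ z, Tendsto (fun m => gradMat (w m) z) atTop (𝓝 (G z))) →
      (∀ᵐ z, c * ‖G z‖ ^ 2 ≤ minorForm q (G z) + h z ^ 2) →
      ∀ (x : ℝ × ℝ) (r : ℝ), 0 < r → ∫ y in closedBall x r, ‖G y‖ ^ 2
        ≤ A / r ^ 2 * (∫ y in closedBall x (2 * r), ‖G y‖) ^ 2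
          + A * ∫ y in closedBall x (2 * r), h y ^ 2 := by
  obtain ⟨C, hC, hcac⟩ := caccioppoli q
  refine ⟨4 * C / c ^ 2 + 2 / c, by positivity,
    fun G h w B hGm hQm hh hw hB hlim hell x r hr => ?_⟩
  obtain ⟨φ, hφc, hφ0, hφ1, hφB, hφz, hmain⟩ := hcac x r hr
  have hB0 : 0 ≤ B := (norm_nonneg _).trans (hB 0 0)
  set D := closedBall x (2 * r) with hD
  have hDc : IsCompact D := isCompact_closedBall _ _
  have hφD : ∀ (z : ℝ × ℝ) (s : ℝ), |s| ≤ (2 * ∑ a, ∑ b, |q a b| + 1) * B ^ 2 →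
      ‖φ z ^ 2 * s‖ ≤ D.indicator (fun _ => (2 * ∑ a, ∑ b, |q a b| + 1) * B ^ 2) z := by
    intro z s hs
    by_cases hz : z ∈ D
    · rw [indicator_of_mem hz, norm_mul, norm_pow, Real.norm_of_nonneg (hφ0 z)]
      calc φ z ^ 2 * ‖s‖ ≤ 1 * ‖s‖ := by gcongr; exact pow_le_one₀ (hφ0 z) (hφ1 z)
        _ ≤ _ := by rw [one_mul]; exact hs
    · rw [indicator_of_notMem hz, hφz z hz]; simp
  have hbi : Integrable (D.indicator fun _ => (2 * ∑ a, ∑ b, |q a b| + 1) * B ^ 2) :=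
    (integrable_indicator_iff measurableSet_closedBall).2
      (integrableOn_const hDc.measure_lt_top.ne)
  have hQB : ∀ Z : Matrix ι (Fin 2) ℝ, ‖Z‖ ≤ B →
      |minorForm q Z| ≤ (2 * ∑ a, ∑ b, |q a b| + 1) * B ^ 2 := fun Z hZ =>
    (abs_minorForm_le q Z).trans (by gcongr; linarith)
  have hNB : ∀ Z : Matrix ι (Fin 2) ℝ, ‖Z‖ ≤ B →
      |‖Z‖ ^ 2| ≤ (2 * ∑ a, ∑ b, |q a b| + 1) * B ^ 2 := fun Z hZ => by
    rw [abs_of_nonneg (by positivity)]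
    have h1 : ‖Z‖ ^ 2 ≤ B ^ 2 := by gcongr
    have h2 : 0 ≤ (2 * ∑ a, ∑ b, |q a b|) * B ^ 2 := by positivity
    linarith
  have hgc : ∀ m, Continuous (gradMat (w m)) := fun m =>
    continuous_gradMat fun a => (hw m a).of_le (by norm_num)
  have hGB : ∀ᵐ z, ‖G z‖ ≤ B := by
    filter_upwards [hlim] with z hz
    exact le_of_tendsto ((continuous_frobenius_norm.tendsto _).comp hz)
      (Eventually.of_forall fun m => hB m z)
  have l1 : Tendsto (fun m => ∫ z, φ z ^ 2 * minorForm q (gradMat (w m) z)) atTop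
      (𝓝 (∫ z, φ z ^ 2 * minorForm q (G z))) := by
    refine tendsto_integral_of_dominated_convergence _ (fun m => ?_) hbi (fun m => ?_) ?_
    · exact ((hφc.pow 2).mul ((continuous_minorForm q).comp (hgc m))).aestronglyMeasurable
    · exact ae_of_all _ fun z => hφD z _ (hQB _ (hB m z))
    · filter_upwards [hlim] with z hz
      exact (((continuous_minorForm q).tendsto _).comp hz).const_mul _
  have l2 : Tendsto (fun m => ∫ z, φ z ^ 2 * ‖gradMat (w m) z‖ ^ 2) atTop
      (𝓝 (∫ z, φ z ^ 2 * ‖G z‖ ^ 2)) := by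
    refine tendsto_integral_of_dominated_convergence _ (fun m => ?_) hbi (fun m => ?_) ?_
    · exact ((hφc.pow 2).mul
        ((continuous_frobenius_norm.comp (hgc m)).pow 2)).aestronglyMeasurable
    · exact ae_of_all _ fun z => hφD z _ (hNB _ (hB m z))
    · filter_upwards [hlim] with z hz
      exact (((continuous_frobenius_norm.tendsto _).comp hz).pow 2).const_mul _
  have l3 : Tendsto (fun m => ∫ z in D, ‖gradMat (w m) z‖) atTop (𝓝 (∫ z in D, ‖G z‖)) := by
    refine tendsto_integral_of_dominated_convergence (fun _ => B) (fun m => ?_)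
      (integrableOn_const hDc.measure_lt_top.ne) (fun m => ?_) ?_
    · exact (continuous_frobenius_norm.comp (hgc m)).aestronglyMeasurable
    · exact ae_of_all _ fun z => by rw [norm_norm]; exact hB m z
    · filter_upwards [ae_restrict_of_ae hlim] with z hz
      exact (continuous_frobenius_norm.tendsto _).comp hz
  -- With $\tau=c/2$, half of the elliptic lower bound remains after absorption.
  have hlimit := le_of_tendsto_of_tendsto' l1 ((l2.const_mul (c / 2)).add ((l3.pow 2).const_mul
    (C / (c / 2 * r ^ 2)))) fun m => hmain (c / 2) (by positivity) (w m) (hw m)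
  have i1 : Integrable fun z => φ z ^ 2 * minorForm q (G z) := by
    refine hbi.mono' ((hφc.measurable.pow_const 2).mul hQm).aestronglyMeasurable ?_
    filter_upwards [hGB] with z hz using hφD z _ (hQB _ hz)
  have i2 : Integrable fun z => φ z ^ 2 * ‖G z‖ ^ 2 := by
    refine hbi.mono' ((hφc.measurable.pow_const 2).mul (hGm.pow_const 2)).aestronglyMeasurable ?_
    filter_upwards [hGB] with z hz using hφD z _ (hNB _ hz)
  have hhD : Integrable (D.indicator fun z => h z ^ 2) :=
    hh.indicator measurableSet_closedBall
  have h1 : c * ∫ z, φ z ^ 2 * ‖G z‖ ^ 2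
      ≤ (∫ z, φ z ^ 2 * minorForm q (G z)) + ∫ z in D, h z ^ 2 := by
    rw [← integral_indicator measurableSet_closedBall, ← integral_const_mul,
      ← integral_add i1 hhD]
    refine integral_mono_ae (i2.const_mul _) (i1.add hhD) ?_
    filter_upwards [hell] with z hz
    by_cases hzD : z ∈ D
    · rw [indicator_of_mem hzD]
      have e1 := mul_le_mul_of_nonneg_left hz (sq_nonneg (φ z))
      have e2 : φ z ^ 2 * h z ^ 2 ≤ 1 * h z ^ 2 := by
        gcongr; exact pow_le_one₀ (hφ0 z) (hφ1 z)
      linarith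
    · rw [indicator_of_notMem hzD, hφz z hzD]; simp
  have h2 : ∫ y in closedBall x r, ‖G y‖ ^ 2 ≤ ∫ z, φ z ^ 2 * ‖G z‖ ^ 2 := by
    rw [← integral_indicator measurableSet_closedBall]
    refine integral_mono_of_nonneg (ae_of_all _ fun z => ?_) i2 (ae_of_all _ fun z => ?_)
    · exact indicator_nonneg (fun _ _ => by positivity) z
    · by_cases hz : z ∈ closedBall x r
      · simp [indicator_of_mem hz, hφB z hz]
      · rw [indicator_of_notMem hz]; exact mul_nonneg (sq_nonneg _) (sq_nonneg _)
  refine h2.trans ?_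
  set I := ∫ z, φ z ^ 2 * ‖G z‖ ^ 2
  set N := ∫ z in D, ‖G z‖
  set H := ∫ z in D, h z ^ 2 with hH
  have hH0 : 0 ≤ H := integral_nonneg fun z => by positivity
  have h3 : I ≤ 2 / c * (C / (c / 2 * r ^ 2) * N ^ 2 + H) := by
    have : c / 2 * I ≤ C / (c / 2 * r ^ 2) * N ^ 2 + H := by linarith
    calc I = 2 / c * (c / 2 * I) := by field_simp
      _ ≤ _ := by gcongr
  have h4 : 2 / c * (C / (c / 2 * r ^ 2) * N ^ 2 + H) = 4 * C / c ^ 2 / r ^ 2 * N ^ 2 + 2 / c * H := by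
    field_simp; ring
  rw [h4] at h3
  refine h3.trans ?_
  gcongr
  · have : 0 ≤ 2 / c := by positivity
    linarith
  · have : 0 ≤ 4 * C / c ^ 2 := by positivity
    linarith

/-- Boundedness and compact support of `G` supply the a priori finiteness that `gehring` demands,
yet `C` depends on neither `B` nor `K`. This is what makes the bound uniform in the step of a
difference quotient. -/
theorem higher_integrability (q : ι → ι → ℝ) {c : ℝ} (hc : 0 < c) : ∃ ρ : ℝ, 0 < ρ ∧ ∃ C : ℝ,
    ∀ (G : ℝ × ℝ → Matrix ι (Fin 2) ℝ) (h : ℝ × ℝ → ℝ) (w : ℕ → ι → ℝ × ℝ → ℝ) (B : ℝ)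
      (K : Set (ℝ × ℝ)), IsCompact K → (∀ z, z ∉ K → G z = 0) →
      (∀ a j, Measurable fun z => G z a j) → Measurable h → (∀ z, 0 ≤ h z) →
      Integrable (fun z => h z ^ 2) → (∀ m a, ContDiff ℝ 2 (w m a)) →
      (∀ m z, ‖gradMat (w m) z‖ ≤ B) →
      (∀ᵐ z, Tendsto (fun m => gradMat (w m) z) atTop (𝓝 (G z))) →
      (∀ᵐ z, c * ‖G z‖ ^ 2 ≤ minorForm q (G z) + h z ^ 2) →
      ∫⁻ z, ENNReal.ofReal (‖G z‖ ^ (2 + ρ))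
        ≤ ENNReal.ofReal C * ∫⁻ z, ENNReal.ofReal (h z ^ (2 + ρ)) := by
  obtain ⟨A, hA, hrev⟩ := reverseHolder_of_limit q hc
  obtain ⟨ρ, hρ, C, hgeh⟩ := gehring A hA
  refine ⟨ρ, hρ, C, fun G h w B K hK hGK hG hhm hh0 hh hw hB hlim hell => ?_⟩
  have hGm : Measurable fun z => ‖G z‖ := by
    have : (fun z => ‖G z‖) = fun z => √(∑ a, (G z a 0 ^ 2 + G z a 1 ^ 2)) := by
      ext z; rw [← frobenius_norm_sq, Real.sqrt_sq (norm_nonneg _)]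
    rw [this]
    exact (Finset.measurable_fun_sum _ fun a _ =>
      ((hG a 0).pow_const 2).add ((hG a 1).pow_const 2)).sqrt
  have hQm : Measurable fun z => minorForm q (G z) :=
    Finset.measurable_fun_sum _ fun a _ => Finset.measurable_fun_sum _ fun b _ =>
      (((hG a 0).mul (hG b 1)).sub ((hG a 1).mul (hG b 0))).const_mul _
  have hGB : ∀ᵐ z, ‖G z‖ ≤ B := by
    filter_upwards [hlim] with z hz
    exact le_of_tendsto ((continuous_frobenius_norm.tendsto _).comp hz)
      (Eventually.of_forall fun m => hB m z)
  have hpow : ∀ p : ℝ, 0 < p → Integrable fun z => ‖G z‖ ^ p := fun p hp => by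
    refine integrable_of_bounded_of_compact (hGm.pow_const p).aestronglyMeasurable hK
      (fun z hz => by rw [hGK z hz, norm_zero, Real.zero_rpow hp.ne']) (B := B ^ p) ?_
    filter_upwards [hGB] with z hz
    rw [abs_of_nonneg (by positivity)]
    gcongr
  refine hgeh (fun z => ‖G z‖) h (fun z => norm_nonneg _) hh0 hGm hhm ?_ ?_ hh ?_
    (hrev G h w B hGm hQm hh hw hB hlim hell)
  · simpa using hpow 1 one_pos
  · simpa using hpow 2 two_pos
  · rw [← ofReal_integral_eq_lintegral_ofReal (hpow _ (by positivity))
      (ae_of_all _ fun z => by positivity)]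
    exact ENNReal.ofReal_ne_top

end HigherIntegrability

/-! ### Mollification of weakly differentiable functions in the plane. -/

section Mollification

open Set Metric Filter
open scoped Topology Convolution

/-- A sequence of bump functions shrinking to the origin of the plane. -/
def planeBump (m : ℕ) : ContDiffBump (0 : Plane) :=
  ⟨1 / (m + 1), 2 / (m + 1), by positivity, by gcongr; norm_num⟩

theorem tendsto_planeBump_rOut : Tendsto (fun m => (planeBump m).rOut) atTop (𝓝 0) := by
  have := (tendsto_one_div_add_atTop_nhds_zero_nat (𝕜 := ℝ)).const_mul 2
  simpa [planeBump, mul_one_div, div_eq_mul_inv] using this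

/-- The mollification of `g` at scale `1 / m`. -/
def mollify (m : ℕ) (g : Plane → ℝ) : Plane → ℝ :=
  (planeBump m).normed volume ⋆[ContinuousLinearMap.lsmul ℝ ℝ, volume] g

theorem mollify_apply (m : ℕ) (g : Plane → ℝ) (x : Plane) :
    mollify m g x = ∫ y, (planeBump m).normed volume (x - y) * g y := by
  rw [mollify, convolution_eq_swap]; rfl

theorem contDiff_mollify (m : ℕ) {g : Plane → ℝ} (hg : LocallyIntegrable g) :
    ContDiff ℝ ∞ (mollify m g) :=
  (planeBump m).hasCompactSupport_normed.contDiff_convolution_left _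
    (planeBump m).contDiff_normed hg

theorem ae_tendsto_mollify {g : Plane → ℝ} (hg : LocallyIntegrable g) :
    ∀ᵐ x, Tendsto (fun m => mollify m g x) atTop (𝓝 (g x)) :=
  ContDiffBump.ae_convolution_tendsto_right_of_locallyIntegrable (K := 2) tendsto_planeBump_rOut
    (Eventually.of_forall fun m => by simp [planeBump]; ring_nf; rfl) hg

theorem locallyIntegrable_of_bounded {g : Plane → ℝ} (hg : Measurable g) {B : ℝ}
    (hB : ∀ x, |g x| ≤ B) : LocallyIntegrable g :=
  (locallyIntegrable_const B).mono hg.aestronglyMeasurable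
    (ae_of_all _ fun x => (hB x).trans (le_abs_self B))

theorem abs_mollify_le (m : ℕ) {g : Plane → ℝ} {B : ℝ} (hB : ∀ x, |g x| ≤ B) (x : Plane) :
    |mollify m g x| ≤ B := by
  have hi : Integrable ((planeBump m).normed volume) := (planeBump m).integrable_normed
  rw [mollify, convolution]
  refine (abs_integral_le_integral_abs).trans ?_
  calc _ ≤ ∫ t, (planeBump m).normed volume t * B := by
        refine integral_mono_of_nonneg (ae_of_all _ fun t => abs_nonneg _) (hi.mul_const B)
          (ae_of_all _ fun t => ?_)
        simp only [ContinuousLinearMap.lsmul_apply, smul_eq_mul, abs_mul,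
          abs_of_nonneg ((planeBump m).nonneg_normed t)]
        exact mul_le_mul_of_nonneg_left (hB _) ((planeBump m).nonneg_normed t)
    _ = B := by rw [integral_mul_const, (planeBump m).integral_normed, one_mul]

/-- The derivative falls on the kernel, and $y\mapsto\psi(x-y)$ is an admissible test function once
the ball of the mollifier around `x` stays inside `Ω`. -/
theorem fderiv_mollify {Ω : Set Plane} {u v : Plane → ℝ} {j : Fin 2} (hu : LocallyIntegrable u)
    (hweak : ∀ φ : Plane → ℝ, ContDiff ℝ ∞ φ → HasCompactSupport φ → tsupport φ ⊆ Ω →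
      ∫ x, u x * fderiv ℝ φ x (EuclideanSpace.single j 1) = -∫ x, v x * φ x)
    (m : ℕ) {x : Plane} (hx : closedBall x (planeBump m).rOut ⊆ Ω) :
    fderiv ℝ (mollify m u) x (EuclideanSpace.single j 1) = mollify m v x := by
  set ψ := (planeBump m).normed volume with hψ
  have hψs : ContDiff ℝ ∞ ψ := (planeBump m).contDiff_normed
  have hψc : HasCompactSupport ψ := (planeBump m).hasCompactSupport_normed
  have h1 : HasFDerivAt (mollify m u) _ x := hψc.hasFDerivAt_convolution_left
    (ContinuousLinearMap.lsmul ℝ ℝ) (hψs.of_le (by exact_mod_cast le_top)) hu x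
  have hcd : Continuous (fderiv ℝ ψ) := hψs.continuous_fderiv (by simp)
  have hex := (hψc.fderiv ℝ).convolutionExists_left
    (ContinuousLinearMap.precompL Plane (ContinuousLinearMap.lsmul ℝ ℝ)) hcd hu x
  rw [h1.fderiv, mollify_apply, convolution_def, ContinuousLinearMap.integral_apply hex,
    ← integral_sub_left_eq_self _ volume x]
  have hφd : ∀ y, fderiv ℝ (fun y => ψ (x - y)) y (EuclideanSpace.single j 1)
      = -fderiv ℝ ψ (x - y) (EuclideanSpace.single j 1) := fun y => by
    have := ((hψs.differentiable (by simp) (x - y)).hasFDerivAt).comp y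
      ((hasFDerivAt_id y).const_sub x)
    rw [show (fun y => ψ (x - y)) = ψ ∘ HSub.hSub x from rfl, this.fderiv]
    simp
  have hzero : ∀ y, y ∉ closedBall x (planeBump m).rOut → ψ (x - y) = 0 := fun y hy => by
    have : x - y ∉ Function.support ψ := by
      rw [hψ, ContDiffBump.support_normed_eq]
      simp only [mem_ball_zero_iff, mem_closedBall, not_le, not_lt] at hy ⊢
      rw [← dist_eq_norm, dist_comm]; exact hy.le
    simpa using this
  have hsupp : tsupport (fun y => ψ (x - y)) ⊆ closedBall x (planeBump m).rOut :=
    closure_minimal (fun y hy => by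
      by_contra h
      exact hy (hzero y h)) isClosed_closedBall
  have h2 := hweak (fun y => ψ (x - y)) (hψs.comp (contDiff_const.sub contDiff_id))
    (HasCompactSupport.intro (isCompact_closedBall x _) hzero) (hsupp.trans hx)
  simp only [hφd, mul_neg, integral_neg, neg_inj] at h2
  simp only [ContinuousLinearMap.precompL_apply, ContinuousLinearMap.lsmul_apply, smul_eq_mul,
    sub_sub_cancel]
  calc _ = ∫ y, u y * fderiv ℝ ψ (x - y) (EuclideanSpace.single j 1) :=
        integral_congr_ae (ae_of_all _ fun y => mul_comm _ _)
    _ = _ := h2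
    _ = _ := integral_congr_ae (ae_of_all _ fun y => mul_comm _ _)

theorem eventually_fderiv_mollify {Ω K : Set Plane} (hΩ : IsOpen Ω) (hK : IsCompact K)
    (hKΩ : K ⊆ Ω) {u v : Plane → ℝ} {j : Fin 2} (hu : LocallyIntegrable u)
    (hweak : ∀ φ : Plane → ℝ, ContDiff ℝ ∞ φ → HasCompactSupport φ → tsupport φ ⊆ Ω →
      ∫ x, u x * fderiv ℝ φ x (EuclideanSpace.single j 1) = -∫ x, v x * φ x) :
    ∀ᶠ m in atTop, ∀ x ∈ K,
      fderiv ℝ (mollify m u) x (EuclideanSpace.single j 1) = mollify m v x := by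
  obtain ⟨δ, hδ, hsub⟩ := hK.exists_cthickening_subset_open hΩ hKΩ
  filter_upwards [tendsto_planeBump_rOut.eventually (gt_mem_nhds hδ)] with m hm x hx
  refine fderiv_mollify hu hweak m (Subset.trans ?_ hsub)
  exact (closedBall_subset_closedBall hm.le).trans (closedBall_subset_cthickening hx δ)

end Mollification

/-! ### Uniform $L^{2+\rho}$ bounds for difference quotients of the gradient. -/

section DifferenceQuotient

open Set Metric Filter
open scoped Topology Manifold

/-- The identification of `ℝ × ℝ` with the Euclidean plane. -/
def toPlane : (ℝ × ℝ) ≃L[ℝ] Plane :=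
  (ContinuousLinearEquiv.finTwoArrow ℝ ℝ).symm.trans (EuclideanSpace.equiv (Fin 2) ℝ).symm

theorem toPlane_coordVec (j : Fin 2) : toPlane (coordVec j) = EuclideanSpace.single j 1 := by
  ext i
  fin_cases j <;> fin_cases i <;> simp [toPlane, coordVec]

/-- Lets the estimates on $\mathbb R\times\mathbb R$ be transported to the Euclidean plane of the
Sobolev spaces. -/
theorem measurePreserving_toPlane : MeasurePreserving toPlane volume volume :=
  (PiLp.volume_preserving_toLp (Fin 2)).comp (volume_preserving_finTwoArrow ℝ).symm

theorem exists_smooth_cutoff {Ω K₀ : Set Plane} (hΩ : IsOpen Ω) (hK₀ : IsCompact K₀)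
    (hK₀Ω : K₀ ⊆ Ω) : ∃ (η : Plane → ℝ) (K : Set Plane) (E : ℝ), ContDiff ℝ ∞ η ∧ IsCompact K ∧
      K ⊆ Ω ∧ (∀ x, x ∉ K → η x = 0) ∧ (∀ x, x ∉ K → fderiv ℝ η x = 0) ∧ (∀ x, 0 ≤ η x) ∧
      (∀ x, η x ≤ 1) ∧ (∀ x ∈ K₀, η x = 1) ∧ 0 ≤ E ∧
      ∀ x j, |fderiv ℝ η x (EuclideanSpace.single j 1)| ≤ E := by
  obtain ⟨δ, hδ, hsub⟩ := hK₀.exists_cthickening_subset_open hΩ hK₀Ω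
  obtain ⟨f, hf0, hf1, hf⟩ := exists_contMDiffMap_zero_one_of_isClosed (n := ⊤) 𝓘(ℝ, Plane)
    (isOpen_thickening (δ := δ) (E := K₀)).isClosed_compl hK₀.isClosed
    (disjoint_compl_left_iff_subset.2 (self_subset_thickening hδ K₀))
  have hfs : ContDiff ℝ ∞ f := f.contMDiff.contDiff
  have hK : IsCompact (cthickening δ K₀) := hK₀.cthickening
  have h0 : ∀ x, x ∉ cthickening δ K₀ → f x = 0 := fun x hx =>
    hf0 fun h => hx (thickening_subset_cthickening _ _ h)
  have hcs : HasCompactSupport f := HasCompactSupport.intro hK h0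
  obtain ⟨E, hE⟩ := ((hfs.continuous_fderiv (by simp)).norm).bddAbove_range_of_hasCompactSupport
    (hcs.fderiv ℝ).norm
  have hE' : ∀ x, ‖fderiv ℝ f x‖ ≤ E := fun x => hE ⟨x, rfl⟩
  refine ⟨f, cthickening δ K₀, E, hfs, hK, hsub, h0, fun x hx => ?_, fun x => (hf x).1,
    fun x => (hf x).2, fun x hx => hf1 hx, (norm_nonneg _).trans (hE' 0), fun x j => ?_⟩
  · have : f =ᶠ[𝓝 x] fun _ => (0 : ℝ) := by
      filter_upwards [isClosed_cthickening.isOpen_compl.mem_nhds hx] with y hy using h0 y hy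
    rw [this.fderiv_eq, fderiv_const_apply]
  · refine ((fderiv ℝ f x).le_opNorm _).trans ?_
    simpa using hE' x

variable {ι : Type} [Fintype ι]

theorem minorForm_smul (q : ι → ι → ℝ) (s : ℝ) (Z : Matrix ι (Fin 2) ℝ) :
    minorForm q (s • Z) = s ^ 2 * minorForm q Z := by
  simp only [minorForm, Finset.mul_sum, Matrix.smul_apply, smul_eq_mul]
  exact Finset.sum_congr rfl fun a _ => Finset.sum_congr rfl fun b _ => by ring

/-- For a localized difference quotient, `S` is the elliptic part and `T` comes from differentiating
the cutoff function. -/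
theorem norm_sq_add_le_of_elliptic (q : ι → ι → ℝ) {c : ℝ} (hc : 0 < c)
    (S T : Matrix ι (Fin 2) ℝ) (hS : c * ‖S‖ ^ 2 ≤ minorForm q S) :
    c / 4 * ‖S + T‖ ^ 2 ≤ minorForm q (S + T)
      + (2 * (2 * ∑ a, ∑ b, |q a b|) ^ 2 / c + 2 * ∑ a, ∑ b, |q a b| + c / 2) * ‖T‖ ^ 2 := by
  have h := minorForm_add_ge q S T
  set C := 2 * ∑ a, ∑ b, |q a b|
  have h1 : ‖S + T‖ ^ 2 ≤ 2 * ‖S‖ ^ 2 + 2 * ‖T‖ ^ 2 := by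
    have := pow_le_pow_left₀ (norm_nonneg _) (norm_add_le S T) 2
    nlinarith [sq_nonneg (‖S‖ - ‖T‖)]
  have h2 : C * (2 * ‖S‖ * ‖T‖) ≤ c / 2 * ‖S‖ ^ 2 + 2 * C ^ 2 / c * ‖T‖ ^ 2 := by
    have e : c / 2 * ‖S‖ ^ 2 + 2 * C ^ 2 / c * ‖T‖ ^ 2 - C * (2 * ‖S‖ * ‖T‖)
        = (c * ‖S‖ - 2 * C * ‖T‖) ^ 2 / (2 * c) := by field_simp; ring
    have : 0 ≤ (c * ‖S‖ - 2 * C * ‖T‖) ^ 2 / (2 * c) := by positivity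
    linarith
  nlinarith

theorem abs_sub_le_of_fderiv_le {s : Plane → ℝ} (hs : Differentiable ℝ s) {R t : ℝ} (ht : 0 ≤ t)
    {x e : Plane} (hR : ∀ τ ∈ Icc 0 t, |fderiv ℝ s (x + τ • e) e| ≤ R) :
    |s (x + t • e) - s x| ≤ R * t := by
  have hd : ∀ τ : ℝ, HasDerivAt (fun τ : ℝ => s (x + τ • e)) (fderiv ℝ s (x + τ • e) e) τ := by
    intro τ
    have hl : HasDerivAt (fun τ : ℝ => x + τ • e) e τ := by
      have := ((hasDerivAt_id τ).smul_const e).const_add x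
      rwa [one_smul] at this
    exact (hs _).hasFDerivAt.comp_hasDerivAt τ hl
  have := norm_image_sub_le_of_norm_deriv_le_segment' (f := fun τ : ℝ => s (x + τ • e)) (a := 0)
    (b := t) (C := R) (fun τ _ => (hd τ).hasDerivWithinAt)
    (fun τ hτ => hR τ ⟨hτ.1, hτ.2.le⟩) t (right_mem_Icc.2 ht)
  simpa using this

theorem ae_add_right {p : Plane → Prop} (h : ∀ᵐ x, p x) (y : Plane) : ∀ᵐ x, p (x + y) :=
  (measurePreserving_add_right volume y).quasiMeasurePreserving.ae h

/-- `higher_integrability` is applied to the gradient of $\eta\,\Delta_tu$. It equals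
$\eta\,\Delta_tv$, elliptic because `v` takes values in the elliptic set at both points, plus
$\Delta_tu\otimes D\eta$, bounded because the gradient of `u` is. Hence `h` is a constant on the
support of the cutoff, independent of `t`. -/
theorem exists_lintegral_diffQuot_le (q : ι → ι → ℝ) {c : ℝ} (hc : 0 < c) :
    ∃ ρ : ℝ, 0 < ρ ∧ ∀ (Ω : Set Plane) (u : ι → Plane → ℝ) (v : ι → Fin 2 → Plane → ℝ) (B R : ℝ)
      (S : Set Plane), IsOpen Ω → (∀ a, Measurable (u a)) → (∀ a j, Measurable (v a j)) →
      (∀ a x, |u a x| ≤ B) → (∀ a j x, |v a j x| ≤ R) →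
      (∀ a j, ∀ φ : Plane → ℝ, ContDiff ℝ ∞ φ → HasCompactSupport φ → tsupport φ ⊆ Ω →
        ∫ x, u a x * fderiv ℝ φ x (EuclideanSpace.single j 1) = -∫ x, v a j x * φ x) →
      (∀ᵐ x, x ∈ Ω → x ∈ S) →
      (∀ x ∈ S, ∀ y ∈ S, c * ‖Matrix.of (fun a j => v a j x - v a j y)‖ ^ 2
        ≤ minorForm q (Matrix.of fun a j => v a j x - v a j y)) →
      ∀ Ω' : Set Plane, IsOpen Ω' → IsCompact (closure Ω') → closure Ω' ⊆ Ω →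
        ∃ δ M : ℝ, 0 < δ ∧ ∀ (k : Fin 2) (t : ℝ), 0 < t → t ≤ δ → ∀ a j,
          ∫⁻ x in Ω', ENNReal.ofReal (|t⁻¹ * (v a j (x + t • EuclideanSpace.single k 1) - v a j x)|
            ^ (2 + ρ)) ≤ ENNReal.ofReal M := by
  obtain ⟨ρ, hρ, C₀, hmain⟩ := higher_integrability q (by positivity : 0 < c / 4)
  refine ⟨ρ, hρ, fun Ω u v B R S hΩ hum hvm huB hvR hweak hS hell Ω' hΩ' hcpt hsub => ?_⟩
  obtain ⟨η, K, E, hη, hK, hKΩ, hη0, hηd0, hηn, hη1, hηΩ', hE0, hE⟩ :=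
    exists_smooth_cutoff hΩ hcpt hsub
  obtain ⟨δ, hδ, hδΩ⟩ := hK.exists_cthickening_subset_open hΩ hKΩ
  set K₂ := cthickening δ K with hK₂
  have hK₂c : IsCompact K₂ := hK.cthickening
  set Q := 2 * (2 * ∑ a, ∑ b, |q a b|) ^ 2 / c + 2 * ∑ a, ∑ b, |q a b| + c / 2 with hQ
  have hQ0 : 0 ≤ Q := by positivity
  -- `N` bounds the cutoff term `Tx`, and `H` is chosen with $H^2=QN^2$ to dominate its
  -- contribution. Neither involves `t` or `B`.
  set N := ∑ _a : ι, (E * R + E * R) with hN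
  set H := √(Q * N ^ 2) with hH
  set P := ENNReal.ofReal C₀ * (ENNReal.ofReal (H ^ (2 + ρ)) * volume (toPlane ⁻¹' K)) with hP
  have hKT : IsCompact (toPlane ⁻¹' K) := toPlane.toHomeomorph.isCompact_preimage.2 hK
  have hPtop : P ≠ ⊤ := ENNReal.mul_ne_top ENNReal.ofReal_ne_top
    (ENNReal.mul_ne_top ENNReal.ofReal_ne_top hKT.measure_lt_top.ne)
  refine ⟨δ, P.toReal, hδ, fun k t ht htδ a₀ j₀ => ?_⟩
  rw [ENNReal.ofReal_toReal hPtop]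
  set e : Plane := EuclideanSpace.single k 1 with he
  have hen : ‖e‖ = 1 := by simp [he]
  have hseg : ∀ x ∈ K, ∀ τ ∈ Icc 0 t, x + τ • e ∈ K₂ := fun x hx τ hτ => by
    refine closedBall_subset_cthickening hx δ ?_
    rw [mem_closedBall, dist_eq_norm, add_sub_cancel_left, norm_smul, hen, mul_one,
      Real.norm_of_nonneg hτ.1]
    exact hτ.2.trans htδ
  have hmemK₂ : ∀ x ∈ K, x ∈ K₂ := fun x hx => self_subset_cthickening K hx
  have hR0 : 0 ≤ R := (abs_nonneg _).trans (hvR a₀ j₀ 0)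
  have hB0 : 0 ≤ B := (abs_nonneg _).trans (huB a₀ 0)
  have hul : ∀ a, LocallyIntegrable (u a) := fun a => locallyIntegrable_of_bounded (hum a) (huB a)
  have hvl : ∀ a j, LocallyIntegrable (v a j) := fun a j =>
    locallyIntegrable_of_bounded (hvm a j) (hvR a j)
  -- Shifting the mollification index by `m₀` makes the gradient identity valid for the entire
  -- sequence, on a neighbourhood of `K` containing all segments of length at most `δ`.
  obtain ⟨m₀, hm₀⟩ : ∃ m₀, ∀ m ≥ m₀, ∀ a j, ∀ x ∈ K₂,
      fderiv ℝ (mollify m (u a)) x (EuclideanSpace.single j 1) = mollify m (v a j) x := by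
    rw [← eventually_atTop]
    exact eventually_all.2 fun a => eventually_all.2 fun j =>
      eventually_fderiv_mollify hΩ hK₂c hδΩ (hul a) (hweak a j)
  -- the localized difference quotient and its mollifications
  set Sx : Plane → Matrix ι (Fin 2) ℝ := fun x =>
    (η x * t⁻¹) • Matrix.of fun a j => v a j (x + t • e) - v a j x with hSx
  set Tx : Plane → Matrix ι (Fin 2) ℝ := fun x => Matrix.of fun a j =>
    fderiv ℝ η x (EuclideanSpace.single j 1) * (t⁻¹ * (u a (x + t • e) - u a x)) with hTx
  set G : Plane → Matrix ι (Fin 2) ℝ := fun x => Sx x + Tx x with hG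
  set w : ℕ → ι → Plane → ℝ := fun m a x =>
    η x * (t⁻¹ * (mollify (m + m₀) (u a) (x + t • e) - mollify (m + m₀) (u a) x)) with hw
  have hms : ∀ m a, ContDiff ℝ ∞ (mollify m (u a)) := fun m a => contDiff_mollify m (hul a)
  have hsh : ContDiff ℝ ∞ (fun x : Plane => x + t • e) := contDiff_id.add contDiff_const
  have hws : ∀ m a, ContDiff ℝ ∞ (w m a) := fun m a =>
    hη.mul (contDiff_const.mul (((hms _ a).comp hsh).sub (hms _ a)))
  have hwd : ∀ m a x j, fderiv ℝ (w m a) x (EuclideanSpace.single j 1)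
      = fderiv ℝ η x (EuclideanSpace.single j 1)
          * (t⁻¹ * (mollify (m + m₀) (u a) (x + t • e) - mollify (m + m₀) (u a) x))
        + η x * (t⁻¹ * (mollify (m + m₀) (v a j) (x + t • e) - mollify (m + m₀) (v a j) x)) := by
    intro m a x j
    have hd := (hms (m + m₀) a).differentiable (by simp)
    have d1 : HasFDerivAt (fun x => mollify (m + m₀) (u a) (x + t • e))
        (fderiv ℝ (mollify (m + m₀) (u a)) (x + t • e)) x :=
      (hd (x + t • e)).hasFDerivAt.comp x ((hasFDerivAt_id x).add_const _)
    have d2 := (d1.sub (hd x).hasFDerivAt).const_mul t⁻¹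
    have d3 := ((hη.differentiable (by simp) x).hasFDerivAt.mul d2)
    have d4 : fderiv ℝ (w m a) x = _ := d3.fderiv
    rw [d4]
    simp only [add_apply, smul_apply, sub_apply, smul_eq_mul]
    by_cases hx : x ∈ K
    · rw [hm₀ _ (Nat.le_add_left _ _) a j x (hmemK₂ x hx),
        hm₀ _ (Nat.le_add_left _ _) a j _ (hseg x hx t ⟨ht.le, le_rfl⟩)]
      simp only [Pi.sub_apply]
      ring
    · rw [hη0 x hx, hηd0 x hx]; simp
  have hΔm : ∀ (m : ℕ) {g : Plane → ℝ} {b : ℝ}, (∀ x, |g x| ≤ b) → ∀ x,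
      |t⁻¹ * (mollify m g (x + t • e) - mollify m g x)| ≤ t⁻¹ * (b + b) := by
    intro m g b hg x
    rw [abs_mul, abs_of_pos (inv_pos.2 ht)]
    gcongr
    exact (abs_sub _ _).trans (add_le_add (abs_mollify_le m hg _) (abs_mollify_le m hg _))
  have hgrad : ∀ m z a j, gradMat (fun a => w m a ∘ toPlane) z a j
      = fderiv ℝ (w m a) (toPlane z) (EuclideanSpace.single j 1) := by
    intro m z a j
    simp only [gradMat, Matrix.of_apply]
    have : HasFDerivAt (w m a ∘ toPlane) _ z :=
      ((hws m a).differentiable (by simp) (toPlane z)).hasFDerivAt.comp z toPlane.hasFDerivAt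
    rw [this.fderiv, ContinuousLinearMap.comp_apply, ← toPlane_coordVec]
    rfl
  -- This bound blows up as `t` tends to 0, which is harmless because it only enters as the
  -- domination constant.
  set B₁ := E * (t⁻¹ * (B + B)) + t⁻¹ * (R + R) with hB₁
  have hwb : ∀ m a j x, |fderiv ℝ (w m a) x (EuclideanSpace.single j 1)| ≤ B₁ := by
    intro m a j x
    rw [hwd]
    refine (abs_add_le _ _).trans (add_le_add ?_ ?_)
    · rw [abs_mul]
      exact mul_le_mul (hE x j) (hΔm _ (huB a) x) (abs_nonneg _) hE0
    · rw [abs_mul, abs_of_nonneg (hηn x)]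
      exact (mul_le_of_le_one_left (abs_nonneg _) (hη1 x)).trans (hΔm _ (hvR a j) x)
  have hGap : ∀ x a j, G x a j = fderiv ℝ η x (EuclideanSpace.single j 1)
          * (t⁻¹ * (u a (x + t • e) - u a x)) + η x * (t⁻¹ * (v a j (x + t • e) - v a j x)) := by
    intro x a j
    simp only [hG, hSx, hTx, Matrix.add_apply, Matrix.smul_apply, Matrix.of_apply, smul_eq_mul]
    ring
  have hmollu : ∀ᵐ x, ∀ a, Tendsto (fun m => mollify (m + m₀) (u a) x) atTop (𝓝 (u a x)) := by
    rw [ae_all_iff]; intro a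
    filter_upwards [ae_tendsto_mollify (hul a)] with x hx
    exact hx.comp (tendsto_add_atTop_nat m₀)
  have hmollv : ∀ᵐ x, ∀ a j,
      Tendsto (fun m => mollify (m + m₀) (v a j) x) atTop (𝓝 (v a j x)) := by
    rw [ae_all_iff]; intro a
    rw [ae_all_iff]; intro j
    filter_upwards [ae_tendsto_mollify (hvl a j)] with x hx
    exact hx.comp (tendsto_add_atTop_nat m₀)
  have hlim : ∀ᵐ x, ∀ a j, Tendsto (fun m => fderiv ℝ (w m a) x (EuclideanSpace.single j 1)) atTop
      (𝓝 (G x a j)) := by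
    filter_upwards [hmollu, hmollv, ae_add_right hmollu (t • e), ae_add_right hmollv (t • e)]
      with x h1 h2 h3 h4 a j
    simp only [hwd, hGap]
    exact ((((h3 a).sub (h1 a)).const_mul _).const_mul _).add
      ((((h4 a j).sub (h2 a j)).const_mul _).const_mul _)
  -- The mean value inequality for the mollifications, along a segment inside `K₂`, passes to the
  -- limit.
  have huΔ : ∀ᵐ x, ∀ a, x ∈ K → |t⁻¹ * (u a (x + t • e) - u a x)| ≤ R := by
    filter_upwards [hmollu, ae_add_right hmollu (t • e)] with x h1 h3 a hx
    refine le_of_tendsto ((((h3 a).sub (h1 a)).const_mul t⁻¹).abs)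
      (Eventually.of_forall fun m => ?_)
    rw [abs_mul, abs_of_pos (inv_pos.2 ht), inv_mul_le_iff₀ ht, mul_comm t R]
    refine abs_sub_le_of_fderiv_le ((hms _ a).differentiable (by simp)) ht.le fun τ hτ => ?_
    rw [hm₀ _ (Nat.le_add_left _ _) a k _ (hseg x hx τ hτ)]
    exact abs_mollify_le _ (hvR a k) _
  have hTn : ∀ᵐ x, ‖Tx x‖ ≤ N := by
    filter_upwards [huΔ] with x hx
    refine (norm_le_sum_abs_entry _).trans (Finset.sum_le_sum fun a _ => ?_)
    have : ∀ j, |Tx x a j| ≤ E * R := fun j => by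
      by_cases hxK : x ∈ K
      · simp only [hTx, Matrix.of_apply, abs_mul (fderiv ℝ η x _)]
        exact mul_le_mul (hE x j) (hx a hxK) (abs_nonneg _) hE0
      · simp only [hTx, Matrix.of_apply, hηd0 x hxK]
        simpa using mul_nonneg hE0 hR0
    exact add_le_add (this 0) (this 1)
  have hGK : ∀ x, x ∉ K → G x = 0 := fun x hx => by
    ext a j
    rw [hGap, hη0 x hx, hηd0 x hx]; simp
  have hSK : ∀ᵐ x, x ∈ K → c * ‖Sx x‖ ^ 2 ≤ minorForm q (Sx x) := by
    filter_upwards [hS, ae_add_right hS (t • e)] with x h1 h2 hx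
    have h3 := hell _ (h2 (hδΩ (hseg x hx t ⟨ht.le, le_rfl⟩))) _ (h1 (hKΩ hx))
    simp only [hSx]
    rw [norm_smul, minorForm_smul, mul_pow, Real.norm_eq_abs, sq_abs, mul_left_comm]
    exact mul_le_mul_of_nonneg_left h3 (sq_nonneg _)
  set h : Plane → ℝ := K.indicator fun _ => H with hh
  have hH2 : H ^ 2 = Q * N ^ 2 := Real.sq_sqrt (by positivity)
  have hH0 : 0 ≤ H := Real.sqrt_nonneg _
  have hKm : MeasurableSet K := hK.isClosed.measurableSet
  have hpt : ∀ᵐ x, c / 4 * ‖G x‖ ^ 2 ≤ minorForm q (G x) + h x ^ 2 := by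
    filter_upwards [hTn, hSK] with x h1 h2
    by_cases hx : x ∈ K
    · rw [hh, indicator_of_mem hx, hH2]
      refine (norm_sq_add_le_of_elliptic q hc (Sx x) (Tx x) (h2 hx)).trans ?_
      gcongr
    · rw [hGK x hx, norm_zero, hh, indicator_of_notMem hx]
      simp [minorForm]
  have hqmp := measurePreserving_toPlane.quasiMeasurePreserving
  have hGm : ∀ a j, Measurable fun x => G x a j := fun a j => by
    simp only [hGap]
    have hsm : Measurable fun x : Plane => x + t • e := measurable_id.add_const _
    have c1 : Measurable fun x => fderiv ℝ η x (EuclideanSpace.single j 1) :=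
      ((hη.continuous_fderiv (by simp)).clm_apply continuous_const).measurable
    exact (c1.mul ((((hum a).comp hsm).sub (hum a)).const_mul _)).add
      (hη.continuous.measurable.mul ((((hvm a j).comp hsm).sub (hvm a j)).const_mul _))
  have hhm : Measurable h := measurable_const.indicator hKm
  have key := hmain (fun z => G (toPlane z)) (fun z => h (toPlane z))
    (fun m a => w m a ∘ toPlane) (∑ _a : ι, (B₁ + B₁)) (toPlane ⁻¹' K) hKT
    (fun z hz => hGK _ hz) (fun a j => (hGm a j).comp measurePreserving_toPlane.measurable)
    (hhm.comp measurePreserving_toPlane.measurable)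
    (fun z => indicator_nonneg (fun _ _ => hH0) _) ?_
    (fun m a => (contDiff_infty.1 (hws m a) 2).comp toPlane.contDiff)
    (fun m z => (norm_le_sum_abs_entry _).trans (Finset.sum_le_sum fun a _ => ?_)) ?_
    (hqmp.ae hpt)
  rotate_left
  · refine integrable_of_bounded_of_compact
      ((hhm.comp measurePreserving_toPlane.measurable).pow_const 2).aestronglyMeasurable hKT
      (fun z hz => ?_) (B := H ^ 2) (ae_of_all _ fun z => ?_)
    · have : toPlane z ∉ K := hz
      simp [hh, this]
    · rw [abs_of_nonneg (sq_nonneg _)]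
      exact pow_le_pow_left₀ (indicator_nonneg (fun _ _ => hH0) _)
        (indicator_le_self' (fun _ _ => hH0) _) 2
  · rw [hgrad, hgrad]
    exact add_le_add (hwb _ _ _ _) (hwb _ _ _ _)
  · filter_upwards [hqmp.ae hlim] with z hz
    refine tendsto_pi_nhds.2 fun a => tendsto_pi_nhds.2 fun j => ?_
    simp only [hgrad]
    exact hz a j
  have hright : ∫⁻ z, ENNReal.ofReal (h (toPlane z) ^ (2 + ρ))
      = ENNReal.ofReal (H ^ (2 + ρ)) * volume (toPlane ⁻¹' K) := by
    rw [← lintegral_indicator_const (hKm.preimage measurePreserving_toPlane.measurable)]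
    refine lintegral_congr fun z => ?_
    by_cases hz : toPlane z ∈ K
    · rw [hh, indicator_of_mem hz, indicator_of_mem (show z ∈ toPlane ⁻¹' K from hz)]
    · rw [hh, indicator_of_notMem hz, indicator_of_notMem (show z ∉ toPlane ⁻¹' K from hz),
        Real.zero_rpow (by positivity), ENNReal.ofReal_zero]
  rw [hright] at key
  refine le_trans ?_ key
  have hleft : ∫⁻ z, ENNReal.ofReal (‖G (toPlane z)‖ ^ (2 + ρ))
      = ∫⁻ x, ENNReal.ofReal (‖G x‖ ^ (2 + ρ)) :=
    measurePreserving_toPlane.lintegral_comp_emb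
      toPlane.toHomeomorph.measurableEmbedding fun x => ENNReal.ofReal (‖G x‖ ^ (2 + ρ))
  rw [hleft]
  -- On `Ω'` the cutoff is identically one, so `G` is the plain difference quotient of `v`.
  refine (setLIntegral_mono' hΩ'.measurableSet fun x hx => ?_).trans (setLIntegral_le_lintegral Ω' _)
  have hη1x : η x = 1 := hηΩ' x (subset_closure hx)
  have hηdx : fderiv ℝ η x = 0 := by
    have : η =ᶠ[𝓝 x] fun _ => (1 : ℝ) := by
      filter_upwards [hΩ'.mem_nhds hx] with y hy using hηΩ' y (subset_closure hy)
    rw [this.fderiv_eq, fderiv_const_apply]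
  have hent := abs_entry_le_norm (G x) a₀ j₀
  rw [hGap, hη1x, hηdx] at hent
  simp only [zero_apply, zero_mul, one_mul, zero_add] at hent
  gcongr

end DifferenceQuotient

/-! ### Weak limits in $L^2$ and lower semicontinuity of $L^p$ bounds. -/

section WeakLimit

open Set Metric Filter
open scoped Topology InnerProductSpace

/-- An `L²` function that is the weak limit of a sequence with `∫ |f_m| ^ p ≤ M` satisfies the same
bound. -/
theorem lintegral_rpow_le_of_weak_limit {α : Type*} [MeasurableSpace α] {μ : Measure α}
    [IsFiniteMeasure μ] {p M : ℝ} (hp : 2 < p) (hM : 0 ≤ M) {f : ℕ → α → ℝ} {g : α → ℝ}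
    {l : Filter ℕ} [l.NeBot] (hf : ∀ m, AEStronglyMeasurable (f m) μ) (hg : Measurable g)
    (hfM : ∀ m, ∫⁻ x, ENNReal.ofReal (|f m x| ^ p) ∂μ ≤ ENNReal.ofReal M)
    (hlim : ∀ ξ : α → ℝ, Measurable ξ → (∃ b, ∀ x, |ξ x| ≤ b) →
      Tendsto (fun m => ∫ x, f m x * ξ x ∂μ) l (𝓝 (∫ x, g x * ξ x ∂μ))) :
    ∫⁻ x, ENNReal.ofReal (|g x| ^ p) ∂μ ≤ ENNReal.ofReal M := by
  have hp0 : 0 < p := by linarith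
  have hfi : ∀ m, Integrable (fun x => |f m x| ^ p) μ := fun m => by
    refine ⟨((hf m).aemeasurable.abs.pow_const p).aestronglyMeasurable, ?_⟩
    rw [hasFiniteIntegral_iff_ofReal (ae_of_all _ fun x => by positivity)]
    exact (hfM m).trans_lt ENNReal.ofReal_lt_top
  have hfM' : ∀ m, ∫ x, |f m x| ^ p ∂μ ≤ M := fun m => by
    rw [← ENNReal.ofReal_le_ofReal_iff hM,
      ofReal_integral_eq_lintegral_ofReal (hfi m) (ae_of_all _ fun x => by positivity)]
    exact hfM m
  -- Truncation makes $|g|^p$ integrable, so that it can be absorbed; monotone convergence removes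
  -- it at the end.
  set A : ℕ → Set α := fun k => {x | |g x| ≤ k} with hA
  have hAm : ∀ k, MeasurableSet (A k) := fun k => measurableSet_le hg.abs measurable_const
  have hpq : p.HolderConjugate (Real.conjExponent p) := Real.HolderConjugate.conjExponent
    (by linarith)
  set p' := Real.conjExponent p with hp'
  have hIi : ∀ k, Integrable ((A k).indicator fun x => |g x| ^ p) μ := fun k => by
    refine Integrable.of_bound ((hg.abs.pow_const p).indicator (hAm k)).aestronglyMeasurable
      ((k : ℝ) ^ p) (ae_of_all _ fun x => ?_)
    by_cases hx : x ∈ A k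
    · rw [indicator_of_mem hx, Real.norm_of_nonneg (by positivity)]
      exact Real.rpow_le_rpow (abs_nonneg _) hx hp0.le
    · rw [indicator_of_notMem hx, norm_zero]; positivity
  have htr : ∀ k, ∫ x, (A k).indicator (fun x => |g x| ^ p) x ∂μ ≤ M := by
    intro k
    set I := ∫ x, (A k).indicator (fun x => |g x| ^ p) x ∂μ with hI
    -- The dual function of `g`: both $g\xi$ and $|\xi|^{p'}$ equal $|g|^p$ on `A k`. Young's
    -- inequality then gives $I\le M/p+I/p'$, that is $I\le M$.
    set ξ : α → ℝ := (A k).indicator fun x => g x * |g x| ^ (p - 2) with hξ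
    have hξm : Measurable ξ := (hg.mul (hg.abs.pow_const _)).indicator (hAm k)
    have hpow : ∀ a : ℝ, 0 ≤ a → a * a ^ (p - 2) = a ^ (p - 1) := fun a ha => by
      conv_lhs => rw [← Real.rpow_one a]
      rw [← Real.rpow_mul ha, ← Real.rpow_add_of_nonneg ha zero_le_one (by linarith)]
      ring_nf
    have hξa : ∀ x, |ξ x| = (A k).indicator (fun x => |g x| ^ (p - 1)) x := by
      intro x
      by_cases hx : x ∈ A k
      · rw [hξ, indicator_of_mem hx, indicator_of_mem hx, abs_mul, ← hpow _ (abs_nonneg _),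
          abs_of_nonneg (by positivity : 0 ≤ |g x| ^ (p - 2))]
      · rw [hξ, indicator_of_notMem hx, indicator_of_notMem hx, abs_zero]
    have hξb : ∀ x, |ξ x| ≤ (k : ℝ) ^ (p - 1) := by
      intro x
      rw [hξa]
      by_cases hx : x ∈ A k
      · rw [indicator_of_mem hx]
        exact Real.rpow_le_rpow (abs_nonneg _) hx (by linarith)
      · rw [indicator_of_notMem hx]; positivity
    have hgξ : ∀ x, g x * ξ x = (A k).indicator (fun x => |g x| ^ p) x := by
      intro x
      by_cases hx : x ∈ A k
      · rw [hξ, indicator_of_mem hx, indicator_of_mem hx, ← mul_assoc, ← pow_two, ← sq_abs,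
          ← Real.rpow_natCast, ← Real.rpow_add_of_nonneg (abs_nonneg _) (by norm_num)
            (by linarith)]
        norm_num
      · rw [hξ, indicator_of_notMem hx, indicator_of_notMem hx, mul_zero]
    have hξp : ∀ x, |ξ x| ^ p' = (A k).indicator (fun x => |g x| ^ p) x := by
      intro x
      rw [hξa]
      by_cases hx : x ∈ A k
      · rw [indicator_of_mem hx, indicator_of_mem hx, ← Real.rpow_mul (abs_nonneg _),
          hpq.sub_one_mul_conj]
      · rw [indicator_of_notMem hx, indicator_of_notMem hx, Real.zero_rpow hpq.symm.ne_zero]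
    have hm : ∀ m, ∫ x, f m x * ξ x ∂μ ≤ M / p + I / p' := by
      intro m
      calc ∫ x, f m x * ξ x ∂μ
          ≤ ∫ x, (|f m x| ^ p / p + (A k).indicator (fun x => |g x| ^ p) x / p') ∂μ := by
            have hint := ((hfi m).div_const p).add ((hIi k).div_const p')
            have hpt : ∀ x, f m x * ξ x
                ≤ |f m x| ^ p / p + (A k).indicator (fun x => |g x| ^ p) x / p' := fun x => by
              rw [← hξp]; exact Real.young_inequality _ _ hpq
            refine integral_mono_ae (hint.mono' ((hf m).mul hξm.aestronglyMeasurable)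
              (ae_of_all _ fun x => ?_)) hint (ae_of_all _ hpt)
            have h1 := Real.young_inequality |f m x| |ξ x| hpq
            rw [abs_abs, abs_abs, hξp] at h1
            simpa [abs_mul] using h1
        _ = (∫ x, |f m x| ^ p ∂μ) / p + I / p' := by
            rw [integral_add ((hfi m).div_const p) ((hIi k).div_const p'), integral_div,
              integral_div]
        _ ≤ M / p + I / p' := by
            gcongr; exact hfM' m
    have h1 : I ≤ M / p + I / p' := by
      have := le_of_tendsto (hlim ξ hξm ⟨_, hξb⟩) (Eventually.of_forall hm)
      simpa only [hgξ] using this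
    have h2 : I / p + I / p' = I := by
      rw [div_eq_mul_inv, div_eq_mul_inv, ← mul_add, hpq.inv_add_inv_eq_one, mul_one]
    have h3 : I / p ≤ M / p := by linarith
    exact (div_le_div_iff_of_pos_right hp0).1 h3
  have hmono : ∫⁻ x, ENNReal.ofReal (|g x| ^ p) ∂μ
      = ⨆ k : ℕ, ∫⁻ x, ENNReal.ofReal ((A k).indicator (fun x => |g x| ^ p) x) ∂μ := by
    rw [← lintegral_iSup]
    · refine lintegral_congr fun x => le_antisymm ?_ (iSup_le fun k => ENNReal.ofReal_le_ofReal
        (indicator_le_self' (fun _ _ => by positivity) _))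
      obtain ⟨k, hk⟩ := exists_nat_ge |g x|
      refine le_iSup_of_le k ?_
      rw [indicator_of_mem (show x ∈ A k from hk)]
    · exact fun k => ((hg.abs.pow_const p).indicator (hAm k)).ennreal_ofReal
    · intro k₁ k₂ hk x
      refine ENNReal.ofReal_le_ofReal (indicator_le_indicator_of_subset (fun y hy => ?_)
        (fun _ => by positivity) x)
      exact le_trans (show |g y| ≤ k₁ from hy) (by exact_mod_cast hk)
  rw [hmono]
  refine iSup_le fun k => ?_
  rw [← ofReal_integral_eq_lintegral_ofReal (hIi k)
    (ae_of_all _ fun x => indicator_nonneg (fun _ _ => by positivity) x)]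
  exact ENNReal.ofReal_le_ofReal (htr k)

/-- A bounded sequence in `L²` has a weak limit along any ultrafilter. -/
theorem exists_weak_limit {α : Type*} [MeasurableSpace α] {μ : Measure α}
    {f : ℕ → α → ℝ} (hf : ∀ m, MemLp (f m) 2 μ) {M : ℝ}
    (hM : ∀ m, eLpNorm (f m) 2 μ ≤ ENNReal.ofReal M) (l : Ultrafilter ℕ) :
    ∃ g : α → ℝ, Measurable g ∧ MemLp g 2 μ ∧ ∀ ξ : α → ℝ, MemLp ξ 2 μ →
      Tendsto (fun m => ∫ x, f m x * ξ x ∂μ) l (𝓝 (∫ x, g x * ξ x ∂μ)) := by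
  set F : ℕ → StrongDual ℝ (Lp ℝ 2 μ) := fun m => InnerProductSpace.toDual ℝ _ ((hf m).toLp)
  have hF : ∀ m, StrongDual.toWeakDual (F m) ∈ WeakDual.toStrongDual ⁻¹' closedBall
      (0 : StrongDual ℝ (Lp ℝ 2 μ)) (max M 0) := fun m => by
    rw [mem_preimage, mem_closedBall_zero_iff]
    change ‖F m‖ ≤ _
    rw [LinearIsometryEquiv.norm_map, Lp.norm_toLp]
    refine ENNReal.toReal_le_of_le_ofReal (le_max_right _ _) ((hM m).trans ?_)
    exact ENNReal.ofReal_le_ofReal (le_max_left _ _)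
  -- Banach-Alaoglu after the Riesz identification. Convergence along an ultrafilter replaces
  -- extraction of a subsequence.
  have hc := WeakDual.isCompact_closedBall (𝕜 := ℝ) (0 : StrongDual ℝ (Lp ℝ 2 μ)) (max M 0)
  obtain ⟨G, -, hG⟩ := hc.ultrafilter_le_nhds (l.map fun m => StrongDual.toWeakDual (F m))
    (by
      rw [le_principal_iff]
      exact mem_map.2 (univ_mem' hF))
  set g₀ : Lp ℝ 2 μ := (InnerProductSpace.toDual ℝ _).symm (WeakDual.toStrongDual G)
  have hgm := (Lp.memLp g₀).1
  refine ⟨hgm.mk g₀, hgm.stronglyMeasurable_mk.measurable,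
    (memLp_congr_ae hgm.ae_eq_mk).1 (Lp.memLp g₀), fun ξ hξ => ?_⟩
  have hin : ∀ (a : α → ℝ) (ha : MemLp a 2 μ),
      ⟪ha.toLp, hξ.toLp⟫_ℝ = ∫ x, a x * ξ x ∂μ := fun a ha => by
    rw [L2.inner_def]
    refine integral_congr_ae ?_
    filter_upwards [ha.coeFn_toLp, hξ.coeFn_toLp] with x h1 h2
    rw [h1, h2]; simp [mul_comm]
  have hev : Tendsto (fun m => F m hξ.toLp) l (𝓝 (G hξ.toLp)) :=
    ((WeakDual.eval_continuous (hξ.toLp)).tendsto G).comp hG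
  have e1 : ∀ m, F m hξ.toLp = ∫ x, f m x * ξ x ∂μ := fun m => by
    simp only [F, InnerProductSpace.toDual_apply_apply]
    exact hin _ (hf m)
  have e2 : G hξ.toLp = ∫ x, hgm.mk g₀ x * ξ x ∂μ := by
    have : G hξ.toLp = ⟪g₀, hξ.toLp⟫_ℝ := by
      simp only [g₀, InnerProductSpace.toDual_symm_apply]
      rfl
    rw [this, ← hin _ ((memLp_congr_ae hgm.ae_eq_mk).1 (Lp.memLp g₀))]
    congr 1
    exact (Lp.toLp_coeFn g₀ (Lp.memLp g₀)).symm.trans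
      ((MemLp.toLp_eq_toLp_iff _ _).2 hgm.ae_eq_mk)
  simpa only [e1, e2] using hev

end WeakLimit

/-! ### Weak derivatives from bounded difference quotients. -/

section WeakDerivative

open Set Metric Filter
open scoped Topology

theorem eLpNorm_le_of_lintegral_rpow_le {α : Type*} [MeasurableSpace α] {μ : Measure α}
    {f : α → ℝ} {p : ℝ} (hp : 0 < p) {M : ℝ}
    (h : ∫⁻ x, ENNReal.ofReal (|f x| ^ p) ∂μ ≤ ENNReal.ofReal M) :
    eLpNorm f (ENNReal.ofReal p) μ ≤ ENNReal.ofReal M ^ (1 / p) := by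
  rw [eLpNorm_eq_lintegral_rpow_enorm_toReal (by simpa using hp) ENNReal.ofReal_ne_top,
    ENNReal.toReal_ofReal hp.le]
  refine ENNReal.rpow_le_rpow (le_trans (le_of_eq (lintegral_congr fun x => ?_)) h) (by positivity)
  rw [← ofReal_norm, ENNReal.ofReal_rpow_of_nonneg (norm_nonneg _) hp.le, Real.norm_eq_abs]

/-- A function with difference quotients bounded in `L^p` has a weak derivative in `L^p`. -/
theorem exists_weak_partial_of_diffQuot {Ω : Set Plane} (hfin : volume Ω ≠ ⊤)
    {v : Plane → ℝ} (hv : Measurable v) {R : ℝ} (hvR : ∀ x, |v x| ≤ R) {p δ M : ℝ} (hp : 2 < p)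
    (hM : 0 ≤ M) (hδ : 0 < δ) {e : Plane} (he : ‖e‖ = 1)
    (hdq : ∀ t : ℝ, 0 < t → t ≤ δ →
      ∫⁻ x in Ω, ENNReal.ofReal (|t⁻¹ * (v (x + t • e) - v x)| ^ p) ≤ ENNReal.ofReal M) :
    ∃ g : Plane → ℝ, MemLp g (ENNReal.ofReal p) (volume.restrict Ω) ∧
      ∀ φ : Plane → ℝ, ContDiff ℝ ∞ φ → HasCompactSupport φ → tsupport φ ⊆ Ω →
        ∫ x in Ω, v x * fderiv ℝ φ x e = -∫ x in Ω, g x * φ x := by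
  have : IsFiniteMeasure (volume.restrict Ω) := ⟨by simpa using hfin.lt_top⟩
  set t : ℕ → ℝ := fun m => δ * (1 / ((m : ℝ) + 1)) with ht
  have ht0 : ∀ m, 0 < t m := fun m => by positivity
  have htδ : ∀ m, t m ≤ δ := fun m => by
    refine mul_le_of_le_one_right hδ.le ?_
    rw [div_le_one (by positivity)]
    have : (0 : ℝ) ≤ m := by positivity
    linarith
  have htlim : Tendsto t atTop (𝓝[≠] 0) := by
    refine tendsto_nhdsWithin_iff.2 ⟨?_, Eventually.of_forall fun m => (ht0 m).ne'⟩
    have := (tendsto_one_div_add_atTop_nhds_zero_nat (𝕜 := ℝ)).const_mul δ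
    rwa [mul_zero] at this
  set f : ℕ → Plane → ℝ := fun m x => (t m)⁻¹ * (v (x + t m • e) - v x) with hf
  have hfm : ∀ m, Measurable (f m) := fun m =>
    ((hv.comp (measurable_id.add_const _)).sub hv).const_mul _
  have hf2 : ∀ m, MemLp (f m) 2 (volume.restrict Ω) := fun m => by
    refine MemLp.of_bound (hfm m).aestronglyMeasurable ((t m)⁻¹ * (R + R))
      (ae_of_all _ fun x => ?_)
    rw [Real.norm_eq_abs, abs_mul, abs_of_pos (inv_pos.2 (ht0 m))]
    have := ht0 m
    gcongr
    exact (abs_sub _ _).trans (add_le_add (hvR _) (hvR _))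
  have hfM : ∀ m, ∫⁻ x in Ω, ENNReal.ofReal (|f m x| ^ p) ≤ ENNReal.ofReal M := fun m =>
    hdq (t m) (ht0 m) (htδ m)
  have hp2 : (2 : ℝ≥0∞) ≤ ENNReal.ofReal p := by
    rw [← ENNReal.ofReal_ofNat]; exact ENNReal.ofReal_le_ofReal hp.le
  -- The uniform $L^2$ bound obtained from the $L^p$ bound by Hölder on a set of finite measure.
  -- Compactness is needed only in $L^2$; the exponent `p` is recovered by lower semicontinuity.
  set X := ENNReal.ofReal M ^ (1 / p) * (volume.restrict Ω) univ
    ^ (1 / (2 : ℝ≥0∞).toReal - 1 / (ENNReal.ofReal p).toReal) with hX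
  have hXt : X ≠ ⊤ := by
    refine ENNReal.mul_ne_top (ENNReal.rpow_ne_top_of_nonneg (by positivity)
      ENNReal.ofReal_ne_top) (ENNReal.rpow_ne_top_of_nonneg ?_ (measure_ne_top _ _))
    rw [ENNReal.toReal_ofReal (by linarith), ENNReal.toReal_ofNat, sub_nonneg]
    gcongr
  obtain ⟨g, hgm, hg2, hlim⟩ := exists_weak_limit hf2 (M := X.toReal) (fun m => by
    rw [ENNReal.ofReal_toReal hXt]
    refine (eLpNorm_le_eLpNorm_mul_rpow_measure_univ hp2 (hf2 m).1).trans ?_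
    exact mul_le_mul_left (eLpNorm_le_of_lintegral_rpow_le (by linarith) (hfM m)) _)
    (hyperfilter ℕ)
  have hbdd : ∀ ξ : Plane → ℝ, Measurable ξ → (∃ b, ∀ x, |ξ x| ≤ b) →
      MemLp ξ 2 (volume.restrict Ω) := by
    rintro ξ hξ ⟨b, hb⟩
    exact MemLp.of_bound hξ.aestronglyMeasurable b (ae_of_all _ hb)
  refine ⟨g, ⟨hgm.aestronglyMeasurable, ?_⟩, fun φ hφ hφc hφΩ => ?_⟩
  · have hgp := lintegral_rpow_le_of_weak_limit (l := (hyperfilter ℕ : Filter ℕ)) hp hM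
      (fun m => (hfm m).aestronglyMeasurable) hgm hfM
      (fun ξ hξ hb => hlim ξ (hbdd ξ hξ hb))
    exact (eLpNorm_le_of_lintegral_rpow_le (by linarith) hgp).trans_lt
      (ENNReal.rpow_lt_top_of_nonneg (by positivity) ENNReal.ofReal_ne_top)
  · have hφ0 : ∀ x, x ∉ Ω → φ x = 0 := fun x hx => image_eq_zero_of_notMem_tsupport
      fun h => hx (hφΩ h)
    have hφd0 : ∀ x, x ∉ Ω → fderiv ℝ φ x = 0 := fun x hx =>
      image_eq_zero_of_notMem_tsupport fun h => hx (hφΩ (tsupport_fderiv_subset ℝ h))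
    obtain ⟨b, hb⟩ := hφ.continuous.norm.bddAbove_range_of_hasCompactSupport hφc.norm
    have hl1 := hlim φ (hbdd φ hφ.continuous.measurable ⟨b, fun x => hb ⟨x, rfl⟩⟩)
    obtain ⟨E, hE⟩ := ((hφ.continuous_fderiv (by simp)).norm).bddAbove_range_of_hasCompactSupport
      (hφc.fderiv ℝ).norm
    have hE' : ∀ x, ‖fderiv ℝ φ x‖ ≤ E := fun x => hE ⟨x, rfl⟩
    set K := cthickening δ (tsupport φ) with hK
    have hKc : IsCompact K := IsCompact.cthickening hφc
    have hvi : ∀ {ψ : Plane → ℝ}, Continuous ψ → HasCompactSupport ψ →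
        Integrable fun x => v x * ψ x := fun {ψ} hψ hψc =>
      (hψ.integrable_of_hasCompactSupport hψc).bdd_mul hv.aestronglyMeasurable
        (ae_of_all _ hvR)
    -- Discrete integration by parts: translation invariance moves the difference quotient onto the
    -- test function, with reversed direction.
    have hswap : ∀ m, ∫ x in Ω, f m x * φ x
        = ∫ x, v x * ((t m)⁻¹ * (φ (x + t m • (-e)) - φ x)) := fun m => by
      rw [setIntegral_eq_integral_of_forall_compl_eq_zero fun x hx => by rw [hφ0 x hx, mul_zero]]
      have hsc : HasCompactSupport fun x => φ (x - t m • e) :=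
        hφc.comp_homeomorph (Homeomorph.subRight (t m • e))
      have hscont : Continuous fun x => φ (x - t m • e) := hφ.continuous.comp (by fun_prop)
      have i1 := hvi hscont hsc
      have i2 := hvi hφ.continuous hφc
      have i3 : Integrable fun x => v (x + t m • e) * φ x := by
        have := i1.comp_add_right (t m • e)
        simpa using this
      have e1 : ∫ x, v (x + t m • e) * φ x = ∫ x, v x * φ (x - t m • e) := by
        rw [← integral_add_right_eq_self (fun x => v x * φ (x - t m • e)) (t m • e)]
        simp
      calc ∫ x, f m x * φ x
          = ∫ x, (t m)⁻¹ * (v (x + t m • e) * φ x - v x * φ x) :=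
            integral_congr_ae (ae_of_all _ fun x => by simp only [hf]; ring)
        _ = (t m)⁻¹ * ((∫ x, v x * φ (x - t m • e)) - ∫ x, v x * φ x) := by
            rw [integral_const_mul, integral_sub i3 i2, e1]
        _ = ∫ x, (t m)⁻¹ * (v x * φ (x - t m • e) - v x * φ x) := by
            rw [integral_const_mul, integral_sub i1 i2]
        _ = _ := integral_congr_ae (ae_of_all _ fun x => by
            simp only [smul_neg, ← sub_eq_add_neg]; ring)
    have hl2 : Tendsto (fun m => ∫ x, v x * ((t m)⁻¹ * (φ (x + t m • (-e)) - φ x))) atTop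
        (𝓝 (∫ x, v x * -fderiv ℝ φ x e)) := by
      refine tendsto_integral_of_dominated_convergence (K.indicator fun _ => R * E) (fun m => ?_)
        ((integrable_indicator_iff hKc.isClosed.measurableSet).2
          (integrableOn_const hKc.measure_lt_top.ne)) (fun m => ae_of_all _ fun x => ?_)
        (ae_of_all _ fun x => ?_)
      · refine (hv.mul (Measurable.const_mul (Measurable.sub ?_ hφ.continuous.measurable)
          _)).aestronglyMeasurable
        exact (hφ.continuous.comp (by fun_prop : Continuous fun x => x + t m • (-e))).measurable
      · by_cases hx : x ∈ K
        · rw [indicator_of_mem hx, norm_mul]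
          refine mul_le_mul (hvR x) ?_ (norm_nonneg _) ((abs_nonneg _).trans (hvR x))
          rw [Real.norm_eq_abs, abs_mul, abs_of_pos (inv_pos.2 (ht0 m)),
            inv_mul_le_iff₀ (ht0 m), mul_comm]
          refine abs_sub_le_of_fderiv_le (hφ.differentiable (by simp)) (ht0 m).le fun τ _ => ?_
          refine ((fderiv ℝ φ _).le_opNorm _).trans ?_
          rw [norm_neg, he, mul_one]
          exact hE' _
        · have h1 : φ x = 0 := image_eq_zero_of_notMem_tsupport fun h =>
            hx (self_subset_cthickening _ h)
          have h2 : φ (x + t m • (-e)) = 0 := image_eq_zero_of_notMem_tsupport fun h => by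
            refine hx (closedBall_subset_cthickening h δ ?_)
            rw [mem_closedBall, dist_eq_norm, sub_add_cancel_left, norm_neg, norm_smul, norm_neg,
              he, mul_one, Real.norm_of_nonneg (ht0 m).le]
            exact htδ m
          rw [h1, h2, indicator_of_notMem hx]; simp
      · refine Tendsto.const_mul _ ?_
        have hl : HasDerivAt (fun τ : ℝ => x + τ • (-e)) (-e) 0 := by
          have := ((hasDerivAt_id (0 : ℝ)).smul_const (-e)).const_add x
          rwa [one_smul] at this
        have hd : HasDerivAt (fun τ : ℝ => φ (x + τ • (-e))) (fderiv ℝ φ x (-e)) 0 := by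
          have h1 : HasFDerivAt φ (fderiv ℝ φ x) (x + (0 : ℝ) • (-e)) := by
            rw [zero_smul, add_zero]; exact (hφ.differentiable (by simp) x).hasFDerivAt
          exact h1.comp_hasDerivAt (0 : ℝ) hl
        have := hd.tendsto_slope_zero.comp htlim
        simpa [Function.comp_def] using this
    have hl3 := hl2.mono_left (Nat.hyperfilter_le_atTop)
    simp only [← hswap] at hl3
    -- The same sequence has the weak limit on one side and, by smoothness of `φ`, the derivative of
    -- the test function on the other.
    have huniq := tendsto_nhds_unique hl1 hl3
    rw [huniq, setIntegral_eq_integral_of_forall_compl_eq_zero fun x hx => by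
      rw [hφd0 x hx, zero_apply, mul_zero], ← integral_neg]
    simp

end WeakDerivative

/-! ### Bounded representatives and the conclusion. -/

section Main

open Set Metric Filter
open scoped Topology

/-- Mollification and translation need functions defined and bounded on the whole plane. Truncation
and extension by zero provide them without changing anything almost everywhere on `Ω`. -/
theorem exists_bounded_representative {Ω : Set Plane} (hΩ : MeasurableSet Ω) {f : Plane → ℝ}
    (hf : AEStronglyMeasurable f (volume.restrict Ω)) {B : ℝ} (hB : 0 ≤ B)
    (hfB : ∀ᵐ x ∂(volume.restrict Ω), |f x| ≤ B) :
    ∃ g : Plane → ℝ, Measurable g ∧ (∀ x, |g x| ≤ B) ∧ (∀ x, x ∉ Ω → g x = 0) ∧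
      g =ᵐ[volume.restrict Ω] f := by
  refine ⟨Ω.indicator fun x => max (-B) (min B (hf.mk f x)), ?_, fun x => ?_, fun x hx => ?_, ?_⟩
  · exact (measurable_const.max
      (measurable_const.min hf.stronglyMeasurable_mk.measurable)).indicator hΩ
  · by_cases hx : x ∈ Ω
    · rw [indicator_of_mem hx, abs_le]
      exact ⟨le_max_left _ _, max_le (by linarith) (min_le_left _ _)⟩
    · rw [indicator_of_notMem hx, abs_zero]; exact hB
  · rw [indicator_of_notMem hx]
  · filter_upwards [hf.ae_eq_mk, hfB, ae_restrict_mem hΩ] with x h1 h2 h3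
    rw [indicator_of_mem h3, ← h1, min_eq_right (abs_le.1 h2).2, max_eq_right (abs_le.1 h2).1]

theorem HasWeakPartial.mono {Ω Ω' : Set Plane} {j : Fin 2} {u v : Plane → ℝ}
    (h : HasWeakPartial Ω j u v) (hsub : Ω' ⊆ Ω) : HasWeakPartial Ω' j u v := by
  refine ⟨h.1.mono_set hsub, h.2.1.mono_set hsub, fun φ hφ hφc hφΩ => ?_⟩
  have h0 : ∀ {S : Set Plane}, tsupport φ ⊆ S → ∀ x, x ∉ S → φ x = 0 := fun hS x hx =>
    image_eq_zero_of_notMem_tsupport fun h => hx (hS h)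
  have h1 : ∀ {S : Set Plane}, tsupport φ ⊆ S → ∀ x, x ∉ S → fderiv ℝ φ x = 0 := fun hS x hx =>
    image_eq_zero_of_notMem_tsupport fun h => hx (hS (tsupport_fderiv_subset ℝ h))
  have key := h.2.2 φ hφ hφc (hφΩ.trans hsub)
  rw [setIntegral_eq_integral_of_forall_compl_eq_zero fun x hx => by
      rw [h1 (hφΩ.trans hsub) x hx, zero_apply, mul_zero],
    setIntegral_eq_integral_of_forall_compl_eq_zero fun x hx => by
      rw [h0 (hφΩ.trans hsub) x hx, mul_zero]] at key
  rw [setIntegral_eq_integral_of_forall_compl_eq_zero fun x hx => by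
      rw [h1 hφΩ x hx, zero_apply, mul_zero],
    setIntegral_eq_integral_of_forall_compl_eq_zero fun x hx => by rw [h0 hφΩ x hx, mul_zero]]
  exact key

theorem norm_le_norm_fromRows {m₁ m₂ : Type} [Fintype m₁] [Fintype m₂]
    (A : Matrix m₁ (Fin 2) ℝ) (B : Matrix m₂ (Fin 2) ℝ) : ‖A‖ ≤ ‖Matrix.fromRows A B‖ := by
  apply le_of_sq_le_sq _ (norm_nonneg _)
  have h : ‖Matrix.fromRows A B‖ ^ 2 = ‖A‖ ^ 2 + ‖B‖ ^ 2 := by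
    simp [frobenius_norm_sq, Fintype.sum_sum_type]
  rw [h]
  nlinarith [sq_nonneg ‖B‖]

end Main

end

theorem mainTheorem6 (n : ℕ) (R : ℝ) (hR : 0 < R) :
    ∃ ε : ℝ, 0 < ε ∧
      ∀ (k : ℕ), 2 ≤ k → ∀ f : Matrix (Fin n) (Fin 2) ℝ → ℝ, ContDiff ℝ k f →
        c2Norm (fun X => f X - areaFun X) (Metric.ball 0 (2 * R)) ≤ ENNReal.ofReal ε →
        ∀ Ω : Set Plane, IsOpen Ω →
        ∀ (U : Plane → EuclideanSpace ℝ (BlockIdx n))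
          (DU : Plane → Matrix (BlockIdx n) (Fin 2) ℝ),
          MemSobolevVec 1 ∞ Ω U →
          HasWeakGradient Ω U DU →
          eLpNorm DU ∞ (volume.restrict Ω) ≤ ENNReal.ofReal R →
          (∀ᵐ x ∂(volume.restrict Ω), DU x ∈ inclusionSet f) →
          ∃ ρ : ℝ, 0 < ρ ∧ MemSobolevVecLoc 2 (ENNReal.ofReal (2 + ρ)) Ω U := by
  obtain ⟨ε, hε, c, hc, q, hell⟩ := exists_elliptic n R hR
  refine ⟨ε, hε, fun k hk f hf hfε Ω hΩ U DU hU hDU hDUR hincl => ?_⟩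
  obtain ⟨ρ, hρ, hdq⟩ := exists_lintegral_diffQuot_le q hc
  refine ⟨ρ, hρ, ?_⟩
  have hf2 : ContDiff ℝ 2 f := hf.of_le (by exact_mod_cast hk)
  have hell' := hell f hf2 hfε
  have hΩm : MeasurableSet Ω := hΩ.measurableSet
  have hDUn : ∀ᵐ x ∂(volume.restrict Ω), ‖DU x‖ ≤ R := by
    rw [eLpNorm_exponent_top] at hDUR
    filter_upwards [ae_le_eLpNormEssSup (f := DU) (μ := volume.restrict Ω)] with x hx
    have := hx.trans hDUR
    rwa [← ofReal_norm, ENNReal.ofReal_le_ofReal_iff hR.le] at this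
  have hUtop : ∀ a, MemLp (fun x => U x a) ∞ (volume.restrict Ω) := fun a => (hU a).1
  have hUb : ∀ a, ∃ B : ℝ, 0 ≤ B ∧ ∀ᵐ x ∂(volume.restrict Ω), |U x a| ≤ B := fun a => by
    have h1 := (hUtop a).2
    rw [eLpNorm_exponent_top] at h1
    refine ⟨(eLpNormEssSup (fun x => U x a) (volume.restrict Ω)).toReal, ENNReal.toReal_nonneg, ?_⟩
    filter_upwards [ae_le_eLpNormEssSup (f := fun x => U x a) (μ := volume.restrict Ω)] with x hx
    have := ENNReal.toReal_mono h1.ne hx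
    rwa [toReal_enorm, Real.norm_eq_abs] at this
  choose B hB0 hB using hUb
  have hur : ∀ a, ∃ g : Plane → ℝ, Measurable g ∧ (∀ x, |g x| ≤ ∑ a, B a) ∧
      (∀ x, x ∉ Ω → g x = 0) ∧ g =ᵐ[volume.restrict Ω] fun x => U x a := fun a => by
    refine exists_bounded_representative hΩm (hUtop a).1
      (Finset.sum_nonneg fun a _ => hB0 a) ?_
    filter_upwards [hB a] with x hx
    exact hx.trans (Finset.single_le_sum (fun i _ => hB0 i) (Finset.mem_univ a))
  choose u hum huB hu0 hueq using hur
  have hvr : ∀ a j, ∃ g : Plane → ℝ, Measurable g ∧ (∀ x, |g x| ≤ R) ∧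
      (∀ x, x ∉ Ω → g x = 0) ∧ g =ᵐ[volume.restrict Ω] fun x => DU x a j := fun a j => by
    refine exists_bounded_representative hΩm (hDU a j).2.1.aestronglyMeasurable hR.le ?_
    filter_upwards [hDUn] with x hx
    exact (abs_entry_le_norm _ a j).trans hx
  choose v hvm hvR hv0 hveq using hvr
  have hweak : ∀ a j, ∀ φ : Plane → ℝ, ContDiff ℝ ∞ φ → HasCompactSupport φ → tsupport φ ⊆ Ω →
      ∫ x, u a x * fderiv ℝ φ x (EuclideanSpace.single j 1) = -∫ x, v a j x * φ x := by
    intro a j φ hφ hφc hφΩ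
    have h := (hDU a j).2.2 φ hφ hφc hφΩ
    have e1 : ∫ x in Ω, u a x * fderiv ℝ φ x (EuclideanSpace.single j 1)
        = ∫ x in Ω, U x a * fderiv ℝ φ x (EuclideanSpace.single j 1) := by
      refine integral_congr_ae ?_
      filter_upwards [hueq a] with x hx
      rw [hx]
    have e2 : ∫ x in Ω, v a j x * φ x = ∫ x in Ω, DU x a j * φ x := by
      refine integral_congr_ae ?_
      filter_upwards [hveq a j] with x hx
      rw [hx]
    have z1 := setIntegral_eq_integral_of_forall_compl_eq_zero (μ := volume) (s := Ω)
      (f := fun x => u a x * fderiv ℝ φ x (EuclideanSpace.single j 1)) fun x hx => by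
        simp only [hu0 a x hx, zero_mul]
    have z2 := setIntegral_eq_integral_of_forall_compl_eq_zero (μ := volume) (s := Ω)
      (f := fun x => v a j x * φ x) fun x hx => by simp only [hv0 a j x hx, zero_mul]
    rw [← z1, ← z2, e1, e2]
    exact h
  -- The good points. The bound on $\|X\|$ is automatic there because `X` is a block of the
  -- gradient, and it places both points in the range of `exists_elliptic`.
  set S : Set Plane := {x | ∃ X : Matrix (Fin n) (Fin 2) ℝ, ‖X‖ ≤ R ∧
    Matrix.of (fun a j => v a j x) = inclusionMap f X} with hS
  have hSae : ∀ᵐ x, x ∈ Ω → x ∈ S := by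
    rw [← ae_restrict_iff' hΩm]
    have hveq' : ∀ᵐ x ∂(volume.restrict Ω), ∀ a j, v a j x = DU x a j := by
      rw [ae_all_iff]; intro a
      rw [ae_all_iff]; intro j
      exact hveq a j
    filter_upwards [hveq', hincl, hDUn] with x h1 h2 h3
    obtain ⟨X, hX⟩ := h2
    refine ⟨X, ?_, ?_⟩
    · rw [hX] at h3
      exact (norm_le_norm_fromRows X _).trans h3
    · rw [inclusionMap, ← hX]
      ext a j
      exact h1 a j
  have hSell : ∀ x ∈ S, ∀ y ∈ S, c * ‖Matrix.of (fun a j => v a j x - v a j y)‖ ^ 2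
      ≤ minorForm q (Matrix.of fun a j => v a j x - v a j y) := by
    rintro x ⟨X, hX, hx⟩ y ⟨Y, hY, hy⟩
    have e : (Matrix.of fun a j => v a j x - v a j y) = inclusionMap f X - inclusionMap f Y := by
      rw [← hx, ← hy]; rfl
    rw [e]
    exact hell' X Y hX hY
  intro Ω' hΩ' hcpt hsub
  have hΩ'Ω : Ω' ⊆ Ω := subset_closure.trans hsub
  have hfin : volume Ω' ≠ ⊤ := (measure_mono subset_closure).trans_lt hcpt.measure_lt_top |>.ne
  have : IsFiniteMeasure (volume.restrict Ω') := ⟨by simpa using hfin.lt_top⟩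
  obtain ⟨δ, M, hδ, hbound⟩ := hdq Ω u v _ R S hΩ hum hvm huB hvR hweak hSae hSell Ω' hΩ' hcpt hsub
  have hle : (volume.restrict Ω' : Measure Plane) ≤ volume.restrict Ω :=
    Measure.restrict_mono_set _ hΩ'Ω
  intro a
  refine ⟨((hUtop a).mono_measure hle).mono_exponent le_top, fun j => ⟨fun x => DU x a j,
    (hDU a j).mono hΩ'Ω, ?_, fun l => ?_⟩⟩
  · refine MemLp.of_bound ((hDU a j).2.1.aestronglyMeasurable.mono_measure hle) R
      (ae_mono hle ?_)
    filter_upwards [hDUn] with x hx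
    exact (abs_entry_le_norm _ a j).trans hx
  -- `M` carries no sign, so `max M 0` supplies the nonnegativity required here.
  · obtain ⟨g, hg, hgw⟩ := exists_weak_partial_of_diffQuot hfin (hvm a j) (hvR a j)
      (p := 2 + ρ) (M := max M 0) (by linarith) (le_max_right _ _) hδ
      (e := EuclideanSpace.single l 1) (by simp)
      (fun t ht htδ => (hbound l t ht htδ a j).trans
        (ENNReal.ofReal_le_ofReal (le_max_left _ _)))
    refine ⟨g, ⟨(hDU a j).2.1.mono_set hΩ'Ω, ?_, fun φ hφ hφc hφΩ => ?_⟩, hg⟩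
    · have hg1 : IntegrableOn g Ω' := hg.integrable (by
        rw [← ENNReal.ofReal_one]; exact ENNReal.ofReal_le_ofReal (by linarith))
      exact hg1.locallyIntegrableOn
    · rw [← hgw φ hφ hφc hφΩ]
      refine integral_congr_ae ?_
      filter_upwards [ae_mono hle (hveq a j)] with x hx
      rw [hx]
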